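/- For a simply connected domain $D\subsetneq\mathbb{C}$ let $\partial_C D$ be its set of prime ends (equivalence classes of null-chains of cross cuts, taken in the Riemann sphere). Let $\lambda_D$ be the hyperbolic density of $D$, normalised by $\lambda_{\mathbb D}(z)=\frac1{1-|z|^2}$ and $\lambda_D(f(z))\,|f'(z)|=\lambda_{\mathbb D}(z)$ for any Riemann map $f\colon\mathbb D\to D$, and let $d_D(z,w)=\inf_\gamma\int_\gamma\lambda_D(u)\,|du|$ be the hyperbolic distance, the infimum being over all piecewise $C^1$ curves $\gamma$ in $D$ joining $z$ and $w$. A geodesic of $\mathbb D$ is a piecewise $C^1$ curve whose hyperbolic length between any two of its parameters equals the hyperbolic distance of the corresponding points, and a geodesic $\gamma\colon[0,+\infty)\to D$ of $D$ is the image of a geodesic of $\mathbb D$ under a Riemann map $\mathbb D\to D$. A curve $\gamma\colon[0,+\infty)\to D$ lands at $\zeta\in\partial_CD$ if $f^{-1}(\gamma(t))\to\sigma$ as $t\to+\infty$, where $f\colon\mathbb D\to D$ is a Riemann map and $\sigma\in\partial\mathbb D$ is the point that the Carathéodory extension of $f$ takes to $\zeta$. For a geodesic $\gamma\colon[0,+\infty)\to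 D$, $t_0\ge0$ and $R>0$ put $$S_D(\gamma|_{[t_0,+\infty)},R)=\Bigl\{z\in D:\ \inf_{t\ge t_0}d_D(z,\gamma(t))<R\Bigr\}.$$ For simply connected domains $D_1\subset D_2\subsetneq\mathbb{C}$ and $\zeta\in\partial_CD_2$, say that $D_1$ is internally tangent to $D_2$ at $\zeta$ if there is a geodesic $\gamma\colon[0,+\infty)\to D_2$ of $D_2$ landing at $\zeta$ such that for every $R>0$ there is $t_0\ge 0$ with $S_{D_2}(\gamma|_{[t_0,+\infty)},R)\subset D_1$. **Theorem.** Let $D_1\subset D_2\subsetneq\mathbb{C}$ be two simply connected domains such that $D_1$ is internally tangent to $D_2$ at $\zeta\in\partial_CD_2$. Let $\gamma\colon[0,+\infty)\to D_2$ be any geodesic of $D_2$ landing at $\zeta$, and let $K>1$. Then for every $R>0$ there exists $t_1\ge0$ such that (a) $S_{D_2}(\gamma|_{[t_1,+\infty)},R)\subset D_1$; (b) $\lambda_{D_2}(z)\le\lambda_{D_1}(z)\le K\lambda_{D_2}(z)$ for all $z\in S_{D_2}(\gamma|_{[t_1,+\infty)},R)$; (c) $d_{D_2}(z,w)\le d_{D_1}(z,w)\le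 K\,d_{D_2}(z,w)$ for all $z,w\in S_{D_2}(\gamma|_{[t_1,+\infty)},R)$. -/

import Mathlib

open Set Filter Topology Metric

namespace HypGeom

noncomputable section

/-! ### The Riemann sphere with its spherical metric -/

/-- Half the chordal distance on `ℂ ∪ {∞}`:
`|z - w| / (√(1 + |z|²) √(1 + |w|²))`, with its limits at `∞`. -/
def halfChord : OnePoint ℂ → OnePoint ℂ → ℝ
  | OnePoint.some z, OnePoint.some w =>
      ‖z - w‖ / (Real.sqrt (1 + ‖z‖ ^ 2) * Real.sqrt (1 + ‖w‖ ^ 2))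
  | OnePoint.some z, OnePoint.infty => 1 / Real.sqrt (1 + ‖z‖ ^ 2)
  | OnePoint.infty, OnePoint.some w => 1 / Real.sqrt (1 + ‖w‖ ^ 2)
  | OnePoint.infty, OnePoint.infty => 0

/-- The spherical (great circle) distance on `ℂ ∪ {∞}`. -/
def sphericalDist (p q : OnePoint ℂ) : ℝ := 2 * Real.arcsin (halfChord p q)

/-- The spherical diameter of a subset of `ℂ ∪ {∞}`. -/
def sphericalDiam (S : Set (OnePoint ℂ)) : ℝ :=
  sSup {r | ∃ p ∈ S, ∃ q ∈ S, r = sphericalDist p q}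

/-! ### Prime ends -/

/-- `C` is a cross cut of `D`: a Jordan arc in the sphere whose interior lies in `D` and whose end
points lie on the boundary of `D` in the sphere. -/
def IsCrossCut (D : Set ℂ) (C : Set (OnePoint ℂ)) : Prop :=
  ∃ γ : ℝ → OnePoint ℂ, ContinuousOn γ (Icc 0 1) ∧ InjOn γ (Icc 0 1) ∧ C = γ '' Icc 0 1 ∧
    (∀ t ∈ Ioo (0 : ℝ) 1, γ t ∈ ((↑) : ℂ → OnePoint ℂ) '' D) ∧
    γ 0 ∈ frontier (((↑) : ℂ → OnePoint ℂ) '' D) ∧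
    γ 1 ∈ frontier (((↑) : ℂ → OnePoint ℂ) '' D)

/-- The part of `D` off the set `C` of the sphere. -/
def cutOff (D : Set ℂ) (C : Set (OnePoint ℂ)) : Set ℂ := {z ∈ D | (z : OnePoint ℂ) ∉ C}

/-- A null-chain `C₀, C₁, C₂, …` of cross cuts of `D`. -/
structure NullChain (D : Set ℂ) where
  /-- the cross cuts; the numbering starts at `0` -/
  cut : ℕ → Set (OnePoint ℂ)
  isCrossCut : ∀ n, IsCrossCut D (cut n)
  disjoint_cut : ∀ n m, n ≠ m → Disjoint (cut n) (cut m)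
  /-- `C₀ ∩ D` and `Cₙ₊₁ ∩ D` lie in different connected components of `D ∖ Cₙ`, for `n ≥ 1` -/
  separates : ∀ n, 1 ≤ n → ∀ z ∈ D, ∀ w ∈ D, (z : OnePoint ℂ) ∈ cut 0 →
    (w : OnePoint ℂ) ∈ cut (n + 1) →
    connectedComponentIn (cutOff D (cut n)) z ≠ connectedComponentIn (cutOff D (cut n)) w
  tendsto_diam : Tendsto (fun n => sphericalDiam (cut n)) atTop (𝓝 0)

/-- The interior part `Vₙ` of the cross cut `Cₙ` of a null-chain (for `n ≥ 1`): the component of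
`D ∖ Cₙ` that does not contain `C₀ ∩ D`. -/
def NullChain.interiorPart {D : Set ℂ} (C : NullChain D) (n : ℕ) : Set ℂ :=
  {z ∈ cutOff D (C.cut n) |
    ∀ w ∈ connectedComponentIn (cutOff D (C.cut n)) z, (w : OnePoint ℂ) ∉ C.cut 0}

/-- Equivalence of null-chains: every interior part of either one contains an interior part of the
other. (Interior parts are nested, so a common index `m` can be used in both inclusions.) -/
def NullChain.Equivalent {D : Set ℂ} (C C' : NullChain D) : Prop :=
  (∀ n, 1 ≤ n → ∃ m, 1 ≤ m ∧ C'.interiorPart m ⊆ C.interiorPart n) ∧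
  (∀ n, 1 ≤ n → ∃ m, 1 ≤ m ∧ C.interiorPart m ⊆ C'.interiorPart n)

instance NullChain.setoid (D : Set ℂ) : Setoid (NullChain D) where
  r := NullChain.Equivalent
  iseqv :=
    { refl := fun _ => ⟨fun n hn => ⟨n, hn, Subset.rfl⟩, fun n hn => ⟨n, hn, Subset.rfl⟩⟩
      symm := fun h => ⟨h.2, h.1⟩
      trans := by
        rintro A B C ⟨h1, h2⟩ ⟨h3, h4⟩
        refine ⟨fun n hn => ?_, fun n hn => ?_⟩
        · obtain ⟨m, hm, hs⟩ := h1 n hn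
          obtain ⟨k, hk, hs'⟩ := h3 m hm
          exact ⟨k, hk, hs'.trans hs⟩
        · obtain ⟨m, hm, hs⟩ := h4 n hn
          obtain ⟨k, hk, hs'⟩ := h2 m hm
          exact ⟨k, hk, hs'.trans hs⟩ }

/-- The prime ends of `D`: equivalence classes of null-chains. -/
def PrimeEnd (D : Set ℂ) : Type := Quotient (NullChain.setoid D)

/-- The trace on `D` of the neighbourhood filter of `ζ` in the Carathéodory topology: it is
generated by the interior parts of the null-chains that represent `ζ`. -/
def PrimeEnd.nhdsTrace {D : Set ℂ} (ζ : PrimeEnd D) : Filter ℂ :=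
  ⨅ (C : NullChain D) (_ : (Quotient.mk (NullChain.setoid D) C : PrimeEnd D) = ζ)
    (n : ℕ) (_ : 1 ≤ n), 𝓟 (C.interiorPart n)

/-! ### Riemann maps and landing -/

/-- `f` restricts to a biholomorphism of the unit disc onto `D`. -/
def IsRiemannMap (f : ℂ → ℂ) (D : Set ℂ) : Prop :=
  DifferentiableOn ℂ f (ball 0 1) ∧ InjOn f (ball 0 1) ∧ f '' ball 0 1 = D

/-- The Carathéodory extension of the Riemann map `f : 𝔻 → D` takes the boundary point `σ` to the
prime end `ζ`, that is, `f z → ζ` in the Carathéodory topology as `z → σ` in `𝔻`. -/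
def CaratheodoryMapsTo {D : Set ℂ} (f : ℂ → ℂ) (σ : ℂ) (ζ : PrimeEnd D) : Prop :=
  Tendsto f (𝓝[ball 0 1] σ) ζ.nhdsTrace

/-- The curve `γ : [0, ∞) → D` lands at the prime end `ζ` of `D`: `f⁻¹ (γ t) → σ` as `t → ∞`, where
`f : 𝔻 → D` is a Riemann map and `σ` is the boundary point with `f σ = ζ`. -/
def LandsAt {D : Set ℂ} (γ : ℝ → ℂ) (ζ : PrimeEnd D) : Prop :=
  ∃ (f : ℂ → ℂ) (σ : ℂ), IsRiemannMap f D ∧ σ ∈ sphere (0 : ℂ) 1 ∧ CaratheodoryMapsTo f σ ζ ∧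
    Tendsto (fun t => Function.invFunOn f (ball 0 1) (γ t)) atTop (𝓝 σ)

/-! ### Hyperbolic metric, length, distance and geodesics -/

/-- `γ` is piecewise continuously differentiable on `[a, b]`: there is a subdivision
`a = s₀ ≤ s₁ ≤ … ≤ sₙ = b` such that `γ` is `C¹` on each closed interval `[sᵢ, sᵢ₊₁]`. -/
def PiecewiseC1On (γ : ℝ → ℂ) (a b : ℝ) : Prop :=
  ∃ (n : ℕ) (s : ℕ → ℝ), Monotone s ∧ s 0 = a ∧ s n = b ∧
    ∀ i < n, ContDiffOn ℝ 1 γ (Icc (s i) (s (i + 1)))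

/-- The length `∫ ρ(γ(t)) |γ'(t)| dt` of `γ` on `[a, b]` with respect to the metric `ρ(z) |dz|`. -/
def metricLength (ρ : ℂ → ℝ) (γ : ℝ → ℂ) (a b : ℝ) : ℝ :=
  ∫ t in a..b, ρ (γ t) * ‖deriv γ t‖

/-- The infimum of the `ρ`-lengths of the piecewise `C¹` curves in `D` from `z` to `w`. -/
def metricDist (ρ : ℂ → ℝ) (D : Set ℂ) (z w : ℂ) : ℝ :=
  sInf {l | ∃ (γ : ℝ → ℂ) (a b : ℝ), a ≤ b ∧ PiecewiseC1On γ a b ∧ MapsTo γ (Icc a b) D ∧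
    γ a = z ∧ γ b = w ∧ l = metricLength ρ γ a b}

/-- The hyperbolic density of the unit disc. -/
def discDensity (z : ℂ) : ℝ := 1 / (1 - ‖z‖ ^ 2)

/-- The hyperbolic distance of the unit disc. -/
def discDist (z w : ℂ) : ℝ := metricDist discDensity (ball 0 1) z w

/-- The hyperbolic density `λ_D` of a simply connected domain `D ≠ ℂ`: `λ_D(z)` is the number with
`λ_D(z) |f'(w)| = λ_𝔻(w)` where `f : 𝔻 → D` is a Riemann map and `f(w) = z`. It does not depend on
the Riemann map. -/
def hypDensity (D : Set ℂ) (z : ℂ) : ℝ :=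
  Classical.epsilon fun x : ℝ => ∃ (f : ℂ → ℂ) (w : ℂ), IsRiemannMap f D ∧ w ∈ ball (0 : ℂ) 1 ∧
    f w = z ∧ x * ‖deriv f w‖ = discDensity w

/-- The hyperbolic distance `d_D` of a simply connected domain `D ≠ ℂ`. -/
def hypDist (D : Set ℂ) (z w : ℂ) : ℝ := metricDist (hypDensity D) D z w

/-- `γ : [0, ∞) → 𝔻` is a geodesic of the unit disc. -/
def IsDiscGeodesicRay (γ : ℝ → ℂ) : Prop :=
  (∀ T, 0 ≤ T → PiecewiseC1On γ 0 T) ∧ MapsTo γ (Ici 0) (ball 0 1) ∧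
    ∀ t₁ t₂, 0 ≤ t₁ → t₁ ≤ t₂ → metricLength discDensity γ t₁ t₂ = discDist (γ t₁) (γ t₂)

/-- `γ : [0, ∞) → D` is a geodesic of the simply connected domain `D ≠ ℂ`: the image of a geodesic
of the unit disc under a Riemann map. -/
def IsGeodesicRay (D : Set ℂ) (γ : ℝ → ℂ) : Prop :=
  ∃ (f : ℂ → ℂ) (η : ℝ → ℂ), IsRiemannMap f D ∧ IsDiscGeodesicRay η ∧
    ∀ t, 0 ≤ t → γ t = f (η t)

/-! ### Sectors and internal tangency -/

/-- The tail `S_D(γ|_{[t₀, ∞)}, R)` of the hyperbolic sector of amplitude `R` around `γ`. -/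
def sector (D : Set ℂ) (γ : ℝ → ℂ) (t₀ R : ℝ) : Set ℂ :=
  {z ∈ D | (⨅ t : Ici t₀, hypDist D z (γ t)) < R}

/-- `D₁` is internally tangent to `D₂` at the prime end `ζ` of `D₂`. -/
def InternallyTangent (D₁ D₂ : Set ℂ) (ζ : PrimeEnd D₂) : Prop :=
  ∃ γ : ℝ → ℂ, IsGeodesicRay D₂ γ ∧ LandsAt γ ζ ∧
    ∀ R, 0 < R → ∃ t₀, 0 ≤ t₀ ∧ sector D₂ γ t₀ R ⊆ D₁

end

end HypGeom

namespace HypGeom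

/-! ### Injective holomorphic maps and their inverses -/

/-! Transport `D₂` to the right half-plane by a Riemann map and a Möbius map that sends the boundary
point corresponding to `ζ` to `∞`. There every geodesic landing at `ζ` is a horizontal half-line
(`IsGeodesicRay.exists_horizontal`), and the tails of its sectors are interleaved with the truncated
angles `wedge B X` (`IsHalfPlaneMap.sector_subset`, `IsHalfPlaneMap.exists_wedge_subset_sector`).
The height of the half-line plays no role far out, so tangency along one geodesic means that for
every slope `B` the domain `D₁` contains the image of some `wedge B X`. This gives (a) for every
other geodesic.

The lower bounds in (b) and (c) are Schwarz–Pick for the inclusion. For the upper bound in (b), all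
points at pseudohyperbolic distance at most `1 / K` from a point deep in a wedge lie in a wider
wedge, hence in `D₁`. A Riemann map of `D₂` centred at that point and precomposed with `v ↦ v / K`
then maps the disc into `D₁`, and Schwarz–Pick yields the factor `K`
(`IsHalfPlaneMap.hypDensity_le`). For (c), truncated wedges are hyperbolically convex
(`chart_radial_mem_wedge`), so the `D₂`-geodesic between two points stays where the density bound
holds, and the bound is integrated along it.

Two inputs need real work. The density of `D₁` is meaningful only if `D₁` has a Riemann map; since
`D₁` embeds into the disc by the inverse Riemann map of `D₂`, the extremal proof applies directly
(`exists_isRiemannMap`). Moreover, each landing geodesic comes with its own Riemann map, and both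
must be moved to one half-plane. This requires that points tending to the prime end have preimages
tending to the corresponding boundary point (`tendsto_of_tendsto_nhdsTrace`). It rests on Koebe's
lemma: the preimages of the cross cuts of a null-chain cannot accumulate at two boundary points,
since otherwise a bounded injective function would have the same radial cluster value along a whole
arc. -/

theorem invFunOn_image {f : ℂ → ℂ} {U : Set ℂ} (hi : InjOn f U) {z : ℂ} (hz : z ∈ U) :
    Function.invFunOn f U (f z) = z :=
  hi (Function.invFunOn_mem ⟨z, hz, rfl⟩) hz (Function.invFunOn_eq ⟨z, hz, rfl⟩)

theorem not_eventually_const_of_injOn {f : ℂ → ℂ} {U : Set ℂ} (hU : IsOpen U) (hi : InjOn f U)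
    {z : ℂ} (hz : z ∈ U) : ¬ ∀ᶠ w in 𝓝 z, f w = f z := by
  intro h
  have h2 : ∀ᶠ w in 𝓝[≠] z, w = z := by
    filter_upwards [(h.and (hU.mem_nhds hz)).filter_mono nhdsWithin_le_nhds] with w hw
    exact hi hw.2 hz hw.1
  obtain ⟨w, hw, hw'⟩ := (h2.and self_mem_nhdsWithin).exists
  exact hw' hw

theorem nhds_le_map_of_injOn {f : ℂ → ℂ} {U : Set ℂ} (hU : IsOpen U)
    (hf : DifferentiableOn ℂ f U) (hi : InjOn f U) {z : ℂ} (hz : z ∈ U) :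
    𝓝 (f z) ≤ map f (𝓝 z) :=
  ((hf.analyticAt (hU.mem_nhds hz)).eventually_constant_or_nhds_le_map_nhds).resolve_left
    (not_eventually_const_of_injOn hU hi hz)

theorem isOpen_image_of_injOn {f : ℂ → ℂ} {U : Set ℂ} (hU : IsOpen U)
    (hf : DifferentiableOn ℂ f U) (hi : InjOn f U) : IsOpen (f '' U) := by
  rw [isOpen_iff_mem_nhds]
  rintro _ ⟨z, hz, rfl⟩
  exact nhds_le_map_of_injOn hU hf hi hz (image_mem_map (hU.mem_nhds hz))

theorem continuousAt_invFunOn {f : ℂ → ℂ} {U : Set ℂ} (hU : IsOpen U)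
    (hf : DifferentiableOn ℂ f U) (hi : InjOn f U) {z : ℂ} (hz : z ∈ U) :
    ContinuousAt (Function.invFunOn f U) (f z) := by
  intro V hV
  rw [invFunOn_image hi hz] at hV
  have := nhds_le_map_of_injOn hU hf hi hz (image_mem_map (inter_mem hV (hU.mem_nhds hz)))
  rw [mem_map]
  filter_upwards [this]
  rintro _ ⟨w, hw, rfl⟩
  simpa [invFunOn_image hi hw.2] using hw.1

theorem hasDerivAt_invFunOn_of_ne {f : ℂ → ℂ} {U : Set ℂ} (hU : IsOpen U)
    (hf : DifferentiableOn ℂ f U) (hi : InjOn f U) {z : ℂ} (hz : z ∈ U) (h : deriv f z ≠ 0) :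
    HasDerivAt (Function.invFunOn f U) (deriv f z)⁻¹ (f z) := by
  refine HasDerivAt.of_local_left_inverse (f := f) (continuousAt_invFunOn hU hf hi hz) ?_ h ?_
  · rw [invFunOn_image hi hz]
    exact (hf.differentiableAt (hU.mem_nhds hz)).hasDerivAt
  · filter_upwards [(isOpen_image_of_injOn hU hf hi).mem_nhds (mem_image_of_mem f hz)]
    rintro _ ⟨w, hw, rfl⟩
    rw [invFunOn_image hi hw]

/-- If `f'` vanished at `z`, it would be an isolated zero, as `f` is not locally constant. The
inverse is then holomorphic off `f z` and continuous there, hence holomorphic by removability, and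
the chain rule gives `0 = 1`. -/
theorem deriv_ne_zero_of_injOn {f : ℂ → ℂ} {U : Set ℂ} (hU : IsOpen U)
    (hf : DifferentiableOn ℂ f U) (hi : InjOn f U) {z : ℂ} (hz : z ∈ U) : deriv f z ≠ 0 := by
  intro h0
  have hfa := hf.analyticAt (hU.mem_nhds hz)
  rcases hfa.deriv.eventually_eq_zero_or_eventually_ne_zero with h | h
  · obtain ⟨r, hr, hb⟩ := Metric.eventually_nhds_iff_ball.1 (h.and (hU.mem_nhds hz))
    obtain ⟨a, ha⟩ := isOpen_ball.exists_is_const_of_deriv_eq_zero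
      (convex_ball z r).isPreconnected (hf.mono fun w hw => (hb w hw).2) (fun w hw => (hb w hw).1)
    refine not_eventually_const_of_injOn hU hi hz ?_
    filter_upwards [ball_mem_nhds z hr] with w hw
    rw [ha w hw, ha z (mem_ball_self hr)]
  · rw [eventually_nhdsWithin_iff] at h
    obtain ⟨V, hV, hVo, hzV⟩ := _root_.mem_nhds_iff.1 (h.and (hU.mem_nhds hz))
    have hVU : V ⊆ U := fun w hw => (hV hw).2
    have hs : f '' V ∈ 𝓝 (f z) :=
      nhds_le_map_of_injOn hU hf hi hz (image_mem_map (hVo.mem_nhds hzV))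
    have hd : DifferentiableOn ℂ (Function.invFunOn f U) (f '' V) := by
      rw [← Complex.differentiableOn_compl_singleton_and_continuousAt_iff hs]
      refine ⟨?_, continuousAt_invFunOn hU hf hi hz⟩
      rintro _ ⟨⟨w, hw, rfl⟩, hne⟩
      have hwz : w ≠ z := fun e => hne (by simp [e])
      exact (hasDerivAt_invFunOn_of_ne hU hf hi (hVU hw)
        ((hV hw).1 hwz)).differentiableAt.differentiableWithinAt
    have h1 := (hd.differentiableAt hs).hasDerivAt.comp z
      (hf.differentiableAt (hU.mem_nhds hz)).hasDerivAt
    have h2 : HasDerivAt (Function.invFunOn f U ∘ f) 1 z := by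
      refine (hasDerivAt_id z).congr_of_eventuallyEq ?_
      filter_upwards [hU.mem_nhds hz] with w hw
      simp [invFunOn_image hi hw]
    have := h1.unique h2
    simp [h0] at this

theorem hasDerivAt_invFunOn {f : ℂ → ℂ} {U : Set ℂ} (hU : IsOpen U)
    (hf : DifferentiableOn ℂ f U) (hi : InjOn f U) {z : ℂ} (hz : z ∈ U) :
    HasDerivAt (Function.invFunOn f U) (deriv f z)⁻¹ (f z) :=
  hasDerivAt_invFunOn_of_ne hU hf hi hz (deriv_ne_zero_of_injOn hU hf hi hz)

theorem differentiableOn_invFunOn {f : ℂ → ℂ} {U : Set ℂ} (hU : IsOpen U)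
    (hf : DifferentiableOn ℂ f U) (hi : InjOn f U) :
    DifferentiableOn ℂ (Function.invFunOn f U) (f '' U) := by
  rintro _ ⟨z, hz, rfl⟩
  exact (hasDerivAt_invFunOn hU hf hi hz).differentiableAt.differentiableWithinAt

/-! ### Automorphisms of the unit disc and the Schwarz–Pick lemma -/

/-- The automorphism `z ↦ (z + a) / (1 + conj a * z)` of the unit disc. -/
noncomputable def mob (a z : ℂ) : ℂ := (z + a) / (1 + starRingEnd ℂ a * z)

theorem one_add_conj_mul_ne_zero {a z : ℂ} (ha : ‖a‖ < 1) (hz : ‖z‖ < 1) :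
    1 + starRingEnd ℂ a * z ≠ 0 := by
  intro h
  have h1 : starRingEnd ℂ a * z = -1 := by linear_combination h
  have h2 : ‖a‖ * ‖z‖ = 1 := by simpa using congrArg norm h1
  nlinarith [norm_nonneg a, norm_nonneg z]

theorem one_sub_normSq_mob {a z : ℂ} (ha : ‖a‖ < 1) (hz : ‖z‖ < 1) :
    1 - ‖mob a z‖ ^ 2 =
      (1 - ‖a‖ ^ 2) * (1 - ‖z‖ ^ 2) / ‖1 + starRingEnd ℂ a * z‖ ^ 2 := by
  have h0 := norm_pos_iff.2 (one_add_conj_mul_ne_zero ha hz)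
  rw [mob, norm_div, div_pow, eq_div_iff (by positivity), sub_mul, div_mul_cancel₀ _ (by positivity)]
  simp only [← Complex.normSq_eq_norm_sq, Complex.normSq_apply]
  simp
  ring

theorem norm_mob_lt {a z : ℂ} (ha : ‖a‖ < 1) (hz : ‖z‖ < 1) : ‖mob a z‖ < 1 := by
  have h0 := norm_pos_iff.2 (one_add_conj_mul_ne_zero ha hz)
  have h1 := one_sub_normSq_mob ha hz
  have h2 : 0 < (1 - ‖a‖ ^ 2) * (1 - ‖z‖ ^ 2) / ‖1 + starRingEnd ℂ a * z‖ ^ 2 := by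
    apply div_pos (mul_pos _ _) (by positivity)
    · nlinarith [norm_nonneg a]
    · nlinarith [norm_nonneg z]
  nlinarith [norm_nonneg (mob a z)]

theorem hasDerivAt_mob {a z : ℂ} (ha : ‖a‖ < 1) (hz : ‖z‖ < 1) :
    HasDerivAt (mob a) ((1 - ‖a‖ ^ 2 : ℝ) / (1 + starRingEnd ℂ a * z) ^ 2) z := by
  have h0 := one_add_conj_mul_ne_zero ha hz
  have h := ((hasDerivAt_id z).add_const a).div
    (((hasDerivAt_id z).const_mul (starRingEnd ℂ a)).const_add 1) h0
  refine h.congr_deriv ?_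
  have e : ((1 - ‖a‖ ^ 2 : ℝ) : ℂ) = 1 - starRingEnd ℂ a * a := by
    rw [← Complex.normSq_eq_norm_sq, ← Complex.normSq_eq_conj_mul_self]
    push_cast
    rfl
  rw [e]
  simp only [id]
  ring

@[simp] theorem mob_zero (a : ℂ) : mob a 0 = a := by simp [mob]

@[simp] theorem mob_neg_self (a : ℂ) : mob (-a) a = 0 := by simp [mob]

theorem mob_neg_mob {a z : ℂ} (ha : ‖a‖ < 1) (hz : ‖z‖ < 1) : mob (-a) (mob a z) = z := by
  have h0 := one_add_conj_mul_ne_zero ha hz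
  have h1 := one_add_conj_mul_ne_zero (a := -a) (by simpa using ha) (norm_mob_lt ha hz)
  have h2 : (1 : ℂ) - starRingEnd ℂ a * a ≠ 0 := by
    have := one_add_conj_mul_ne_zero (a := -a) (z := a) (by simpa using ha) ha
    simpa [sub_eq_add_neg] using this
  rw [mob, div_eq_iff h1]
  have e : mob a z * (1 + starRingEnd ℂ a * z) = z + a := by rw [mob, div_mul_cancel₀ _ h0]
  simp only [map_neg]
  apply mul_right_cancel₀ h0
  linear_combination (1 + starRingEnd ℂ a * z) * e

theorem differentiableOn_mob {a : ℂ} (ha : ‖a‖ < 1) : DifferentiableOn ℂ (mob a) (ball 0 1) :=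
  fun _ hz => (hasDerivAt_mob ha (by simpa using hz)).differentiableAt.differentiableWithinAt

theorem mapsTo_mob {a : ℂ} (ha : ‖a‖ < 1) : MapsTo (mob a) (ball 0 1) (ball 0 1) :=
  fun z hz => by simpa using norm_mob_lt ha (by simpa using hz)

theorem injOn_mob {a : ℂ} (ha : ‖a‖ < 1) : InjOn (mob a) (ball 0 1) := by
  intro z hz w hw h
  rw [← mob_neg_mob (z := z) ha (by simpa using hz), h, mob_neg_mob ha (by simpa using hw)]

theorem norm_deriv_mob_zero {a : ℂ} (ha : ‖a‖ < 1) : ‖deriv (mob a) 0‖ = 1 - ‖a‖ ^ 2 := by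
  rw [(hasDerivAt_mob ha (by simp)).deriv]
  simp only [mul_zero, add_zero, one_pow, div_one, Complex.norm_real, Real.norm_eq_abs]
  exact abs_of_pos (by nlinarith [norm_nonneg a])

theorem norm_deriv_mob_neg_self {a : ℂ} (ha : ‖a‖ < 1) :
    ‖deriv (mob (-a)) a‖ = 1 / (1 - ‖a‖ ^ 2) := by
  have hp : 0 < 1 - ‖a‖ ^ 2 := by nlinarith [norm_nonneg a]
  rw [(hasDerivAt_mob (by simpa using ha) ha).deriv]
  have : (1 : ℂ) + starRingEnd ℂ (-a) * a = ((1 - ‖a‖ ^ 2 : ℝ) : ℂ) := by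
    rw [← Complex.normSq_eq_norm_sq]
    push_cast
    rw [Complex.normSq_eq_conj_mul_self]
    simp [sub_eq_add_neg]
  rw [this, norm_neg, norm_div, norm_pow, Complex.norm_real, Real.norm_of_nonneg hp.le]
  field_simp

/-- The Schwarz–Pick lemma for the derivative. -/
theorem schwarz_pick {ψ : ℂ → ℂ} (hd : DifferentiableOn ℂ ψ (ball 0 1))
    (hm : MapsTo ψ (ball 0 1) (ball 0 1)) {w : ℂ} (hw : w ∈ ball (0 : ℂ) 1) :
    discDensity (ψ w) * ‖deriv ψ w‖ ≤ discDensity w := by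
  have hw1 : ‖w‖ < 1 := by simpa using hw
  have hψ1 : ‖ψ w‖ < 1 := by simpa using hm hw
  have hψ1' : ‖-ψ w‖ < 1 := by simpa using hψ1
  have h0 : (0 : ℂ) ∈ ball (0 : ℂ) 1 := by simp
  have hφd : DifferentiableOn ℂ (mob (-ψ w) ∘ ψ ∘ mob w) (ball 0 1) :=
    (differentiableOn_mob hψ1').comp (hd.comp (differentiableOn_mob hw1) (mapsTo_mob hw1))
      (hm.comp (mapsTo_mob hw1))
  have hφm : MapsTo (mob (-ψ w) ∘ ψ ∘ mob w) (ball 0 1) (ball 0 1) :=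
    (mapsTo_mob hψ1').comp (hm.comp (mapsTo_mob hw1))
  have hφ0 : (mob (-ψ w) ∘ ψ ∘ mob w) 0 = 0 := by simp
  have h := Complex.norm_deriv_le_one_of_mapsTo_ball hφd
    (by rw [hφ0]; exact hφm.mono_right ball_subset_closedBall) one_pos
  have e1 : HasDerivAt (ψ ∘ mob w) (deriv ψ w * deriv (mob w) 0) 0 := by
    refine HasDerivAt.comp 0 ?_
      ((differentiableOn_mob hw1).differentiableAt (isOpen_ball.mem_nhds h0)).hasDerivAt
    rw [mob_zero]
    exact (hd.differentiableAt (isOpen_ball.mem_nhds hw)).hasDerivAt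
  have e2 : HasDerivAt (mob (-ψ w) ∘ ψ ∘ mob w)
      (deriv (mob (-ψ w)) (ψ w) * (deriv ψ w * deriv (mob w) 0)) 0 := by
    refine HasDerivAt.comp 0 ?_ e1
    simp only [Function.comp_apply, mob_zero]
    exact ((differentiableOn_mob hψ1').differentiableAt
      (isOpen_ball.mem_nhds (hm hw))).hasDerivAt
  rw [e2.deriv, norm_mul, norm_mul, norm_deriv_mob_zero hw1, norm_deriv_mob_neg_self hψ1] at h
  have hp : 0 < 1 - ‖w‖ ^ 2 := by nlinarith [norm_nonneg w]
  unfold discDensity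
  rw [le_div_iff₀ hp]
  linarith

end HypGeom

namespace HypGeom

open MeasureTheory

/-! ### Piecewise `C¹` curves -/

theorem exists_mem_Icc_of_monotone {s : ℕ → ℝ} {t : ℝ} {n : ℕ} (hn : 0 < n)
    (ht : t ∈ Icc (s 0) (s n)) : ∃ i < n, t ∈ Icc (s i) (s (i + 1)) := by
  induction n with
  | zero => exact absurd hn (lt_irrefl 0)
  | succ k ih =>
    rcases le_total t (s k) with h | h
    · rcases Nat.eq_zero_or_pos k with rfl | hk
      · exact ⟨0, by simp, ht⟩
      · obtain ⟨i, hi, hti⟩ := ih hk ⟨ht.1, h⟩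
        exact ⟨i, hi.trans (Nat.lt_succ_self k), hti⟩
    · exact ⟨k, Nat.lt_succ_self k, h, ht.2⟩

theorem PiecewiseC1On.continuousOn {γ : ℝ → ℂ} {a b : ℝ} (h : PiecewiseC1On γ a b) :
    ContinuousOn γ (Icc a b) := by
  obtain ⟨n, s, hs, rfl, rfl, hd⟩ := h
  induction n with
  | zero => simp
  | succ k ih =>
    rw [← Icc_union_Icc_eq_Icc (hs (Nat.zero_le k)) (hs (Nat.le_succ k))]
    exact (ih fun i hi => hd i (hi.trans (Nat.lt_succ_self k))).union_of_isClosed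
      (hd k (Nat.lt_succ_self k)).continuousOn isClosed_Icc isClosed_Icc

theorem PiecewiseC1On.exists_countable {γ : ℝ → ℂ} {a b : ℝ} (h : PiecewiseC1On γ a b) :
    ∃ E : Set ℝ, E.Countable ∧ ∀ t ∈ Ioo a b \ E, DifferentiableAt ℝ γ t := by
  obtain ⟨n, s, hs, rfl, rfl, hd⟩ := h
  refine ⟨range s, countable_range s, fun t ht => ?_⟩
  rcases Nat.eq_zero_or_pos n with rfl | hn
  · simp at ht
  obtain ⟨i, hi, hti⟩ := exists_mem_Icc_of_monotone hn (Ioo_subset_Icc_self ht.1)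
  have h1 : s i < t := lt_of_le_of_ne hti.1 fun e => ht.2 ⟨i, e⟩
  have h2 : t < s (i + 1) := lt_of_le_of_ne hti.2 fun e => ht.2 ⟨i + 1, e.symm⟩
  exact ((hd i hi).differentiableOn one_ne_zero).differentiableAt (Icc_mem_nhds h1 h2)

theorem PiecewiseC1On.intervalIntegrable_deriv {γ : ℝ → ℂ} {a b : ℝ}
    (h : PiecewiseC1On γ a b) : IntervalIntegrable (deriv γ) volume a b := by
  obtain ⟨n, s, hs, rfl, rfl, hd⟩ := h
  refine IntervalIntegrable.trans_iterate fun k hk => ?_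
  rcases (hs (Nat.le_succ k)).eq_or_lt with e | hlt
  · simp only [Nat.succ_eq_add_one] at e
    rw [e]
  rw [intervalIntegrable_iff_integrableOn_Ioo_of_le hlt.le]
  have hc : ContinuousOn (derivWithin γ (Icc (s k) (s (k + 1)))) (Icc (s k) (s (k + 1))) :=
    (hd k hk).continuousOn_derivWithin (uniqueDiffOn_Icc hlt) le_rfl
  refine ((hc.integrableOn_Icc).mono_set Ioo_subset_Icc_self).congr_fun (fun t ht => ?_)
    measurableSet_Ioo
  exact derivWithin_of_mem_nhds (Icc_mem_nhds ht.1 ht.2)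

theorem PiecewiseC1On.comp {γ : ℝ → ℂ} {a b : ℝ} (h : PiecewiseC1On γ a b) {g : ℂ → ℂ}
    {A : Set ℂ} (hA : IsOpen A) (hg : DifferentiableOn ℂ g A) (hm : MapsTo γ (Icc a b) A) :
    PiecewiseC1On (g ∘ γ) a b := by
  obtain ⟨n, s, hs, rfl, rfl, hd⟩ := h
  refine ⟨n, s, hs, rfl, rfl, fun i hi => ?_⟩
  have hg' : ContDiffOn ℝ 1 g A := (hg.contDiffOn hA).restrict_scalars ℝ
  exact hg'.comp (hd i hi) (hm.mono_left (Icc_subset_Icc (hs (Nat.zero_le i)) (hs hi)))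

theorem PiecewiseC1On.of_contDiff {γ : ℝ → ℂ} (h : ContDiff ℝ 1 γ) {a b : ℝ} (hab : a ≤ b) :
    PiecewiseC1On γ a b := by
  refine ⟨1, fun i => if i = 0 then a else b, fun i j hij => ?_, by simp, by simp,
    fun i _ => h.contDiffOn⟩
  by_cases hi : i = 0
  · by_cases hj : j = 0 <;> simp [hi, hj, hab]
  · have : j ≠ 0 := by omega
    simp [hi, this]

/-! ### Lengths -/

theorem intervalIntegrable_length {γ : ℝ → ℂ} {a b : ℝ} (hab : a ≤ b) (h : PiecewiseC1On γ a b)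
    {ρ : ℂ → ℝ} {A : Set ℂ} (hρ : ContinuousOn ρ A) (hm : MapsTo γ (Icc a b) A) :
    IntervalIntegrable (fun t => ρ (γ t) * ‖deriv γ t‖) volume a b := by
  refine h.intervalIntegrable_deriv.norm.continuousOn_mul ?_
  rw [uIcc_of_le hab]
  exact hρ.comp h.continuousOn hm

theorem metricLength_nonneg {γ : ℝ → ℂ} {a b : ℝ} (hab : a ≤ b) {ρ : ℂ → ℝ} {A : Set ℂ}
    (hρ : ∀ z ∈ A, 0 ≤ ρ z) (hm : MapsTo γ (Icc a b) A) : 0 ≤ metricLength ρ γ a b :=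
  intervalIntegral.integral_nonneg hab fun _ ht => mul_nonneg (hρ _ (hm ht)) (norm_nonneg _)

theorem metricLength_mono {γ : ℝ → ℂ} {a b : ℝ} (hab : a ≤ b) (h : PiecewiseC1On γ a b)
    {ρ₁ ρ₂ : ℂ → ℝ} {A : Set ℂ} (h1 : ContinuousOn ρ₁ A) (h2 : ContinuousOn ρ₂ A) {T : Set ℂ}
    (hTA : T ⊆ A) (hm : MapsTo γ (Icc a b) T) {K : ℝ} (hle : ∀ z ∈ T, ρ₁ z ≤ K * ρ₂ z) :
    metricLength ρ₁ γ a b ≤ K * metricLength ρ₂ γ a b := by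
  rw [metricLength, metricLength, ← intervalIntegral.integral_const_mul]
  refine intervalIntegral.integral_mono_on hab
    (intervalIntegrable_length hab h h1 (hm.mono_right hTA))
    ((intervalIntegrable_length hab h h2 (hm.mono_right hTA)).const_mul K) fun t ht => ?_
  rw [← mul_assoc]
  exact mul_le_mul_of_nonneg_right (hle _ (hm ht)) (norm_nonneg _)

/-- The chain rule can fail only at the break points and the right end point, a null set for the
integral. -/
theorem metricLength_comp {γ : ℝ → ℂ} {a b : ℝ} (hab : a ≤ b) (h : PiecewiseC1On γ a b)
    {g : ℂ → ℂ} {A : Set ℂ} (hA : IsOpen A) (hg : DifferentiableOn ℂ g A)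
    (hm : MapsTo γ (Icc a b) A) {ρA ρB : ℂ → ℝ}
    (hρ : ∀ u ∈ A, ρB (g u) * ‖deriv g u‖ = ρA u) :
    metricLength ρB (g ∘ γ) a b = metricLength ρA γ a b := by
  obtain ⟨E, hE, hd⟩ := h.exists_countable
  refine intervalIntegral.integral_congr_ae ?_
  have h0 : ∀ᵐ t : ℝ, t ∉ E ∪ {b} := (hE.union (countable_singleton b)).ae_notMem volume
  filter_upwards [h0] with t ht htm
  rw [uIoc_of_le hab] at htm
  have htb : t ≠ b := fun e => ht (Or.inr e)
  have hγ := (hd t ⟨⟨htm.1, lt_of_le_of_ne htm.2 htb⟩, fun e => ht (Or.inl e)⟩).hasDerivAt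
  have hA' := hm (Ioc_subset_Icc_self htm)
  have hc := HasDerivAt.scomp t (hg.differentiableAt (hA.mem_nhds hA')).hasDerivAt hγ
  rw [hc.deriv, ← hρ _ hA', norm_smul, Function.comp_apply]
  ring

/-! ### Distances -/

theorem metricDist_comp_subset {g : ℂ → ℂ} {A B : Set ℂ} (hA : IsOpen A)
    (hg : DifferentiableOn ℂ g A) (hgB : MapsTo g A B) {ρA ρB : ℂ → ℝ}
    (hρ : ∀ u ∈ A, ρB (g u) * ‖deriv g u‖ = ρA u) (u v : ℂ) :
    {l | ∃ (γ : ℝ → ℂ) (a b : ℝ), a ≤ b ∧ PiecewiseC1On γ a b ∧ MapsTo γ (Icc a b) A ∧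
      γ a = u ∧ γ b = v ∧ l = metricLength ρA γ a b} ⊆
    {l | ∃ (γ : ℝ → ℂ) (a b : ℝ), a ≤ b ∧ PiecewiseC1On γ a b ∧ MapsTo γ (Icc a b) B ∧
      γ a = g u ∧ γ b = g v ∧ l = metricLength ρB γ a b} := by
  rintro _ ⟨γ, a, b, hab, hp, hm, rfl, rfl, rfl⟩
  exact ⟨g ∘ γ, a, b, hab, hp.comp hA hg hm, hgB.comp hm, rfl, rfl,
    (metricLength_comp hab hp hA hg hm hρ).symm⟩

theorem metricDist_image {g : ℂ → ℂ} {A : Set ℂ} (hA : IsOpen A)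
    (hg : DifferentiableOn ℂ g A) (hi : InjOn g A) {ρA ρB : ℂ → ℝ}
    (hρ : ∀ u ∈ A, ρB (g u) * ‖deriv g u‖ = ρA u) {u v : ℂ} (hu : u ∈ A) (hv : v ∈ A) :
    metricDist ρB (g '' A) (g u) (g v) = metricDist ρA A u v := by
  unfold metricDist
  congr 1
  refine Subset.antisymm ?_ (metricDist_comp_subset hA hg (mapsTo_image g A) hρ u v)
  have h := metricDist_comp_subset (g := Function.invFunOn g A) (B := A)
    (isOpen_image_of_injOn hA hg hi) (differentiableOn_invFunOn hA hg hi) (ρA := ρB) (ρB := ρA)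
    (by rintro _ ⟨z, hz, rfl⟩; rwa [invFunOn_image hi hz]) (by
      rintro _ ⟨z, hz, rfl⟩
      have hne := norm_ne_zero_iff.2 (deriv_ne_zero_of_injOn hA hg hi hz)
      rw [invFunOn_image hi hz, (hasDerivAt_invFunOn hA hg hi hz).deriv, ← hρ z hz, norm_inv,
        mul_inv_cancel_right₀ hne]) (g u) (g v)
  rwa [invFunOn_image hi hu, invFunOn_image hi hv] at h

theorem metricDist_le {ρ : ℂ → ℝ} {D : Set ℂ} (hρ : ∀ z ∈ D, 0 ≤ ρ z) {γ : ℝ → ℂ} {a b : ℝ}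
    (hab : a ≤ b) (h : PiecewiseC1On γ a b) (hm : MapsTo γ (Icc a b) D) :
    metricDist ρ D (γ a) (γ b) ≤ metricLength ρ γ a b := by
  refine csInf_le ⟨0, ?_⟩ ⟨γ, a, b, hab, h, hm, rfl, rfl, rfl⟩
  rintro _ ⟨η, c, d, hcd, -, hm', -, -, rfl⟩
  exact metricLength_nonneg hcd hρ hm'

/-- The curve `γ` only makes the set of lengths nonempty: the infimum of the empty set would be `0`.
-/
theorem le_metricDist {ρ : ℂ → ℝ} {D : Set ℂ} {z w : ℂ} {γ : ℝ → ℂ} {a b : ℝ}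
    (hab : a ≤ b) (h : PiecewiseC1On γ a b) (hm : MapsTo γ (Icc a b) D) (ha : γ a = z)
    (hb : γ b = w) {x : ℝ}
    (hx : ∀ (η : ℝ → ℂ) (c d : ℝ), c ≤ d → PiecewiseC1On η c d → MapsTo η (Icc c d) D → η c = z →
      η d = w → x ≤ metricLength ρ η c d) : x ≤ metricDist ρ D z w := by
  refine le_csInf ⟨_, γ, a, b, hab, h, hm, ha, hb, rfl⟩ ?_
  rintro _ ⟨η, c, d, hcd, hp, hm', hc, hd, rfl⟩
  exact hx η c d hcd hp hm' hc hd

end HypGeom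

namespace HypGeom

open MeasureTheory

/-! ### The hyperbolic density -/

theorem discDensity_pos {w : ℂ} (hw : w ∈ ball (0 : ℂ) 1) : 0 < discDensity w := by
  have : ‖w‖ < 1 := by simpa using hw
  exact one_div_pos.2 (by nlinarith [norm_nonneg w])

theorem continuousOn_discDensity : ContinuousOn discDensity (ball 0 1) := by
  refine continuousOn_const.div (by fun_prop) fun w hw => ?_
  have : ‖w‖ < 1 := by simpa using hw
  exact ne_of_gt (by nlinarith [norm_nonneg w])

variable {D : Set ℂ} {f : ℂ → ℂ}

theorem IsRiemannMap.isOpen (hf : IsRiemannMap f D) : IsOpen D :=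
  hf.2.2 ▸ isOpen_image_of_injOn isOpen_ball hf.1 hf.2.1

theorem IsRiemannMap.mapsTo (hf : IsRiemannMap f D) : MapsTo f (ball 0 1) D :=
  hf.2.2 ▸ mapsTo_image f (ball 0 1)

theorem IsRiemannMap.deriv_ne_zero (hf : IsRiemannMap f D) {w : ℂ} (hw : w ∈ ball (0 : ℂ) 1) :
    deriv f w ≠ 0 :=
  deriv_ne_zero_of_injOn isOpen_ball hf.1 hf.2.1 hw

theorem IsRiemannMap.inv_mem (hf : IsRiemannMap f D) {z : ℂ} (hz : z ∈ D) :
    Function.invFunOn f (ball 0 1) z ∈ ball (0 : ℂ) 1 :=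
  Function.invFunOn_mem (by rw [← hf.2.2] at hz; exact hz)

theorem IsRiemannMap.apply_inv (hf : IsRiemannMap f D) {z : ℂ} (hz : z ∈ D) :
    f (Function.invFunOn f (ball 0 1) z) = z :=
  Function.invFunOn_eq (by rw [← hf.2.2] at hz; exact hz)

theorem IsRiemannMap.differentiableOn_inv (hf : IsRiemannMap f D) :
    DifferentiableOn ℂ (Function.invFunOn f (ball 0 1)) D := by
  have := differentiableOn_invFunOn isOpen_ball hf.1 hf.2.1
  rwa [hf.2.2] at this

/-- Contraction of the density of the image under a holomorphic map of the disc into `D`. -/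
theorem IsRiemannMap.density_le (hf : IsRiemannMap f D) {g : ℂ → ℂ}
    (hg : DifferentiableOn ℂ g (ball 0 1)) (hgD : MapsTo g (ball 0 1) D) {u w : ℂ}
    (hu : u ∈ ball (0 : ℂ) 1) (hw : w ∈ ball (0 : ℂ) 1) (h : f u = g w) {x : ℝ}
    (hx : x * ‖deriv f u‖ = discDensity u) : x * ‖deriv g w‖ ≤ discDensity w := by
  set ψ := Function.invFunOn f (ball 0 1) ∘ g with hψ
  have hd : DifferentiableOn ℂ ψ (ball 0 1) := hf.differentiableOn_inv.comp hg hgD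
  have hm : MapsTo ψ (ball 0 1) (ball 0 1) := fun v hv => hf.inv_mem (hgD hv)
  have hψw : ψ w = u := by simp [hψ, ← h, invFunOn_image hf.2.1 hu]
  have h1 := schwarz_pick hd hm hw
  have h2 : HasDerivAt g (deriv f u * deriv ψ w) w := by
    have h3 : HasDerivAt (f ∘ ψ) (deriv f u * deriv ψ w) w := by
      refine HasDerivAt.comp w ?_ (hd.differentiableAt (isOpen_ball.mem_nhds hw)).hasDerivAt
      rw [hψw]
      exact (hf.1.differentiableAt (isOpen_ball.mem_nhds hu)).hasDerivAt
    refine h3.congr_of_eventuallyEq ?_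
    filter_upwards [isOpen_ball.mem_nhds hw] with v hv
    exact (hf.apply_inv (hgD hv)).symm
  rw [h2.deriv, norm_mul, ← mul_assoc, hx, ← hψw]
  exact h1

/-- The density is a choice made with some unknown Riemann map `f₁`. Applying the contraction
property to `f` against `f₁` and to `f₁` against `f` gives both inequalities, hence independence of
the map. -/
theorem IsRiemannMap.hypDensity_mul (hf : IsRiemannMap f D) {w : ℂ}
    (hw : w ∈ ball (0 : ℂ) 1) : hypDensity D (f w) * ‖deriv f w‖ = discDensity w := by
  have hpos := norm_pos_iff.2 (hf.deriv_ne_zero hw)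
  have key : ∃ x : ℝ, ∃ (f₁ : ℂ → ℂ) (u : ℂ), IsRiemannMap f₁ D ∧ u ∈ ball (0 : ℂ) 1 ∧
      f₁ u = f w ∧ x * ‖deriv f₁ u‖ = discDensity u :=
    ⟨discDensity w / ‖deriv f w‖, f, w, hf, hw, rfl, div_mul_cancel₀ _ hpos.ne'⟩
  obtain ⟨f₁, u, hf₁, hu, hfu, hx⟩ := Classical.epsilon_spec key
  change hypDensity D (f w) * ‖deriv f₁ u‖ = discDensity u at hx
  refine le_antisymm (hf₁.density_le hf.1 hf.mapsTo hu hw hfu hx) ?_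
  have hpos' := norm_pos_iff.2 (hf₁.deriv_ne_zero hu)
  have h := hf.density_le hf₁.1 hf₁.mapsTo hw hu hfu.symm
    (div_mul_cancel₀ (discDensity w) hpos.ne')
  rw [← hx] at h
  exact (div_le_iff₀ hpos).1 (le_of_mul_le_mul_right h hpos')

theorem IsRiemannMap.hypDensity_mul_le (hf : IsRiemannMap f D) {g : ℂ → ℂ}
    (hg : DifferentiableOn ℂ g (ball 0 1)) (hgD : MapsTo g (ball 0 1) D) {w : ℂ}
    (hw : w ∈ ball (0 : ℂ) 1) : hypDensity D (g w) * ‖deriv g w‖ ≤ discDensity w := by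
  have hu := hf.inv_mem (hgD hw)
  have e := hf.apply_inv (hgD hw)
  have h := hf.hypDensity_mul hu
  rw [e] at h
  exact hf.density_le hg hgD hu hw e h

theorem IsRiemannMap.hypDensity_eq (hf : IsRiemannMap f D) {z : ℂ} (hz : z ∈ D) :
    hypDensity D z = discDensity (Function.invFunOn f (ball 0 1) z) /
      ‖deriv f (Function.invFunOn f (ball 0 1) z)‖ := by
  have hu := hf.inv_mem hz
  rw [eq_div_iff (norm_ne_zero_iff.2 (hf.deriv_ne_zero hu)), ← hf.hypDensity_mul hu,
    hf.apply_inv hz]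

theorem IsRiemannMap.hypDensity_pos (hf : IsRiemannMap f D) {z : ℂ} (hz : z ∈ D) :
    0 < hypDensity D z := by
  rw [hf.hypDensity_eq hz]
  exact div_pos (discDensity_pos (hf.inv_mem hz))
    (norm_pos_iff.2 (hf.deriv_ne_zero (hf.inv_mem hz)))

theorem IsRiemannMap.continuousOn_hypDensity (hf : IsRiemannMap f D) :
    ContinuousOn (hypDensity D) D := by
  have hc := hf.differentiableOn_inv.continuousOn
  have hm : MapsTo (Function.invFunOn f (ball 0 1)) D (ball 0 1) := fun z hz => hf.inv_mem hz
  have hd : ContinuousOn (deriv f) (ball 0 1) := (hf.1.deriv isOpen_ball).continuousOn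
  refine ContinuousOn.congr ((continuousOn_discDensity.comp hc hm).div (hd.comp hc hm).norm ?_)
    fun z hz => hf.hypDensity_eq hz
  exact fun z hz => norm_ne_zero_iff.2 (hf.deriv_ne_zero (hf.inv_mem hz))

theorem IsRiemannMap.hypDist_eq (hf : IsRiemannMap f D) {u v : ℂ} (hu : u ∈ ball (0 : ℂ) 1)
    (hv : v ∈ ball (0 : ℂ) 1) : hypDist D (f u) (f v) = discDist u v := by
  have := metricDist_image isOpen_ball hf.1 hf.2.1 (ρB := hypDensity D)
    (fun w hw => hf.hypDensity_mul hw) hu hv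
  rwa [hf.2.2] at this

/-! ### The hyperbolic distance from the centre of the disc -/

theorem hasDerivAt_artanh {x : ℝ} (hx : x ∈ Ioo (-1 : ℝ) 1) :
    HasDerivAt Real.artanh (1 / (1 - x ^ 2)) x := by
  have h1 : 0 < 1 + x := by linarith [hx.1]
  have h2 : 0 < 1 - x := by linarith [hx.2]
  have h := ((((hasDerivAt_id x).const_add 1).log h1.ne').sub
    (((hasDerivAt_id x).const_sub 1).log h2.ne')).const_mul (1 / 2)
  have h3 : (1 : ℝ) / 2 * (1 / (1 + id x) - -1 / (1 - id x)) = 1 / (1 - x ^ 2) := by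
    have h4 : 1 - x ^ 2 ≠ 0 := by nlinarith
    simp only [id]
    field_simp
    ring
  rw [h3] at h
  refine h.congr_of_eventuallyEq ?_
  filter_upwards [isOpen_Ioo.mem_nhds hx] with y hy
  rw [Real.artanh_eq_half_log (Ioo_subset_Icc_self hy),
    Real.log_div (by linarith [hy.1]) (by linarith [hy.2])]
  simp

theorem radial_mem {v : ℂ} (hv : v ∈ ball (0 : ℂ) 1) {t : ℝ} (ht : t ∈ Icc (0 : ℝ) 1) :
    (t : ℂ) * v ∈ ball (0 : ℂ) 1 := by
  rw [mem_ball_zero_iff] at hv ⊢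
  rw [norm_mul, Complex.norm_real, Real.norm_of_nonneg ht.1]
  nlinarith [ht.1, ht.2, norm_nonneg v]

theorem piecewiseC1On_radial (v : ℂ) : PiecewiseC1On (fun t : ℝ => (t : ℂ) * v) 0 1 :=
  PiecewiseC1On.of_contDiff (Complex.ofRealCLM.contDiff.mul contDiff_const) zero_le_one

theorem metricLength_radial {v : ℂ} (hv : v ∈ ball (0 : ℂ) 1) :
    metricLength discDensity (fun t : ℝ => (t : ℂ) * v) 0 1 = Real.artanh ‖v‖ := by
  have hv1 : ‖v‖ < 1 := by simpa using hv
  have hint := intervalIntegrable_length zero_le_one (piecewiseC1On_radial v)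
    continuousOn_discDensity (fun t ht => radial_mem hv ht)
  have hmem : ∀ t ∈ Icc (0 : ℝ) 1, t * ‖v‖ ∈ Ioo (-1 : ℝ) 1 := fun t ht =>
    ⟨by nlinarith [ht.1, norm_nonneg v, mul_nonneg ht.1 (norm_nonneg v)],
      by nlinarith [ht.1, ht.2, norm_nonneg v]⟩
  have hd : ∀ t ∈ Icc (0 : ℝ) 1, HasDerivAt (fun t : ℝ => Real.artanh (t * ‖v‖))
      (discDensity ((t : ℂ) * v) * ‖deriv (fun t : ℝ => (t : ℂ) * v) t‖) t := by
    intro t ht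
    have h := (hasDerivAt_artanh (hmem t ht)).comp t ((hasDerivAt_id t).mul_const ‖v‖)
    refine h.congr_deriv ?_
    have e : HasDerivAt (fun t : ℝ => (t : ℂ) * v) v t := by
      simpa using (Complex.ofRealCLM.hasDerivAt (x := t)).mul_const v
    rw [e.deriv, discDensity, norm_mul, Complex.norm_real, Real.norm_of_nonneg ht.1]
    simp
  have := intervalIntegral.integral_eq_sub_of_hasDerivAt (a := 0) (b := 1)
    (fun t ht => hd t (by rwa [uIcc_of_le zero_le_one] at ht)) hint
  rw [metricLength, this]
  simp

/-- Rotate `v` onto the positive real axis and project the curve to that axis. The projection `L`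
shortens tangent vectors and lands where the density is no larger, and on the axis the density
integrates to `artanh`. -/
theorem artanh_norm_le_metricLength {v : ℂ} {γ : ℝ → ℂ} {a b : ℝ} (hab : a ≤ b)
    (h : PiecewiseC1On γ a b) (hm : MapsTo γ (Icc a b) (ball 0 1)) (ha : γ a = 0)
    (hb : γ b = v) : Real.artanh ‖v‖ ≤ metricLength discDensity γ a b := by
  obtain ⟨c, hc, hcv⟩ : ∃ c : ℂ, ‖c‖ = 1 ∧ c * v = (‖v‖ : ℂ) := by
    rcases eq_or_ne v 0 with rfl | hv
    · exact ⟨1, by simp, by simp⟩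
    · have hn : (‖v‖ : ℂ) ≠ 0 := by simpa using hv
      refine ⟨starRingEnd ℂ v / ‖v‖, by simp [hv], ?_⟩
      rw [div_mul_eq_mul_div, div_eq_iff hn, ← Complex.normSq_eq_conj_mul_self,
        Complex.normSq_eq_norm_sq]
      push_cast
      ring
  let L : ℂ →L[ℝ] ℝ := Complex.reCLM.comp ((ContinuousLinearMap.mul ℝ ℂ) c)
  have hL : ∀ z, L z = (c * z).re := fun z => rfl
  have hLn : ∀ z, |L z| ≤ ‖z‖ := fun z => by
    rw [hL]
    exact (Complex.abs_re_le_norm _).trans (by rw [norm_mul, hc, one_mul])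
  have hmem : ∀ t ∈ Icc a b, L (γ t) ∈ Ioo (-1 : ℝ) 1 := fun t ht => by
    have : ‖γ t‖ < 1 := by simpa using hm ht
    exact abs_lt.1 ((hLn _).trans_lt this)
  obtain ⟨E, hE, hd⟩ := h.exists_countable
  have hLc : ContinuousOn (fun t => L (γ t)) (Icc a b) :=
    L.continuous.comp_continuousOn h.continuousOn
  have hac : ContinuousOn Real.artanh (Ioo (-1) 1) :=
    fun x hx => (hasDerivAt_artanh hx).continuousAt.continuousWithinAt
  have hint : IntervalIntegrable (fun t => 1 / (1 - L (γ t) ^ 2) * L (deriv γ t)) volume a b := by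
    refine IntervalIntegrable.continuousOn_mul ?_ ?_
    · have := h.intervalIntegrable_deriv
      exact ⟨L.integrable_comp this.1, L.integrable_comp this.2⟩
    · rw [uIcc_of_le hab]
      refine continuousOn_const.div (continuousOn_const.sub (hLc.pow 2)) fun t ht => ?_
      have := hmem t ht
      nlinarith [this.1, this.2]
  have hftc := integral_eq_of_hasDerivAt_off_countable_of_le (fun t => Real.artanh (L (γ t)))
    (fun t => 1 / (1 - L (γ t) ^ 2) * L (deriv γ t)) hab hE (hac.comp hLc hmem)
    (fun t ht => HasDerivAt.comp (h₂ := Real.artanh) t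
      (hasDerivAt_artanh (hmem t (Ioo_subset_Icc_self ht.1)))
      (L.hasFDerivAt.comp_hasDerivAt t (hd t ht).hasDerivAt)) hint
  simp only [ha, hb, map_zero, Real.artanh_zero, sub_zero] at hftc
  have hv : L v = ‖v‖ := by rw [hL, hcv, Complex.ofReal_re]
  rw [← hv, ← hftc]
  refine intervalIntegral.integral_mono_on hab hint
    (intervalIntegrable_length hab h continuousOn_discDensity hm) fun t ht => ?_
  have h1 : ‖γ t‖ < 1 := by simpa using hm ht
  have h2 : L (γ t) ^ 2 ≤ ‖γ t‖ ^ 2 := by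
    rw [← sq_abs]
    exact pow_le_pow_left₀ (abs_nonneg _) (hLn _) 2
  have h3 : 0 < 1 - ‖γ t‖ ^ 2 := by nlinarith [norm_nonneg (γ t)]
  refine (mul_le_mul_of_nonneg_left ((le_abs_self _).trans (hLn _)) ?_).trans
    (mul_le_mul_of_nonneg_right (one_div_le_one_div_of_le h3 (by linarith)) (norm_nonneg _))
  exact one_div_nonneg.2 (by linarith)

theorem discDist_zero {v : ℂ} (hv : v ∈ ball (0 : ℂ) 1) : discDist 0 v = Real.artanh ‖v‖ := by
  refine le_antisymm ?_ ?_
  · have := metricDist_le (fun z hz => (discDensity_pos hz).le) zero_le_one (piecewiseC1On_radial v)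
      (fun t ht => radial_mem hv ht)
    rw [metricLength_radial hv] at this
    simpa [discDist] using this
  · exact le_metricDist zero_le_one (piecewiseC1On_radial v) (fun t ht => radial_mem hv ht)
      (by simp) (by simp) fun η c d hcd hp hm hc hd => artanh_norm_le_metricLength hcd hp hm hc hd

theorem IsRiemannMap.hypDist_zero (hf : IsRiemannMap f D) {v : ℂ} (hv : v ∈ ball (0 : ℂ) 1) :
    hypDist D (f 0) (f v) = Real.artanh ‖v‖ := by
  rw [hf.hypDist_eq (by simp) hv, discDist_zero hv]

end HypGeom

namespace HypGeom

/-! ### The Riemann mapping theorem for domains that embed into the disc -/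

/-- An open mapping statement uniform in `n`. On a small circle `‖f z - f a‖` has a positive minimum
`m`, so eventually `‖F n z - F n a‖ ≥ m / 3` there, and a ball of radius `m / 6` is covered. -/
theorem exists_ball_subset_image_of_tendsto {ι : Type*} {φ : Filter ι} {F : ι → ℂ → ℂ} {f : ℂ → ℂ}
    {U : Set ℂ} (hU : IsOpen U) (hF : TendstoLocallyUniformlyOn F f φ U)
    (hd : ∀ n, DifferentiableOn ℂ (F n) U) (hi : ∀ n, InjOn (F n) U) {a : ℂ} (ha : a ∈ U)
    (hne : ∀ᶠ z in 𝓝[≠] a, f z ≠ f a) {δ : ℝ} (hδ : 0 < δ) :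
    ∃ r < δ, ∃ ε > 0, closedBall a r ⊆ U ∧ ∀ᶠ n in φ, ball (F n a) ε ⊆ F n '' closedBall a r := by
  rw [eventually_nhdsWithin_iff] at hne
  obtain ⟨R, hR, hb⟩ := Metric.eventually_nhds_iff_ball.1 (hne.and (hU.mem_nhds ha))
  obtain ⟨r, hr, hrlt⟩ := exists_between (lt_min hR hδ)
  have hrU : closedBall a r ⊆ U := fun z hz =>
    (hb z (closedBall_subset_ball (hrlt.trans_le (min_le_left _ _)) hz)).2
  have hsub : sphere a r ⊆ closedBall a r := sphere_subset_closedBall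
  by_cases hφ : φ = ⊥
  · exact ⟨r, hrlt.trans_le (min_le_right _ _), 1, one_pos, hrU, by simp [hφ]⟩
  have : φ.NeBot := ⟨hφ⟩
  have hfc : ContinuousOn f U := (hF.differentiableOn (Eventually.of_forall hd) hU).continuousOn
  have hcont : ContinuousOn (fun z => ‖f z - f a‖) (sphere a r) :=
    ((hfc.mono (hsub.trans hrU)).sub continuousOn_const).norm
  obtain ⟨z₁, hz₁, hmin⟩ := (isCompact_sphere a r).exists_isMinOn
    (NormedSpace.sphere_nonempty.2 hr.le) hcont
  set m := ‖f z₁ - f a‖ with hm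
  have hz₁a : z₁ ≠ a := fun e => by
    rw [e, mem_sphere, dist_self] at hz₁
    exact hr.ne hz₁
  have hmpos : 0 < m := norm_pos_iff.2 (sub_ne_zero.2 ((hb z₁ (closedBall_subset_ball
    (hrlt.trans_le (min_le_left _ _)) (hsub hz₁))).1 hz₁a))
  refine ⟨r, hrlt.trans_le (min_le_right _ _), m / 3 / 2, by positivity, hrU, ?_⟩
  have hu := ((tendstoLocallyUniformlyOn_iff_forall_isCompact hU).1 hF) _ hrU
    (isCompact_closedBall a r)
  filter_upwards [Metric.tendstoUniformlyOn_iff.1 hu (m / 3) (by positivity)] with n hn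
  refine DiffContOnCl.ball_subset_image_closedBall ?_ hr (fun z hz => ?_) ?_
  · exact ((hd n).mono (closure_ball_subset_closedBall.trans hrU)).diffContOnCl
  · have h1 := hn z (hsub hz)
    have h2 := hn a (mem_closedBall_self hr.le)
    have h3 : m ≤ ‖f z - f a‖ := hmin hz
    rw [dist_eq_norm] at h1 h2
    have h4 : ‖f z - f a‖ ≤ ‖f z - F n z‖ + ‖F n z - F n a‖ + ‖f a - F n a‖ := by
      have e : f z - f a = (f z - F n z) + (F n z - F n a) - (f a - F n a) := by ring
      rw [e]
      exact (norm_sub_le _ _).trans (add_le_add_left (norm_add_le _ _) _)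
    linarith
  · have h1 := not_eventually_const_of_injOn hU (hi n) ha
    exact not_eventually.1 h1

/-- Hurwitz' theorem: a non-constant limit of injective holomorphic functions is injective. -/
theorem injOn_of_tendstoLocallyUniformlyOn {ι : Type*} {φ : Filter ι} [φ.NeBot] {F : ι → ℂ → ℂ}
    {f : ℂ → ℂ} {U : Set ℂ} (hU : IsOpen U) (hUc : IsPreconnected U)
    (hF : TendstoLocallyUniformlyOn F f φ U) (hd : ∀ n, DifferentiableOn ℂ (F n) U)
    (hi : ∀ n, InjOn (F n) U) {z₀ : ℂ} (hz₀ : z₀ ∈ U) (hf : deriv f z₀ ≠ 0) : InjOn f U := by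
  have hfd : DifferentiableOn ℂ f U := hF.differentiableOn (Eventually.of_forall hd) hU
  have hfa : AnalyticOnNhd ℂ f U := hfd.analyticOnNhd hU
  have hne : ∀ a ∈ U, ∀ᶠ z in 𝓝[≠] a, f z ≠ f a := by
    intro a ha
    refine ((hfa a ha).eventually_eq_or_eventually_ne analyticAt_const).resolve_left fun h => hf ?_
    have h1 : EqOn f (fun _ => f a) U :=
      hfa.eqOn_of_preconnected_of_eventuallyEq analyticOnNhd_const hUc ha h
    have h2 : f =ᶠ[𝓝 z₀] fun _ => f a := h1.eventuallyEq_of_mem (hU.mem_nhds hz₀)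
    rw [h2.deriv_eq, deriv_const]
  intro a ha b hb hab
  by_contra hne'
  -- Closed discs of radius less than half the distance are disjoint, yet for large `n` the
  -- injective `F n` takes the value `f a = f b` in both.
  have hδ : 0 < dist a b / 2 := half_pos (dist_pos.2 hne')
  obtain ⟨r, hr, ε, hε, hrU, h1⟩ := exists_ball_subset_image_of_tendsto hU hF hd hi ha (hne a ha) hδ
  obtain ⟨r', hr', ε', hε', hrU', h2⟩ :=
    exists_ball_subset_image_of_tendsto hU hF hd hi hb (hne b hb) hδ
  have ta := (Metric.tendsto_nhds.1 (hF.tendsto_at ha)) ε hε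
  have tb := (Metric.tendsto_nhds.1 (hF.tendsto_at hb)) ε' hε'
  obtain ⟨n, hn1, hn2, hn3, hn4⟩ := (h1.and (h2.and (ta.and tb))).exists
  obtain ⟨p, hp, hpe⟩ := hn1 (by rw [mem_ball, dist_comm]; exact hn3)
  obtain ⟨q, hq, hqe⟩ := hn2 (by rw [mem_ball, dist_comm]; exact hn4)
  have hpq : p = q := hi n (hrU hp) (hrU' hq) (by rw [hpe, hqe, hab])
  rw [mem_closedBall] at hp hq
  have h3 := dist_triangle_left a b p
  rw [← hpq] at hq
  linarith

theorem dist_le_of_mapsTo_unit_ball {f : ℂ → ℂ} {U : Set ℂ} (hf : DifferentiableOn ℂ f U)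
    (hm : MapsTo f U (ball 0 1)) {x : ℂ} {r : ℝ} (hr : ball x r ⊆ U) {y : ℂ} (hy : y ∈ ball x r) :
    dist (f y) (f x) ≤ 2 / r * dist y x := by
  have hx : x ∈ ball x r := mem_ball_self (pos_of_mem_ball hy)
  refine Complex.dist_le_div_mul_dist_of_mapsTo_ball (hf.mono hr) (fun z hz => ?_) hy
  have h1 : dist (f z) 0 < 1 := hm (hr hz)
  have h2 : dist (f x) 0 < 1 := hm (hr hx)
  rw [mem_closedBall]
  linarith [dist_triangle_right (f z) (f x) 0]

/-- Montel's theorem along an ultrafilter: compactness of the closed disc gives pointwise limits,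
and the local Lipschitz bound from the Schwarz lemma, uniform in `n`, makes the convergence locally
uniform. -/
theorem exists_tendstoLocallyUniformlyOn {ι : Type*} (𝒰 : Ultrafilter ι) {F : ι → ℂ → ℂ}
    {U : Set ℂ} (hU : IsOpen U) (hd : ∀ n, DifferentiableOn ℂ (F n) U)
    (hm : ∀ n, MapsTo (F n) U (ball 0 1)) :
    ∃ f : ℂ → ℂ, TendstoLocallyUniformlyOn F f 𝒰 U := by
  have hlim : ∀ z ∈ U, ∃ w, Tendsto (fun n => F n z) 𝒰 (𝓝 w) := fun z hz => by
    obtain ⟨w, -, hw⟩ := (isCompact_closedBall (0 : ℂ) 1).ultrafilter_le_nhds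
      (𝒰.map fun n => F n z) (by
        rw [Ultrafilter.coe_map]
        exact tendsto_principal.2 (Eventually.of_forall fun n => ball_subset_closedBall (hm n hz)))
    exact ⟨w, hw⟩
  choose! f hf using hlim
  refine ⟨f, Metric.tendstoLocallyUniformlyOn_iff.2 fun ε hε x hx => ?_⟩
  obtain ⟨r, hr, hb⟩ := Metric.isOpen_iff.1 hU x hx
  have hδ : 0 < min r (ε * r / 8) := lt_min hr (by positivity)
  refine ⟨ball x (min r (ε * r / 8)), mem_nhdsWithin_of_mem_nhds (ball_mem_nhds x hδ), ?_⟩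
  have hF : ∀ n, ∀ y ∈ ball x (min r (ε * r / 8)), dist (F n y) (F n x) ≤ ε / 4 := by
    intro n y hy
    refine (dist_le_of_mapsTo_unit_ball (hd n) (hm n) hb
      (ball_subset_ball (min_le_left _ _) hy)).trans ?_
    have : dist y x ≤ ε * r / 8 := (mem_ball.1 hy).le.trans (min_le_right _ _)
    calc 2 / r * dist y x ≤ 2 / r * (ε * r / 8) := by gcongr
      _ = ε / 4 := by field_simp; norm_num
  filter_upwards [Metric.tendsto_nhds.1 (hf x hx) (ε / 4) (by positivity)] with n hn y hy
  have hyU : y ∈ U := hb (ball_subset_ball (min_le_left _ _) hy)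
  have h1 : dist (f y) (f x) ≤ ε / 4 :=
    le_of_tendsto ((hf y hyU).dist (hf x hx)) (Eventually.of_forall fun k => hF k y hy)
  have h2 := hF n y hy
  have h3 := dist_triangle4 (f y) (f x) (F n x) (F n y)
  rw [dist_comm (f x), dist_comm (F n x) (F n y)] at h3
  linarith

theorem hasDerivAt_of_sq_eq {s g : ℂ → ℂ} {x g' : ℂ} (hs : ContinuousAt s x)
    (hsq : ∀ y, s y ^ 2 = g y) (h0 : s x ≠ 0) (hg : HasDerivAt g g' x) :
    HasDerivAt s (g' / (2 * s x)) x := by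
  rw [hasDerivAt_iff_tendsto_slope] at hg ⊢
  have hsum : Tendsto (fun y => s y + s x) (𝓝[≠] x) (𝓝 (2 * s x)) := by
    rw [two_mul]
    exact (hs.tendsto.mono_left nhdsWithin_le_nhds).add tendsto_const_nhds
  have h2 : 2 * s x ≠ 0 := mul_ne_zero two_ne_zero h0
  refine (hg.div hsum h2).congr' ?_
  filter_upwards [hsum.eventually_ne h2] with y hy
  rw [Pi.div_apply, slope_def_field, slope_def_field, ← hsq y, ← hsq x]
  field_simp
  ring

/-- Koebe's square root trick: move the omitted value to `0`, take a square root and move the image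
of `z₀` back to `0`. With `q = ‖s z₀‖`, so that `q ^ 2 = ‖w₀‖`, the derivative is multiplied in
modulus by `(1 + q ^ 2) / (2 * q) > 1`. -/
theorem exists_larger_deriv {U : Set ℂ} (hU : IsOpen U) (hUc : IsSimplyConnected U) {f : ℂ → ℂ}
    (hd : DifferentiableOn ℂ f U) (hi : InjOn f U) (hm : MapsTo f U (ball 0 1)) {z₀ : ℂ}
    (hz₀ : z₀ ∈ U) (hf0 : f z₀ = 0) {w₀ : ℂ} (hw₀ : w₀ ∈ ball (0 : ℂ) 1) (hw : w₀ ∉ f '' U) :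
    ∃ F : ℂ → ℂ, DifferentiableOn ℂ F U ∧ InjOn F U ∧ MapsTo F U (ball 0 1) ∧ F z₀ = 0 ∧
      ‖deriv f z₀‖ < ‖deriv F z₀‖ := by
  have hw1 : ‖-w₀‖ < 1 := by simpa using hw₀
  have hgd : DifferentiableOn ℂ (mob (-w₀) ∘ f) U := (differentiableOn_mob hw1).comp hd hm
  have hgm : MapsTo (mob (-w₀) ∘ f) U (ball 0 1) := (mapsTo_mob hw1).comp hm
  have hgi : InjOn (mob (-w₀) ∘ f) U := (injOn_mob hw1).comp hi hm
  have hg0 : ∀ z ∈ U, (mob (-w₀) ∘ f) z ≠ 0 := fun z hz h => hw ⟨z, hz, by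
    rw [← mob_neg_self w₀] at h
    exact injOn_mob hw1 (hm hz) hw₀ h⟩
  obtain ⟨s, hsc, hsq⟩ := Complex.exists_continuousOn_pow_eq hUc hU hgd.continuousOn
    (by rintro ⟨z, hz, h⟩; exact hg0 z hz h) two_ne_zero
  have hs0 : ∀ z ∈ U, s z ≠ 0 := fun z hz h => hg0 z hz (by rw [← hsq z, h]; simp)
  have hsd : ∀ z ∈ U, HasDerivAt s (deriv (mob (-w₀) ∘ f) z / (2 * s z)) z := fun z hz =>
    hasDerivAt_of_sq_eq (hsc.continuousAt (hU.mem_nhds hz)) hsq (hs0 z hz)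
      (hgd.differentiableAt (hU.mem_nhds hz)).hasDerivAt
  have hsm : MapsTo s U (ball 0 1) := fun z hz => by
    have h := hgm hz
    rw [← hsq z, mem_ball_zero_iff, norm_pow] at h
    rw [mem_ball_zero_iff]
    nlinarith [norm_nonneg (s z)]
  have hsi : InjOn s U := fun z hz w hw h => hgi hz hw (by rw [← hsq z, h, hsq w])
  have hq1 : ‖s z₀‖ < 1 := by simpa using hsm hz₀
  have hq1' : ‖-s z₀‖ < 1 := by simpa using hq1
  refine ⟨mob (-s z₀) ∘ s, (differentiableOn_mob hq1').comp
    (fun z hz => (hsd z hz).differentiableAt.differentiableWithinAt) hsm,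
    (injOn_mob hq1').comp hsi hsm, (mapsTo_mob hq1').comp hsm, by simp, ?_⟩
  have e1 : deriv (mob (-s z₀) ∘ s) z₀ =
      deriv (mob (-s z₀)) (s z₀) * (deriv (mob (-w₀) ∘ f) z₀ / (2 * s z₀)) :=
    (HasDerivAt.comp z₀ ((differentiableOn_mob hq1').differentiableAt
      (isOpen_ball.mem_nhds (hsm hz₀))).hasDerivAt (hsd z₀ hz₀)).deriv
  have e2 : deriv (mob (-w₀) ∘ f) z₀ = deriv (mob (-w₀)) 0 * deriv f z₀ := by
    refine (HasDerivAt.comp z₀ ?_ (hd.differentiableAt (hU.mem_nhds hz₀)).hasDerivAt).deriv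
    rw [hf0]
    exact ((differentiableOn_mob hw1).differentiableAt
      (isOpen_ball.mem_nhds (by simp))).hasDerivAt
  have e3 : ‖s z₀‖ ^ 2 = ‖-w₀‖ := by
    rw [← norm_pow, hsq, Function.comp_apply, hf0, mob_zero]
  rw [e1, e2, norm_mul, norm_div, norm_mul, norm_mul, norm_deriv_mob_neg_self hq1,
    norm_deriv_mob_zero hw1, ← e3]
  have hq0 : 0 < ‖s z₀‖ := norm_pos_iff.2 (hs0 z₀ hz₀)
  have hf' : 0 < ‖deriv f z₀‖ := norm_pos_iff.2 (deriv_ne_zero_of_injOn hU hd hi hz₀)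
  generalize ‖s z₀‖ = q at *
  have hq2 : 0 < 1 - q ^ 2 := by nlinarith
  have e4 : 1 / (1 - q ^ 2) * ((1 - (q ^ 2) ^ 2) * ‖deriv f z₀‖ / (‖(2 : ℂ)‖ * q)) =
      (1 + q ^ 2) / (2 * q) * ‖deriv f z₀‖ := by
    simp only [Complex.norm_ofNat]
    field_simp
    ring
  rw [e4]
  refine lt_mul_of_one_lt_left hf' ?_
  rw [one_lt_div (by positivity)]
  nlinarith [sq_pos_of_pos (sub_pos.2 hq1)]

/-- Maximise `‖deriv f z₀‖` over the injective maps into the disc that vanish at `z₀`; the embedding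
`φ` makes this class nonempty. A limit of a maximising sequence is injective by Hurwitz, and
surjective because an omitted value would allow a larger derivative. -/
theorem exists_isRiemannMap {U : Set ℂ} (hU : IsOpen U) (hUc : IsSimplyConnected U) {φ : ℂ → ℂ}
    (hφd : DifferentiableOn ℂ φ U) (hφi : InjOn φ U) (hφm : MapsTo φ U (ball 0 1)) :
    ∃ f : ℂ → ℂ, IsRiemannMap f U := by
  obtain ⟨z₀, hz₀⟩ := hUc.nonempty
  have hUp : IsPreconnected U := hUc.isPathConnected.isConnected.isPreconnected
  let S : Set (ℂ → ℂ) := {f | DifferentiableOn ℂ f U ∧ InjOn f U ∧ MapsTo f U (ball 0 1) ∧ f z₀ = 0}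
  have hφ1 : ‖-φ z₀‖ < 1 := by simpa using hφm hz₀
  have hS : S.Nonempty := ⟨mob (-φ z₀) ∘ φ, (differentiableOn_mob hφ1).comp hφd hφm,
    (injOn_mob hφ1).comp hφi hφm, (mapsTo_mob hφ1).comp hφm, by simp⟩
  obtain ⟨r, hr, hb⟩ := Metric.isOpen_iff.1 hU z₀ hz₀
  have hbdd : BddAbove ((fun f => ‖deriv f z₀‖) '' S) := by
    refine ⟨1 / r, ?_⟩
    rintro _ ⟨f, ⟨hd, -, hm, h0⟩, rfl⟩
    refine Complex.norm_deriv_le_div_of_mapsTo_ball (hd.mono hb) ?_ hr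
    rw [h0]
    exact (hm.mono_left hb).mono_right ball_subset_closedBall
  obtain ⟨u, -, hu, hmem⟩ := exists_seq_tendsto_sSup (hS.image fun f => ‖deriv f z₀‖) hbdd
  choose F hFS hFu using hmem
  set M := sSup ((fun f => ‖deriv f z₀‖) '' S) with hM
  have hMle : ∀ f ∈ S, ‖deriv f z₀‖ ≤ M := fun f hf => le_csSup hbdd ⟨f, hf, rfl⟩
  have hMpos : 0 < M := by
    obtain ⟨f, hf⟩ := hS
    exact (norm_pos_iff.2 (deriv_ne_zero_of_injOn hU hf.1 hf.2.1 hz₀)).trans_le (hMle f hf)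
  obtain ⟨f, hf⟩ := exists_tendstoLocallyUniformlyOn (hyperfilter ℕ) hU (fun n => (hFS n).1)
    (fun n => (hFS n).2.2.1)
  have hfd : DifferentiableOn ℂ f U :=
    hf.differentiableOn (Eventually.of_forall fun n => (hFS n).1) hU
  have hder : ‖deriv f z₀‖ = M := by
    have h1 := (hf.deriv (Eventually.of_forall fun n => (hFS n).1) hU).tendsto_at hz₀
    have h2 : Tendsto u (hyperfilter ℕ) (𝓝 M) := hu.mono_left (by
      rw [← Nat.cofinite_eq_atTop]
      exact hyperfilter_le_cofinite)
    refine tendsto_nhds_unique h1.norm (h2.congr fun n => ?_)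
    exact (hFu n).symm
  have hfi : InjOn f U := injOn_of_tendstoLocallyUniformlyOn hU hUp hf (fun n => (hFS n).1)
    (fun n => (hFS n).2.1) hz₀ (norm_pos_iff.1 (hder ▸ hMpos))
  have hf0 : f z₀ = 0 := by
    refine tendsto_nhds_unique (hf.tendsto_at hz₀) ?_
    simp only [fun n => (hFS n).2.2.2]
    exact tendsto_const_nhds
  have hfm : MapsTo f U (ball 0 1) := by
    have h1 : f '' U ⊆ closedBall 0 1 := by
      rintro _ ⟨z, hz, rfl⟩
      exact isClosed_closedBall.mem_of_tendsto (hf.tendsto_at hz)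
        (Eventually.of_forall fun n => ball_subset_closedBall ((hFS n).2.2.1 hz))
    have h2 := (isOpen_image_of_injOn hU hfd hfi).subset_interior_iff.2 h1
    rw [interior_closedBall _ one_ne_zero] at h2
    exact mapsTo_iff_image_subset.2 h2
  have hsurj : f '' U = ball 0 1 := by
    refine Subset.antisymm hfm.image_subset fun w hw => ?_
    by_contra hwn
    obtain ⟨G, hG1, hG2, hG3, hG4, hG5⟩ := exists_larger_deriv hU hUc hfd hfi hfm hz₀ hf0 hw hwn
    exact absurd (hMle G ⟨hG1, hG2, hG3, hG4⟩) (not_le.2 (hder ▸ hG5))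
  refine ⟨Function.invFunOn f U, ?_, ?_, ?_⟩
  · rw [← hsurj]
    exact differentiableOn_invFunOn hU hfd hfi
  · rw [← hsurj]
    rintro _ ⟨z, hz, rfl⟩ _ ⟨w, hw, rfl⟩ h
    rw [invFunOn_image hfi hz, invFunOn_image hfi hw] at h
    rw [h]
  · rw [← hsurj, image_image]
    refine Subset.antisymm ?_ fun z hz => ⟨z, hz, invFunOn_image hfi hz⟩
    rintro _ ⟨z, hz, rfl⟩
    simpa only [invFunOn_image hfi hz] using hz

end HypGeom

namespace HypGeom

open MeasureTheory
open scoped ENNReal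

/-! ### Radial cluster values of bounded injective holomorphic functions -/

theorem det_smul_one (c : ℂ) : (c • (1 : ℂ →L[ℝ] ℂ)).det = ‖c‖ ^ 2 := by
  rw [← Complex.normSq_eq_norm_sq, ← Algebra.norm_complex_apply, Algebra.norm_apply,
    ContinuousLinearMap.det]
  congr 1

/-- The integral of `‖F'‖ ^ 2` is the area of the bounded image, and `‖F'‖ ≤ 1 + ‖F'‖ ^ 2`. -/
theorem lintegral_enorm_deriv_ne_top {F : ℂ → ℂ} (hd : DifferentiableOn ℂ F (ball 0 1))
    (hi : InjOn F (ball 0 1)) {M : ℝ} (hM : ∀ z ∈ ball (0 : ℂ) 1, ‖F z‖ ≤ M) :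
    ∫⁻ z in ball 0 1, ‖deriv F z‖ₑ ≠ ∞ := by
  have h1 := lintegral_abs_det_fderiv_eq_addHaar_image volume measurableSet_ball
    (fun z hz => (hd.differentiableAt
      (isOpen_ball.mem_nhds hz)).hasDerivAt.complexToReal_fderiv.hasFDerivWithinAt) hi
  have h2 : volume (F '' ball 0 1) < ∞ := by
    refine (measure_mono (t := closedBall 0 M) ?_).trans_lt measure_closedBall_lt_top
    rintro _ ⟨z, hz, rfl⟩
    simpa using hM z hz
  have h3 : ∫⁻ z in ball 0 1, ‖deriv F z‖ₑ ≤
      ∫⁻ z in ball (0 : ℂ) 1, (1 + ENNReal.ofReal |(deriv F z • (1 : ℂ →L[ℝ] ℂ)).det|) := by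
    refine lintegral_mono fun z => ?_
    rw [det_smul_one, abs_of_nonneg (by positivity), ← ofReal_norm, ← ENNReal.ofReal_one,
      ← ENNReal.ofReal_add zero_le_one (by positivity)]
    exact ENNReal.ofReal_le_ofReal (by nlinarith [sq_nonneg (‖deriv F z‖ - 1)])
  refine (h3.trans_lt ?_).ne
  rw [lintegral_add_left measurable_const, h1]
  refine ENNReal.add_lt_top.2 ⟨?_, h2⟩
  rw [setLIntegral_one]
  exact measure_ball_lt_top

theorem tendsto_lintegral_annulus {g : ℂ → ℝ≥0∞} (hg : ∫⁻ z in ball 0 1, g z ≠ ∞) :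
    Tendsto (fun r => ∫⁻ z in ball 0 1 \ closedBall 0 r, g z) (𝓝[<] 1) (𝓝 0) := by
  have h0 : Tendsto (fun r : ℝ => (volume.restrict (ball (0 : ℂ) 1)) (ball 0 1 \ closedBall 0 r))
      (𝓝[<] 1) (𝓝 0) := by
    have h1 : Tendsto (fun r : ℝ => ENNReal.ofReal (Real.pi - r ^ 2 * Real.pi)) (𝓝[<] 1) (𝓝 0) := by
      have : Tendsto (fun r : ℝ => ENNReal.ofReal (Real.pi - r ^ 2 * Real.pi)) (𝓝 1)
          (𝓝 (ENNReal.ofReal (Real.pi - 1 ^ 2 * Real.pi))) :=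
        ENNReal.tendsto_ofReal (Continuous.tendsto (by fun_prop) 1)
      simp only [one_pow, one_mul, sub_self, ENNReal.ofReal_zero] at this
      exact this.mono_left nhdsWithin_le_nhds
    refine tendsto_of_tendsto_of_tendsto_of_le_of_le' tendsto_const_nhds h1
      (Eventually.of_forall fun _ => zero_le) ?_
    filter_upwards [Ioo_mem_nhdsLT (zero_lt_one' ℝ)] with r hr
    refine (Measure.restrict_apply_le _ _).trans ?_
    rw [measure_sdiff (closedBall_subset_ball hr.2) measurableSet_closedBall.nullMeasurableSet
      measure_closedBall_lt_top.ne, Complex.volume_ball, Complex.volume_closedBall,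
      ENNReal.ofReal_sub _ (by have := Real.pi_pos; positivity),
      ENNReal.ofReal_mul (by positivity), ENNReal.ofReal_pow hr.1.le]
    simp only [ENNReal.ofReal_one, one_pow, one_mul]
    rw [show ENNReal.ofReal Real.pi = (NNReal.pi : ℝ≥0∞) from by
      rw [← NNReal.coe_real_pi, ENNReal.ofReal_coe_nnreal]]
  refine (tendsto_setLIntegral_zero hg h0).congr fun r => ?_
  rw [Measure.restrict_restrict (measurableSet_ball.diff measurableSet_closedBall),
    inter_eq_left.2 sdiff_subset]

theorem polarCoord_symm_eq_circleMap (p : ℝ × ℝ) :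
    Complex.polarCoord.symm p = circleMap 0 p.1 p.2 := by
  rw [Complex.polarCoord_symm_apply, circleMap_zero, Complex.exp_mul_I]
  push_cast
  rfl

/-- In polar coordinates the Jacobian is the radius, which is at least `r` on the annulus; `κ ≤ π`
keeps the angles in the polar chart. -/
theorem lintegral_rays_le {g : ℂ → ℝ≥0∞} (hg : Measurable g) {r κ : ℝ} (hr : 0 < r)
    (hκ : κ ≤ Real.pi) :
    ENNReal.ofReal r * ∫⁻ θ in Ioo (-κ) κ, ∫⁻ t in Ioo r 1, g (circleMap 0 t θ) ≤
      ∫⁻ z in ball 0 1 \ closedBall 0 r, g z := by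
  have hcm : Measurable fun p : ℝ × ℝ => circleMap 0 p.1 p.2 := by
    have : Continuous fun p : ℝ × ℝ => circleMap 0 p.1 p.2 := by
      simp only [circleMap]
      fun_prop
    exact this.measurable
  have hgm : Measurable fun p : ℝ × ℝ => g (circleMap 0 p.1 p.2) := hg.comp hcm
  rw [← lintegral_indicator (measurableSet_ball.diff measurableSet_closedBall),
    ← Complex.lintegral_comp_polarCoord_symm]
  calc ENNReal.ofReal r * ∫⁻ θ in Ioo (-κ) κ, ∫⁻ t in Ioo r 1, g (circleMap 0 t θ)
      = ∫⁻ p in Ioo r 1 ×ˢ Ioo (-κ) κ, ENNReal.ofReal r * g (circleMap 0 p.1 p.2) := by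
        rw [lintegral_const_mul _ hgm, Measure.volume_eq_prod,
          ← Measure.prod_restrict, lintegral_prod_symm _ hgm.aemeasurable]
    _ ≤ ∫⁻ p in Ioo r 1 ×ˢ Ioo (-κ) κ, ENNReal.ofReal p.1 •
          (ball 0 1 \ closedBall 0 r).indicator g (Complex.polarCoord.symm p) := by
        refine setLIntegral_mono' (measurableSet_Ioo.prod measurableSet_Ioo) fun p hp => ?_
        have hp0 : |p.1| = p.1 := abs_of_pos (hr.trans hp.1.1)
        rw [polarCoord_symm_eq_circleMap, indicator_of_mem, smul_eq_mul]
        · gcongr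
          exact hp.1.1.le
        · simp [hp0, hp.1.1, hp.1.2]
    _ ≤ _ := by
        refine lintegral_mono_set fun p hp => ?_
        exact ⟨hr.trans hp.1.1, by linarith [hp.2.1], by linarith [hp.2.2]⟩

theorem circleMap_mem_ball {r θ : ℝ} (h0 : 0 ≤ r) (h1 : r < 1) : circleMap 0 r θ ∈ ball (0 : ℂ) 1 := by
  simp [abs_of_nonneg h0, h1]

theorem enorm_sub_le_lintegral_ray {F : ℂ → ℂ} (hd : DifferentiableOn ℂ F (ball 0 1)) {r ρ θ : ℝ}
    (hr : 0 < r) (hrρ : r ≤ ρ) (hρ : ρ < 1) :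
    ‖F (circleMap 0 ρ θ) - F (circleMap 0 r θ)‖ₑ ≤
      ∫⁻ t in Ioo r 1, ‖deriv F (circleMap 0 t θ)‖ₑ := by
  have hmem : ∀ t ∈ Icc r ρ, circleMap 0 t θ ∈ ball (0 : ℂ) 1 := fun t ht =>
    circleMap_mem_ball (hr.le.trans ht.1) (ht.2.trans_lt hρ)
  have hder : ∀ t ∈ uIcc r ρ, HasDerivAt (fun t : ℝ => F (circleMap 0 t θ))
      (Complex.exp (θ * Complex.I) • deriv F (circleMap 0 t θ)) t := by
    intro t ht
    rw [uIcc_of_le hrρ] at ht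
    have h1 : HasDerivAt (fun t : ℝ => circleMap 0 t θ) (Complex.exp (θ * Complex.I)) t := by
      simp only [circleMap_zero]
      simpa using (Complex.ofRealCLM.hasDerivAt (x := t)).mul_const (Complex.exp (θ * Complex.I))
    exact HasDerivAt.scomp t (hd.differentiableAt (isOpen_ball.mem_nhds (hmem t ht))).hasDerivAt h1
  have hcont : ContinuousOn (fun t : ℝ => Complex.exp (θ * Complex.I) •
      deriv F (circleMap 0 t θ)) (uIcc r ρ) := by
    rw [uIcc_of_le hrρ]
    simp only [smul_eq_mul]
    refine continuousOn_const.mul ((hd.deriv isOpen_ball).continuousOn.comp ?_ hmem)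
    simp only [circleMap]
    fun_prop
  rw [← intervalIntegral.integral_eq_sub_of_hasDerivAt hder hcont.intervalIntegrable,
    intervalIntegral.integral_of_le hrρ]
  refine (enorm_integral_le_lintegral_enorm _).trans ?_
  simp only [enorm_smul, Complex.enorm_exp_ofReal_mul_I, one_mul]
  refine lintegral_mono_set fun t ht => ⟨ht.1, ht.2.trans_lt hρ⟩

/-- Since `F` comes arbitrarily close to `q` further out on each ray, `‖F - q‖` at radius `r` is at
most the length of the image of the rest of the ray. Integrated over the angles, these lengths are
controlled by the integral of `‖F'‖` over a thin annulus. -/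
theorem tendsto_integral_of_radial_cluster {F : ℂ → ℂ} (hd : DifferentiableOn ℂ F (ball 0 1))
    (hi : InjOn F (ball 0 1)) {M : ℝ} (hM : ∀ z ∈ ball (0 : ℂ) 1, ‖F z‖ ≤ M) {κ : ℝ} (hκ0 : 0 < κ)
    (hκ : κ ≤ Real.pi) {q : ℂ} (hq : ∀ θ ∈ Icc (-κ) κ, ∀ r < 1, ∀ ε > 0, ∃ ρ ∈ Ioo r 1,
      ‖F (circleMap 0 ρ θ) - q‖ < ε) :
    Tendsto (fun r => ∫ θ in -κ..κ, ‖F (circleMap 0 r θ) - q‖) (𝓝[<] 1) (𝓝 0) := by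
  have hA := tendsto_lintegral_annulus (lintegral_enorm_deriv_ne_top hd hi hM)
  -- The factor `2` absorbs `1 / r` for `r > 1 / 2`.
  have hA2 : Tendsto (fun r => 2 * ∫⁻ z in ball 0 1 \ closedBall 0 r, ‖deriv F z‖ₑ)
      (𝓝[<] 1) (𝓝 0) := by
    simpa using ENNReal.Tendsto.const_mul hA (Or.inr ENNReal.ofNat_ne_top)
  have hB : Tendsto (fun r => ENNReal.ofReal (∫ θ in -κ..κ, ‖F (circleMap 0 r θ) - q‖))
      (𝓝[<] 1) (𝓝 0) := by
    refine tendsto_of_tendsto_of_tendsto_of_le_of_le' tendsto_const_nhds hA2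
      (Eventually.of_forall fun _ => zero_le) ?_
    filter_upwards [Ioo_mem_nhdsLT (show (1 / 2 : ℝ) < 1 by norm_num)] with r hr
    have hr0 : 0 < r := by linarith [hr.1]
    have hcont : Continuous fun θ => F (circleMap 0 r θ) - q :=
      (hd.continuousOn.comp_continuous (continuous_circleMap 0 r)
        fun θ => circleMap_mem_ball hr0.le hr.2).sub continuous_const
    have h1 : ENNReal.ofReal (∫ θ in -κ..κ, ‖F (circleMap 0 r θ) - q‖) =
        ∫⁻ θ in Ioo (-κ) κ, ‖F (circleMap 0 r θ) - q‖ₑ := by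
      rw [intervalIntegral.integral_of_le (by linarith), integral_Ioc_eq_integral_Ioo,
        ofReal_integral_norm_eq_lintegral_enorm]
      exact (hcont.integrableOn_Icc).mono_set Ioo_subset_Icc_self
    rw [h1]
    have h2 : ∫⁻ θ in Ioo (-κ) κ, ‖F (circleMap 0 r θ) - q‖ₑ ≤
        ∫⁻ θ in Ioo (-κ) κ, ∫⁻ t in Ioo r 1, ‖deriv F (circleMap 0 t θ)‖ₑ := by
      refine setLIntegral_mono' measurableSet_Ioo fun θ hθ => ?_
      refine ENNReal.le_of_forall_pos_le_add fun ε hε _ => ?_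
      obtain ⟨ρ, hρ, hlt⟩ := hq θ (Ioo_subset_Icc_self hθ) r hr.2 ε hε
      have h3 := enorm_sub_le_lintegral_ray hd hr0 hρ.1.le hρ.2 (θ := θ)
      calc ‖F (circleMap 0 r θ) - q‖ₑ
          = ‖(F (circleMap 0 ρ θ) - q) - (F (circleMap 0 ρ θ) - F (circleMap 0 r θ))‖ₑ := by
            congr 1; ring
        _ ≤ ‖F (circleMap 0 ρ θ) - q‖ₑ + ‖F (circleMap 0 ρ θ) - F (circleMap 0 r θ)‖ₑ :=
            enorm_sub_le
        _ ≤ ε + _ := by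
            gcongr
            rw [← ofReal_norm, ← ENNReal.ofReal_coe_nnreal]
            exact ENNReal.ofReal_le_ofReal hlt.le
        _ = _ := add_comm _ _
    have h4 := lintegral_rays_le (measurable_deriv F).enorm hr0 hκ
    refine h2.trans ?_
    calc _ = 2 * (ENNReal.ofReal (1 / 2) *
          ∫⁻ θ in Ioo (-κ) κ, ∫⁻ t in Ioo r 1, ‖deriv F (circleMap 0 t θ)‖ₑ) := by
          rw [← mul_assoc, ← ENNReal.ofReal_ofNat 2, ← ENNReal.ofReal_mul (by norm_num)]
          norm_num
      _ ≤ 2 * (ENNReal.ofReal r *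
          ∫⁻ θ in Ioo (-κ) κ, ∫⁻ t in Ioo r 1, ‖deriv F (circleMap 0 t θ)‖ₑ) := by
          gcongr
          exact hr.1.le
      _ ≤ _ := by gcongr
  have hC := (ENNReal.tendsto_toReal ENNReal.zero_ne_top).comp hB
  simp only [ENNReal.toReal_zero] at hC
  refine hC.congr fun r => ENNReal.toReal_ofReal ?_
  exact intervalIntegral.integral_nonneg (by linarith) fun _ _ => norm_nonneg _

end HypGeom

namespace HypGeom

open MeasureTheory

/-! ### Uniqueness from vanishing means over circles and arcs -/

/-- By Cauchy's formula `G z` is the circle average of `w / (w - z) * G w`, and the kernel is at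
most `2 / (1 - ‖z‖)` once the radius exceeds `(1 + ‖z‖) / 2`. -/
theorem eq_zero_of_tendsto_circle_integral {G : ℂ → ℂ} (hd : DifferentiableOn ℂ G (ball 0 1))
    (hG : Tendsto (fun r => ∫ θ in 0..2 * Real.pi, ‖G (circleMap 0 r θ)‖) (𝓝[<] 1) (𝓝 0))
    {z : ℂ} (hz : z ∈ ball (0 : ℂ) 1) : G z = 0 := by
  have hz1 : ‖z‖ < 1 := by simpa using hz
  have hpi := Real.pi_pos
  set C : ℝ := (2 * Real.pi)⁻¹ * (2 / (1 - ‖z‖)) with hC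
  have hb : ∀ᶠ r in 𝓝[<] (1 : ℝ), ‖G z‖ ≤ C * ∫ θ in 0..2 * Real.pi, ‖G (circleMap 0 r θ)‖ := by
    filter_upwards [Ioo_mem_nhdsLT (show (1 + ‖z‖) / 2 < 1 by linarith)] with r hr
    have hzr : ‖z‖ < r := by linarith [hr.1]
    have hr0 : 0 < r := (norm_nonneg z).trans_lt hzr
    have hmem : ∀ θ, circleMap 0 r θ ∈ ball (0 : ℂ) 1 := fun θ => circleMap_mem_ball hr0.le hr.2
    have hne : ∀ θ, circleMap 0 r θ - z ≠ 0 := fun θ h => by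
      have h1 := congrArg norm (sub_eq_zero.1 h)
      rw [norm_circleMap_zero, abs_of_pos hr0] at h1
      linarith
    have hcG : Continuous fun θ => G (circleMap 0 r θ) :=
      hd.continuousOn.comp_continuous (continuous_circleMap 0 r) hmem
    have hav := DiffContOnCl.circleAverage_smul_div (f := G) (c := 0) (R := r) (w := z)
      ((hd.mono (closure_ball_subset_closedBall.trans (closedBall_subset_ball (by
        rw [abs_of_pos hr0]; exact hr.2)))).diffContOnCl) (by simpa [abs_of_pos hr0] using hzr)
    rw [← hav, Real.circleAverage_def, norm_smul, Real.norm_of_nonneg (by positivity), hC,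
      mul_assoc]
    refine mul_le_mul_of_nonneg_left ?_ (by positivity)
    rw [← intervalIntegral.integral_const_mul]
    have hc1 : Continuous fun θ => ((circleMap 0 r θ - 0) / (circleMap 0 r θ - z)) •
        G (circleMap 0 r θ) := by
      have h1 := continuous_circleMap (0 : ℂ) r
      exact (((h1.sub continuous_const).div (h1.sub continuous_const) hne)).smul hcG
    refine (intervalIntegral.norm_integral_le_integral_norm (by positivity)).trans ?_
    refine intervalIntegral.integral_mono_on (by positivity) (hc1.norm.intervalIntegrable _ _)
      ((hcG.norm.const_mul _).intervalIntegrable _ _) fun θ _ => ?_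
    rw [norm_smul, norm_div, sub_zero, norm_circleMap_zero, abs_of_pos hr0]
    refine mul_le_mul_of_nonneg_right ?_ (norm_nonneg _)
    have h2 : (1 - ‖z‖) / 2 ≤ ‖circleMap 0 r θ - z‖ := by
      have := norm_sub_norm_le (circleMap 0 r θ) z
      rw [norm_circleMap_zero, abs_of_pos hr0] at this
      linarith [hr.1]
    rw [div_le_div_iff₀ (norm_pos_iff.2 (hne θ)) (by linarith)]
    nlinarith [hr.2]
  have hlim : Tendsto (fun r => C * ∫ θ in 0..2 * Real.pi, ‖G (circleMap 0 r θ)‖)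
      (𝓝[<] 1) (𝓝 0) := by
    simpa using hG.const_mul C
  exact norm_le_zero_iff.1 (ge_of_tendsto hlim hb)

/-- A bounded holomorphic function whose means over an arc tend to zero has a zero among any
suitable finite set of rotates of a point. -/
theorem exists_rotate_eq_zero {f : ℂ → ℂ} (hd : DifferentiableOn ℂ f (ball 0 1)) {M : ℝ}
    (hM : ∀ z ∈ ball (0 : ℂ) 1, ‖f z‖ ≤ M) {κ : ℝ} {m : ℕ} (hm : 0 < m)
    (hmκ : Real.pi ≤ κ * m)
    (hf : Tendsto (fun r => ∫ θ in -κ..κ, ‖f (circleMap 0 r θ)‖) (𝓝[<] 1) (𝓝 0)) {z : ℂ}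
    (hz : z ∈ ball (0 : ℂ) 1) :
    ∃ ω : ℂ, ‖ω‖ = 1 ∧ f (ω * z) = 0 := by
  have hpi := Real.pi_pos
  have hm0 : (0 : ℝ) < m := by exact_mod_cast hm
  have hκ0 : 0 < κ := pos_of_mul_pos_left (hpi.trans_le hmκ) hm0.le
  set T : ℝ := 2 * Real.pi / m with hT
  have hT0 : 0 < T := by positivity
  have hTκ : T ≤ 2 * κ := by
    rw [hT, div_le_iff₀ hm0]
    linarith
  set ω : ℕ → ℂ := fun k => Complex.exp ((k * T : ℝ) * Complex.I) with hω
  have hωn : ∀ k, ‖ω k‖ = 1 := fun k => Complex.norm_exp_ofReal_mul_I _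
  have hM0 : 0 ≤ M := (norm_nonneg _).trans (hM 0 (by simp))
  have hmem : ∀ k, ∀ w ∈ ball (0 : ℂ) 1, ω k * w ∈ ball (0 : ℂ) 1 := fun k w hw => by
    rw [mem_ball_zero_iff] at hw ⊢
    rwa [norm_mul, hωn, one_mul]
  -- The modulus of the product of all `m` rotates has period `T` on circles, so its circle integral
  -- is `m` times that over an arc of length `T ≤ 2 * κ`. On that arc one factor has small mean and
  -- the others are bounded by `M`. Hence `G` vanishes identically.
  set G : ℂ → ℂ := fun w => ∏ k ∈ Finset.range m, f (ω k * w) with hG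
  have hGd : DifferentiableOn ℂ G (ball 0 1) := by
    refine DifferentiableOn.fun_finsetProd fun k _ => ?_
    exact hd.comp (differentiableOn_id.const_mul (ω k)) (hmem k)
  have hωm : ω m = ω 0 := by
    simp only [hω, hT]
    rw [mul_div_cancel₀ _ hm0.ne']
    push_cast
    simp [Complex.exp_two_pi_mul_I]
  have hcirc : ∀ k r θ, ω k * circleMap 0 r (θ + T) = ω (k + 1) * circleMap 0 r θ := by
    intro k r θ
    simp only [hω, circleMap_zero]
    rw [mul_left_comm, mul_left_comm (Complex.exp _), ← Complex.exp_add, ← Complex.exp_add]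
    congr 2
    push_cast
    ring
  have hper : ∀ r, Function.Periodic (fun θ => ‖G (circleMap 0 r θ)‖) T := by
    intro r θ
    simp only [hG, hcirc]
    congr 1
    obtain ⟨m', rfl⟩ : ∃ m', m = m' + 1 := ⟨m - 1, by omega⟩
    rw [Finset.prod_range_succ, hωm, Finset.prod_range_succ']
  have hGle : ∀ w ∈ ball (0 : ℂ) 1, ‖G w‖ ≤ M ^ (m - 1) * ‖f w‖ := by
    intro w hw
    obtain ⟨m', rfl⟩ : ∃ m', m = m' + 1 := ⟨m - 1, by omega⟩
    simp only [hG]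
    rw [Finset.prod_range_succ', norm_mul, norm_prod]
    have h0 : ω 0 * w = w := by simp [hω]
    rw [h0, Nat.add_sub_cancel]
    refine mul_le_mul_of_nonneg_right ?_ (norm_nonneg _)
    calc _ ≤ ∏ _k ∈ Finset.range m', M :=
          Finset.prod_le_prod (fun _ _ => norm_nonneg _) fun k _ => hM _ (hmem _ w hw)
      _ = M ^ m' := by simp
  have hGt : Tendsto (fun r => ∫ θ in 0..2 * Real.pi, ‖G (circleMap 0 r θ)‖) (𝓝[<] 1) (𝓝 0) := by
    have hlim := hf.const_mul (m * M ^ (m - 1))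
    rw [mul_zero] at hlim
    refine tendsto_of_tendsto_of_tendsto_of_le_of_le' tendsto_const_nhds hlim
      (Eventually.of_forall fun r => intervalIntegral.integral_nonneg (by positivity)
        fun _ _ => norm_nonneg _) ?_
    filter_upwards [Ioo_mem_nhdsLT (zero_lt_one' ℝ)] with r hr
    have hc : ∀ θ, circleMap 0 r θ ∈ ball (0 : ℂ) 1 := fun θ => circleMap_mem_ball hr.1.le hr.2
    have hcG : Continuous fun θ => ‖G (circleMap 0 r θ)‖ :=
      (hGd.continuousOn.comp_continuous (continuous_circleMap 0 r) hc).norm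
    have hcf : Continuous fun θ => ‖f (circleMap 0 r θ)‖ :=
      (hd.continuousOn.comp_continuous (continuous_circleMap 0 r) hc).norm
    have h1 := (hper r).intervalIntegral_add_zsmul_eq m 0 fun _ _ => hcG.intervalIntegrable _ _
    have h2 := (hper r).intervalIntegral_add_eq 0 (-κ)
    have h3 : (0 : ℝ) + (m : ℤ) • T = 2 * Real.pi := by
      rw [zero_add, zsmul_eq_mul, Int.cast_natCast, hT, mul_div_cancel₀ _ hm0.ne']
    rw [h3, h2, zsmul_eq_mul, Int.cast_natCast] at h1
    rw [h1, mul_assoc]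
    refine mul_le_mul_of_nonneg_left ?_ hm0.le
    rw [← intervalIntegral.integral_const_mul]
    calc ∫ θ in -κ..-κ + T, ‖G (circleMap 0 r θ)‖
        ≤ ∫ θ in -κ..-κ + T, M ^ (m - 1) * ‖f (circleMap 0 r θ)‖ :=
          intervalIntegral.integral_mono_on (by linarith) (hcG.intervalIntegrable _ _)
            ((hcf.const_mul _).intervalIntegrable _ _) fun θ _ => hGle _ (hc θ)
      _ ≤ _ := intervalIntegral.integral_mono_interval le_rfl (by linarith) (by linarith)
          (Eventually.of_forall fun θ => by positivity) ((hcf.const_mul _).intervalIntegrable _ _)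
  have h0 := eq_zero_of_tendsto_circle_integral hGd hGt hz
  obtain ⟨k, -, hk⟩ := Finset.prod_eq_zero_iff.1 h0
  exact ⟨ω k, hωn k, hk⟩

/-- A bounded injective holomorphic function does not have the same radial cluster value at all
points of an arc. -/
theorem not_radial_cluster_arc {F : ℂ → ℂ} (hd : DifferentiableOn ℂ F (ball 0 1))
    (hi : InjOn F (ball 0 1)) {M : ℝ} (hM : ∀ z ∈ ball (0 : ℂ) 1, ‖F z‖ ≤ M) {κ : ℝ} (hκ0 : 0 < κ)
    (hκ : κ ≤ Real.pi) {q : ℂ} (hq : ∀ θ ∈ Icc (-κ) κ, ∀ r < 1, ∀ ε > 0, ∃ ρ ∈ Ioo r 1,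
      ‖F (circleMap 0 ρ θ) - q‖ < ε) : False := by
  have h1 := tendsto_integral_of_radial_cluster hd hi hM hκ0 hκ hq
  obtain ⟨m, hm⟩ := exists_nat_gt (Real.pi / κ)
  have hm0 : 0 < m := by
    have : (0 : ℝ) < m := (div_pos Real.pi_pos hκ0).trans hm
    exact_mod_cast this
  have hmκ : Real.pi ≤ κ * m := by
    rw [div_lt_iff₀ hκ0] at hm
    linarith
  -- Every circle about `0` inside the disc would carry a point where `F = q`; the radii `0` and `1
  -- / 2` already contradict injectivity.
  have key : ∀ z ∈ ball (0 : ℂ) 1, ∃ ω : ℂ, ‖ω‖ = 1 ∧ F (ω * z) - q = 0 := fun z hz =>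
    exists_rotate_eq_zero (hd.sub_const q) (M := M + ‖q‖)
      (fun w hw => (norm_sub_le _ _).trans (by linarith [hM w hw])) hm0 hmκ h1 hz
  obtain ⟨ω₁, hω₁, e₁⟩ := key 0 (by simp)
  have hhalf : (1 / 2 : ℂ) ∈ ball (0 : ℂ) 1 := by
    rw [mem_ball_zero_iff]; norm_num
  obtain ⟨ω₂, hω₂, e₂⟩ := key (1 / 2) hhalf
  have h2 : ω₁ * 0 = ω₂ * (1 / 2) := hi (by simp) (by
    rw [mem_ball_zero_iff, norm_mul, hω₂]; norm_num) (by
    rw [sub_eq_zero.1 e₁, sub_eq_zero.1 e₂])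
  have h3 := congrArg norm h2
  rw [mul_zero, norm_zero, norm_mul, hω₂] at h3
  norm_num at h3

end HypGeom

namespace HypGeom

/-! ### Koebe's lemma -/

theorem eq_norm_mul_of_arg {z c : ℂ} (hc : ‖c‖ = 1) {φ α : ℝ}
    (h : (z * (c * Complex.exp (φ * Complex.I))⁻¹).arg = α) :
    z = ‖z‖ * (c * Complex.exp ((α + φ : ℝ) * Complex.I)) := by
  have hc0 : c ≠ 0 := norm_ne_zero_iff.1 (by rw [hc]; exact one_ne_zero)
  have hne : c * Complex.exp (φ * Complex.I) ≠ 0 := mul_ne_zero hc0 (Complex.exp_ne_zero _)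
  have h1 := Complex.norm_mul_exp_arg_mul_I (z * (c * Complex.exp (φ * Complex.I))⁻¹)
  rw [h, norm_mul, norm_inv, norm_mul, hc, Complex.norm_exp_ofReal_mul_I, one_mul, inv_one,
    mul_one, ← div_eq_mul_inv, eq_div_iff hne] at h1
  rw [← h1, Complex.ofReal_add, add_mul, Complex.exp_add]
  simp only [norm_mul, Complex.norm_real, norm_norm, Complex.norm_exp_ofReal_mul_I, hc, mul_one]
  ring

/-- A connected set from near `c e^{iτ}` to near `c e^{-iτ}` meets all rays near `c`, or all rays
near `-c`. -/
theorem rays_meet_or {Γ : Set ℂ} (hΓ : IsPreconnected Γ) (h0 : (0 : ℂ) ∉ Γ) {c : ℂ} (hc : ‖c‖ = 1)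
    {κ : ℝ} (hκ : 0 < κ) (hκ2 : κ ≤ Real.pi / 4) {x y : ℂ} (hx : x ∈ Γ) (hy : y ∈ Γ)
    (hxa : (x * c⁻¹).arg ∈ Icc κ (Real.pi - 2 * κ))
    (hya : (y * c⁻¹).arg ∈ Icc (-(Real.pi - 2 * κ)) (-κ)) :
    (∀ θ ∈ Icc (-κ) κ, ∃ z ∈ Γ, z = ‖z‖ * (c * Complex.exp (θ * Complex.I))) ∨
    (∀ θ ∈ Icc (-κ) κ, ∃ z ∈ Γ, z = ‖z‖ * (-c * Complex.exp (θ * Complex.I))) := by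
  have hc0 : c ≠ 0 := norm_ne_zero_iff.1 (by rw [hc]; exact one_ne_zero)
  by_contra hcon
  push Not at hcon
  obtain ⟨⟨θ, hθ, hmiss⟩, φ, hφ, hmiss'⟩ := hcon
  have hw0 : ∀ z ∈ Γ, z * (c * Complex.exp (φ * Complex.I))⁻¹ ≠ 0 := fun z hz =>
    mul_ne_zero (fun e => h0 (e ▸ hz)) (inv_ne_zero (mul_ne_zero hc0 (Complex.exp_ne_zero _)))
  -- Missing the ray through `-c e^{iφ}` places `Γ` in a slit plane on which the rotated argument is
  -- continuous. Its values at `y` and `x` straddle `θ - φ`, so `Γ` meets the ray through `c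
  -- e^{iθ}`, which it was supposed to miss.
  have hslit : ∀ z ∈ Γ, z * (c * Complex.exp (φ * Complex.I))⁻¹ ∈ Complex.slitPlane := by
    intro z hz
    refine Complex.mem_slitPlane_iff_arg.2 ⟨fun h => hmiss' z hz ?_, hw0 z hz⟩
    have h1 := eq_norm_mul_of_arg hc h
    rw [Complex.ofReal_add, add_mul, Complex.exp_add, Complex.exp_pi_mul_I] at h1
    rw [neg_mul]
    simpa using h1
  have hcont : ContinuousOn (fun z => (z * (c * Complex.exp (φ * Complex.I))⁻¹).arg) Γ :=
    fun z hz => ((Complex.continuousAt_arg (hslit z hz)).comp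
      (f := fun z => z * (c * Complex.exp (φ * Complex.I))⁻¹)
      (continuous_id.mul continuous_const).continuousAt).continuousWithinAt
  have harg : ∀ z ∈ Γ, (z * c⁻¹).arg - φ ∈ Ioc (-Real.pi) Real.pi →
      (z * (c * Complex.exp (φ * Complex.I))⁻¹).arg = (z * c⁻¹).arg - φ := by
    intro z hz h
    have hz0 : z * c⁻¹ ≠ 0 := mul_ne_zero (fun e => h0 (e ▸ hz)) (inv_ne_zero hc0)
    have e : z * (c * Complex.exp (φ * Complex.I))⁻¹ =
        ‖z * c⁻¹‖ * Complex.exp (((z * c⁻¹).arg - φ : ℝ) * Complex.I) := by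
      rw [Complex.ofReal_sub, sub_mul, Complex.exp_sub, mul_div_assoc',
        Complex.norm_mul_exp_arg_mul_I, mul_inv, div_eq_mul_inv]
      ring
    rw [e, Complex.exp_mul_I, Complex.arg_mul_cos_add_sin_mul_I (norm_pos_iff.2 hz0) h]
  have hx1 := harg x hx ⟨by linarith [hxa.1, hφ.2], by linarith [hxa.2, hφ.1]⟩
  have hy1 := harg y hy ⟨by linarith [hya.1, hφ.2], by linarith [hya.2, hφ.1, Real.pi_pos]⟩
  obtain ⟨z, hz, hza⟩ := hΓ.intermediate_value hy hx hcont
    (show θ - φ ∈ Icc _ _ from ⟨by simp only [hy1]; linarith [hya.2, hθ.1],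
      by simp only [hx1]; linarith [hxa.1, hθ.2]⟩)
  have h1 := eq_norm_mul_of_arg hc hza
  rw [sub_add_cancel] at h1
  exact hmiss z hz h1

section Koebe

variable {F : ℂ → ℂ} {M : ℝ} {Γ : ℕ → Set ℂ}

/-- Along a subsequence the values of `F` on `Γ n` approach one number `q`. If these sets meet all
rays of an arc, arbitrarily close to the circle, then `q` is a radial cluster value on the whole
arc. -/
theorem not_frequently_rays_meet (hd : DifferentiableOn ℂ F (ball 0 1))
    (hi : InjOn F (ball 0 1)) (hM : ∀ z ∈ ball (0 : ℂ) 1, ‖F z‖ ≤ M)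
    (hΓb : ∀ n, Γ n ⊆ ball 0 1) (hΓr : ∀ r < 1, ∀ᶠ n in atTop, ∀ z ∈ Γ n, r < ‖z‖)
    (hosc : ∀ ε > 0, ∀ᶠ n in atTop, ∀ z ∈ Γ n, ∀ w ∈ Γ n, ‖F z - F w‖ < ε) {c : ℂ} (hc : ‖c‖ = 1)
    {κ : ℝ} (hκ : 0 < κ) (hκ2 : κ ≤ Real.pi) :
    ¬ ∃ᶠ n in atTop, ∀ θ ∈ Icc (-κ) κ, ∃ z ∈ Γ n, z = ‖z‖ * (c * Complex.exp (θ * Complex.I)) := by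
  intro hfr
  obtain ⟨φ, hφ, hφm⟩ := extraction_of_frequently_atTop hfr
  have hne : ∀ n, ∃ z, z ∈ Γ (φ n) := fun n =>
    let ⟨z, hz, _⟩ := hφm n 0 ⟨by linarith, hκ.le⟩
    ⟨z, hz⟩
  choose x hx using hne
  obtain ⟨q, -, ψ, hψ, hlim⟩ := tendsto_subseq_of_bounded (x := fun n => F (x n))
    (isBounded_closedBall (x := (0 : ℂ)) (r := M)) fun n => by
      simpa using hM _ (hΓb _ (hx n))
  have hrot : MapsTo (fun z => c * z) (ball (0 : ℂ) 1) (ball 0 1) := fun z hz => by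
    rw [mem_ball_zero_iff] at hz ⊢
    rwa [norm_mul, hc, one_mul]
  have hc0 : c ≠ 0 := norm_ne_zero_iff.1 (by rw [hc]; exact one_ne_zero)
  refine not_radial_cluster_arc (F := fun z => F (c * z)) (q := q)
    (hd.comp (differentiableOn_id.const_mul c) hrot)
    (hi.comp (fun a _ b _ h => mul_left_cancel₀ hc0 h) hrot) (fun z hz => hM _ (hrot hz)) hκ hκ2 ?_
  intro θ hθ r hr ε hε
  have hmono : Tendsto (fun k => φ (ψ k)) atTop atTop := hφ.tendsto_atTop.comp hψ.tendsto_atTop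
  obtain ⟨k, hk1, hk2, hk3⟩ := ((hmono.eventually (hΓr r hr)).and
    ((hmono.eventually (hosc (ε / 2) (by positivity))).and
      (Metric.tendsto_nhds.1 hlim (ε / 2) (by positivity)))).exists
  obtain ⟨z, hz, hze⟩ := hφm (ψ k) θ hθ
  refine ⟨‖z‖, ⟨hk1 z hz, by simpa using hΓb _ hz⟩, ?_⟩
  have e : c * circleMap 0 ‖z‖ θ = z := by
    rw [circleMap_zero]
    conv_rhs => rw [hze]
    ring
  simp only [e]
  have h1 := hk2 z hz _ (hx (ψ k))
  rw [dist_eq_norm] at hk3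
  calc ‖F z - q‖ = ‖(F z - F (x (ψ k))) + (F (x (ψ k)) - q)‖ := by congr 1; ring
    _ ≤ ‖F z - F (x (ψ k))‖ + ‖F (x (ψ k)) - q‖ := norm_add_le _ _
    _ < ε := by simp only [Function.comp_apply] at hk3; linarith

theorem koebe_aux (hd : DifferentiableOn ℂ F (ball 0 1))
    (hi : InjOn F (ball 0 1)) (hM : ∀ z ∈ ball (0 : ℂ) 1, ‖F z‖ ≤ M)
    (hΓb : ∀ n, Γ n ⊆ ball 0 1) (hΓc : ∀ n, IsPreconnected (Γ n))
    (hΓr : ∀ r < 1, ∀ᶠ n in atTop, ∀ z ∈ Γ n, r < ‖z‖)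
    (hosc : ∀ ε > 0, ∀ᶠ n in atTop, ∀ z ∈ Γ n, ∀ w ∈ Γ n, ‖F z - F w‖ < ε) {x y : ℕ → ℂ}
    (hx : ∀ n, x n ∈ Γ n) (hy : ∀ n, y n ∈ Γ n) {c : ℂ} (hc : ‖c‖ = 1) {τ : ℝ} (hτ : 0 < τ)
    (hτ2 : τ ≤ Real.pi / 2)
    (hxl : Tendsto x atTop (𝓝 (c * Complex.exp (τ * Complex.I))))
    (hyl : Tendsto y atTop (𝓝 (c * Complex.exp ((-τ : ℝ) * Complex.I)))) : False := by
  have hc0 : c ≠ 0 := norm_ne_zero_iff.1 (by rw [hc]; exact one_ne_zero)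
  have hpi := Real.pi_pos
  have hargl : ∀ {u : ℕ → ℂ} {t : ℝ}, |t| < Real.pi →
      Tendsto u atTop (𝓝 (c * Complex.exp (t * Complex.I))) →
      Tendsto (fun n => (u n * c⁻¹).arg) atTop (𝓝 t) := by
    intro u t ht hu
    have ht' := abs_lt.1 ht
    have harg : (Complex.exp (t * Complex.I)).arg = t := by
      rw [Complex.arg_exp_mul_I, toIocMod_eq_self]
      exact ⟨ht'.1, by linarith [ht'.2]⟩
    have h1 : Tendsto (fun n => u n * c⁻¹) atTop (𝓝 (Complex.exp (t * Complex.I))) := by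
      have := hu.mul_const c⁻¹
      rwa [mul_comm c, mul_assoc, mul_inv_cancel₀ hc0, mul_one] at this
    have h2 := (Complex.continuousAt_arg (x := Complex.exp (t * Complex.I))
      (Complex.mem_slitPlane_iff_arg.2 ⟨by rw [harg]; exact ht'.2.ne, Complex.exp_ne_zero _⟩))
    have h3 := h2.tendsto.comp h1
    rwa [harg] at h3
  -- With this choice and `τ ≤ π / 2`, the limiting arguments `±τ` are interior to the two windows
  -- required by `rays_meet_or`.
  set κ := τ / 4 with hκ
  have hκ0 : 0 < κ := by positivity
  have hxa := (hargl (by rw [abs_of_pos hτ]; linarith) hxl).eventually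
    (Icc_mem_nhds (show κ < τ by linarith) (show τ < Real.pi - 2 * κ by linarith))
  have hya := (hargl (by rw [abs_neg, abs_of_pos hτ]; linarith) hyl).eventually
    (Icc_mem_nhds (show -(Real.pi - 2 * κ) < -τ by linarith) (show -τ < -κ by linarith))
  have hor : ∀ᶠ n in atTop,
      (∀ θ ∈ Icc (-κ) κ, ∃ z ∈ Γ n, z = ‖z‖ * (c * Complex.exp (θ * Complex.I))) ∨
      (∀ θ ∈ Icc (-κ) κ, ∃ z ∈ Γ n, z = ‖z‖ * (-c * Complex.exp (θ * Complex.I))) := by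
    filter_upwards [hxa, hya, hΓr 0 one_pos] with n h1 h2 h3
    exact rays_meet_or (hΓc n) (fun h => by simpa using h3 0 h) hc hκ0 (by linarith) (hx n) (hy n)
      h1 h2
  rcases frequently_or_distrib.1 hor.frequently with h | h
  · exact not_frequently_rays_meet hd hi hM hΓb hΓr hosc hc hκ0 (by linarith) h
  · exact not_frequently_rays_meet hd hi hM hΓb hΓr hosc (by rwa [norm_neg]) hκ0 (by linarith) h

/-- Koebe's lemma: connected sets that tend to the boundary of the disc and on which a bounded
injective holomorphic function is asymptotically constant have at most one limit point. -/
theorem koebe_lemma (hd : DifferentiableOn ℂ F (ball 0 1))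
    (hi : InjOn F (ball 0 1)) (hM : ∀ z ∈ ball (0 : ℂ) 1, ‖F z‖ ≤ M)
    (hΓb : ∀ n, Γ n ⊆ ball 0 1) (hΓc : ∀ n, IsPreconnected (Γ n))
    (hΓr : ∀ r < 1, ∀ᶠ n in atTop, ∀ z ∈ Γ n, r < ‖z‖)
    (hosc : ∀ ε > 0, ∀ᶠ n in atTop, ∀ z ∈ Γ n, ∀ w ∈ Γ n, ‖F z - F w‖ < ε) {x y : ℕ → ℂ}
    (hx : ∀ n, x n ∈ Γ n) (hy : ∀ n, y n ∈ Γ n) {σ σ' : ℂ} (hσ : ‖σ‖ = 1) (hσ' : ‖σ'‖ = 1)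
    (hxl : Tendsto x atTop (𝓝 σ)) (hyl : Tendsto y atTop (𝓝 σ')) : σ = σ' := by
  by_contra hne
  have hσ0 : σ ≠ 0 := norm_ne_zero_iff.1 (by rw [hσ]; exact one_ne_zero)
  have hσ0' : σ' ≠ 0 := norm_ne_zero_iff.1 (by rw [hσ']; exact one_ne_zero)
  -- Half the angle from `σ'` to `σ`; below, `c` is the midpoint of the arc, so the two points are
  -- `c e^{iτ}` and `c e^{-iτ}`. A negative `τ` is handled by swapping them.
  set τ : ℝ := (σ / σ').arg / 2 with hτ
  have hq : σ / σ' = Complex.exp ((2 * τ : ℝ) * Complex.I) := by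
    have := Complex.norm_mul_exp_arg_mul_I (σ / σ')
    rw [norm_div, hσ, hσ', div_one, Complex.ofReal_one, one_mul] at this
    rw [hτ, mul_div_cancel₀ _ two_ne_zero, this]
  set c := σ * Complex.exp ((-τ : ℝ) * Complex.I) with hc
  have hcn : ‖c‖ = 1 := by rw [hc, norm_mul, hσ, Complex.norm_exp_ofReal_mul_I, one_mul]
  have e1 : c * Complex.exp (τ * Complex.I) = σ := by
    rw [hc, mul_assoc, ← Complex.exp_add]
    simp
  have e2 : c * Complex.exp ((-τ : ℝ) * Complex.I) = σ' := by
    rw [div_eq_iff hσ0'] at hq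
    rw [hc, hq, mul_assoc, mul_right_comm, ← Complex.exp_add, ← Complex.exp_add]
    rw [show ((2 * τ : ℝ) : ℂ) * Complex.I + ((-τ : ℝ) * Complex.I + (-τ : ℝ) * Complex.I) = 0 by
      push_cast; ring]
    simp
  have hτne : τ ≠ 0 := fun h => hne (by rw [← e1, ← e2, h]; simp)
  have h1 := Complex.neg_pi_lt_arg (σ / σ')
  have h2 := Complex.arg_le_pi (σ / σ')
  rcases lt_or_gt_of_ne hτne with h | h
  · refine koebe_aux hd hi hM hΓb hΓc hΓr hosc hy hx hcn (neg_pos.2 h) (by linarith) ?_ ?_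
    · rwa [e2]
    · rwa [neg_neg, e1]
  · refine koebe_aux hd hi hM hΓb hΓc hΓr hosc hx hy hcn h (by linarith) ?_ ?_
    · rwa [e1]
    · rwa [e2]

end Koebe

end HypGeom

namespace HypGeom

/-! ### The chordal distance -/

theorem sphericalDist_le_diam {S : Set (OnePoint ℂ)} {p q : OnePoint ℂ} (hp : p ∈ S) (hq : q ∈ S) :
    sphericalDist p q ≤ sphericalDiam S := by
  refine le_csSup ⟨Real.pi, ?_⟩ ⟨p, hp, q, hq, rfl⟩
  rintro _ ⟨p, -, q, -, rfl⟩
  have := Real.arcsin_le_pi_div_two (halfChord p q)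
  rw [sphericalDist]
  linarith

theorem halfChord_lt_of_diam_lt {S : Set (OnePoint ℂ)} {ε : ℝ} (h0 : 0 < ε) (h1 : ε ≤ 1)
    (h : sphericalDiam S < 2 * ε) {p q : OnePoint ℂ} (hp : p ∈ S) (hq : q ∈ S) :
    halfChord p q < ε := by
  by_contra hcon
  have h2 : ε ≤ Real.arcsin ε := by
    have h3 := Real.sin_le (Real.arcsin_nonneg.2 h0.le)
    rwa [Real.sin_arcsin (by linarith) h1] at h3
  have h3 := Real.monotone_arcsin (not_lt.1 hcon)
  have h4 := sphericalDist_le_diam hp hq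
  rw [sphericalDist] at h4
  linarith

theorem halfChord_coe (z w : ℂ) : halfChord (z : OnePoint ℂ) (w : OnePoint ℂ) =
    ‖z - w‖ / (Real.sqrt (1 + ‖z‖ ^ 2) * Real.sqrt (1 + ‖w‖ ^ 2)) := rfl

theorem halfChord_coe_infty (z : ℂ) : halfChord (z : OnePoint ℂ) OnePoint.infty =
    1 / Real.sqrt (1 + ‖z‖ ^ 2) := rfl

theorem sqrt_one_add_sq_pos (x : ℝ) : 0 < Real.sqrt (1 + x ^ 2) := Real.sqrt_pos.2 (by positivity)

theorem sqrt_one_add_sq_le {x y : ℝ} (h0 : 0 ≤ x) (h : x ≤ y) : Real.sqrt (1 + x ^ 2) ≤ 1 + y :=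
  Real.sqrt_le_iff.2 ⟨by linarith, by nlinarith⟩

theorem div_le_halfChord {z w : ℂ} {A B : ℝ} (hA : ‖z‖ ≤ A) (hB : ‖w‖ ≤ B) :
    ‖z - w‖ / ((1 + A) * (1 + B)) ≤ halfChord (z : OnePoint ℂ) (w : OnePoint ℂ) := by
  have h1 := sqrt_one_add_sq_le (norm_nonneg z) hA
  have h2 := sqrt_one_add_sq_le (norm_nonneg w) hB
  have h3 := sqrt_one_add_sq_pos ‖z‖
  have h4 := sqrt_one_add_sq_pos ‖w‖
  have h5 : 0 ≤ 1 + A := by linarith [norm_nonneg z]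
  rw [halfChord_coe]
  gcongr

/-- A compact subset of an open set is at positive chordal distance from its complement. -/
theorem exists_le_halfChord {D K : Set ℂ} (hD : IsOpen D) (hK : IsCompact K) (hKD : K ⊆ D) :
    ∃ ε > 0, ∀ w ∈ K, ∀ p : OnePoint ℂ, p ∉ ((↑) : ℂ → OnePoint ℂ) '' D →
      ε ≤ halfChord (w : OnePoint ℂ) p := by
  obtain ⟨δ, hδ, hth⟩ := hK.exists_thickening_subset_open hD hKD
  obtain ⟨M, hM0, hM⟩ := hK.isBounded.exists_pos_norm_le
  -- For finite points at distance `t` the chordal bound `t / ((1 + M) * (1 + M + t))` increases in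
  -- `t`, so `t = δ` is the worst case; this value is also below the bound `1 / (1 + M)` for the
  -- point at infinity.
  refine ⟨δ / ((1 + M) * (1 + M + δ)), by positivity, fun w hw p hp => ?_⟩
  have hwM := hM w hw
  induction p using OnePoint.rec with
  | infty =>
    have h1 := sqrt_one_add_sq_le (norm_nonneg w) hwM
    have h2 := sqrt_one_add_sq_pos ‖w‖
    rw [halfChord_coe_infty]
    calc δ / ((1 + M) * (1 + M + δ)) ≤ 1 / (1 + M) := by
          rw [div_le_div_iff₀ (by positivity) (by positivity)]
          nlinarith [mul_pos hM0 hδ]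
      _ ≤ _ := by gcongr
  | coe z =>
    have hz : z ∉ D := fun h => hp ⟨z, h, rfl⟩
    have ht : δ ≤ ‖w - z‖ := by
      by_contra hcon
      refine hz (hth (mem_thickening_iff.2 ⟨w, hw, ?_⟩))
      rw [dist_comm, dist_eq_norm]
      exact not_le.1 hcon
    have hzM : ‖z‖ ≤ M + ‖w - z‖ := by
      have := norm_sub_norm_le z w
      rw [norm_sub_rev] at this
      linarith
    refine le_trans ?_ (div_le_halfChord hwM hzM)
    generalize ‖w - z‖ = t at *
    have ht0 : 0 < t := hδ.trans_le ht
    rw [div_le_div_iff₀ (by positivity) (by positivity)]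
    nlinarith [mul_pos hM0 hδ, mul_nonneg (sub_nonneg.2 ht) (sq_nonneg (1 + M))]

/-! ### A bounded injective function adapted to the chordal distance -/

/-- Closeness of squares leaves the sign undetermined; connectedness excludes a jump between the
signs. If `u` were far from `v`, some `w` in `S` would be at distance exactly `δ` from `v`, forcing
`‖w + v‖ ≤ δ`. Then `v`, and with it `u`, is so small that `u` and `v` are close. -/
theorem norm_sub_le_of_sq_close {S : Set ℂ} (hS : IsPreconnected S) {δ : ℝ} (hδ : 0 < δ)
    (h : ∀ u ∈ S, ∀ v ∈ S, ‖u ^ 2 - v ^ 2‖ ≤ δ ^ 2) {u v : ℂ} (hu : u ∈ S) (hv : v ∈ S) :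
    ‖u - v‖ ≤ 3 * δ := by
  by_contra hcon
  push Not at hcon
  obtain ⟨w, hw, hwv⟩ := hS.intermediate_value (f := fun w => ‖w - v‖) hv hu
    (by fun_prop) (show δ ∈ Icc _ _ from ⟨by simp [hδ.le], by linarith⟩)
  have h1 := h w hw v hv
  have e : w ^ 2 - v ^ 2 = (w - v) * (w + v) := by ring
  simp only at hwv
  rw [e, norm_mul, hwv, sq] at h1
  have h2 : ‖w + v‖ ≤ δ := le_of_mul_le_mul_left h1 hδ
  have h3 : ‖(2 : ℂ) * v‖ ≤ 2 * δ := by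
    have e2 : (2 : ℂ) * v = (w + v) - (w - v) := by ring
    rw [e2]
    exact (norm_sub_le _ _).trans (by linarith)
  rw [norm_mul, Complex.norm_ofNat] at h3
  have h4 := h u hu v hv
  have h5 := norm_sub_norm_le (u ^ 2) (v ^ 2)
  rw [norm_pow, norm_pow] at h5
  have h6 := norm_sub_le u v
  have hv0 := norm_nonneg v
  have h7 : ‖u‖ ≤ 2 * δ := by nlinarith [norm_nonneg u]
  linarith

/-- A branch `s` of the square root of `z - a` omits a disc about `-s d`, so `1 / (s + s d)` is
bounded and injective. It is small near `∞`; on bounded parts of `D` chordal closeness is Euclidean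
closeness, which passes to `s` on connected sets. -/
theorem exists_bounded_injOn {D : Set ℂ} (hD : IsOpen D) (hDc : IsSimplyConnected D)
    (hDu : D ≠ univ) : ∃ (B : ℂ → ℂ) (M : ℝ), DifferentiableOn ℂ B D ∧ InjOn B D ∧
      (∀ z ∈ D, ‖B z‖ ≤ M) ∧ ∀ ε > 0, ∃ δ > 0, ∀ A ⊆ D, IsPreconnected A →
        (∀ z ∈ A, ∀ w ∈ A, halfChord (z : OnePoint ℂ) (w : OnePoint ℂ) < δ) →
        ∀ z ∈ A, ∀ w ∈ A, ‖B z - B w‖ < ε := by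
  obtain ⟨a, ha⟩ := (ne_univ_iff_exists_notMem D).1 hDu
  obtain ⟨d, hd⟩ := hDc.nonempty
  have hne : ∀ z ∈ D, z - a ≠ 0 := fun z hz h => ha (sub_eq_zero.1 h ▸ hz)
  obtain ⟨s, hsc, hsq⟩ := Complex.exists_continuousOn_pow_eq hDc hD (g := fun z => z - a)
    (by fun_prop) (by rintro ⟨z, hz, h⟩; exact hne z hz h) two_ne_zero
  have hs0 : ∀ z ∈ D, s z ≠ 0 := fun z hz h => hne z hz (by rw [← hsq z, h]; simp)
  have hsd : DifferentiableOn ℂ s D := fun z hz =>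
    (hasDerivAt_of_sq_eq (hsc.continuousAt (hD.mem_nhds hz)) hsq (hs0 z hz)
      ((hasDerivAt_id z).sub_const a)).differentiableAt.differentiableWithinAt
  have hsi : InjOn s D := fun z _ w _ h => by
    have h1 := hsq z
    rw [h, hsq w] at h1
    exact (sub_left_injective h1).symm
  obtain ⟨r, hr, hb⟩ := Metric.isOpen_iff.1 (isOpen_image_of_injOn hD hsd hsi) (s d) ⟨d, hd, rfl⟩
  have hfar : ∀ z ∈ D, r ≤ ‖s z + s d‖ := by
    intro z hz
    by_contra hcon
    obtain ⟨w, hw, hwz⟩ := hb (show -s z ∈ ball (s d) r by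
      rw [mem_ball, dist_eq_norm, ← norm_neg]
      simpa [add_comm] using hcon)
    have h1 : w = z := by
      have h2 := hsq w
      rw [hwz, neg_sq, hsq z] at h2
      exact (sub_left_injective h2).symm
    rw [h1] at hwz
    exact hs0 z hz (CharZero.eq_neg_self_iff.1 hwz)
  have hfar0 : ∀ z ∈ D, s z + s d ≠ 0 := fun z hz => norm_pos_iff.1 (hr.trans_le (hfar z hz))
  refine ⟨fun z => (s z + s d)⁻¹, r⁻¹, (hsd.add_const _).inv hfar0, fun z hz w hw h => ?_,
    fun z hz => ?_, fun ε hε => ?_⟩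
  · exact hsi hz hw (add_right_cancel (inv_injective h))
  · rw [norm_inv]
    exact inv_anti₀ hr (hfar z hz)
  obtain ⟨N, hN⟩ : ∃ N, N = ‖s d‖ + 3 / ε := ⟨_, rfl⟩
  have hN0 : 0 ≤ N := by rw [hN]; positivity
  set L : ℝ := N ^ 2 + ‖a‖ with hL
  have hL0 : 0 ≤ L := by positivity
  have hlarge : ∀ z ∈ D, L ≤ ‖z‖ → ‖(s z + s d)⁻¹‖ ≤ ε / 3 := by
    intro z hz hzL
    have h1 : N ^ 2 ≤ ‖s z‖ ^ 2 := by
      rw [← norm_pow, hsq]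
      have := norm_sub_norm_le z a
      linarith
    have h2 : N ≤ ‖s z‖ := le_of_sq_le_sq h1 (norm_nonneg _)
    have h3 : 3 / ε ≤ ‖s z + s d‖ := by
      have := norm_sub_norm_le (s z) (-s d)
      rw [norm_neg, sub_neg_eq_add] at this
      linarith
    rw [norm_inv, ← inv_div]
    exact inv_anti₀ (by positivity) h3
  obtain ⟨η, hη⟩ : ∃ η, η = ε * r ^ 2 / 4 := ⟨_, rfl⟩
  have hη0 : 0 < η := by rw [hη]; positivity
  set P : ℝ := 1 + (2 * L + 1) with hP
  have hP0 : 0 < P := by positivity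
  -- The first bound keeps a set with a point of modulus at least `2 * L + 1` outside the disc of
  -- radius `L`, where the function is below `ε / 3`. The second makes points of modulus below `2 *
  -- L + 1` Euclidean close.
  refine ⟨min (1 / (2 * (1 + L))) (η ^ 2 / (36 * P ^ 2)), by positivity, fun A hAD hA hch z hz w hw => ?_⟩
  by_cases hcase : ∃ u ∈ A, 2 * L + 1 ≤ ‖u‖
  · obtain ⟨u, hu, huL⟩ := hcase
    have hall : ∀ v ∈ A, L ≤ ‖v‖ := by
      intro v hv
      by_contra hcon
      push Not at hcon
      have h1 := (div_le_halfChord hcon.le le_rfl).trans_lt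
        ((hch v hv u hu).trans_le (min_le_left _ _))
      have h2 : ‖u‖ - L ≤ ‖v - u‖ := by
        have := norm_sub_norm_le u v
        rw [norm_sub_rev] at this
        linarith
      rw [div_lt_div_iff₀ (by positivity) (by positivity)] at h1
      nlinarith [norm_nonneg u]
    have h1 := hlarge z (hAD hz) (hall z hz)
    have h2 := hlarge w (hAD hw) (hall w hw)
    exact (norm_sub_le _ _).trans_lt (by linarith)
  · push Not at hcase
    have hclose : ∀ u ∈ A, ∀ v ∈ A, ‖u - v‖ ≤ (η / 6) ^ 2 := by
      intro u hu v hv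
      have h1 := (div_le_halfChord (hcase u hu).le (hcase v hv).le).trans_lt
        ((hch u hu v hv).trans_le (min_le_right _ _))
      rw [div_lt_div_iff₀ (by positivity) (by positivity)] at h1
      have h2 : 0 < P ^ 2 := by positivity
      have h3 : ‖u - v‖ * 36 < η ^ 2 := by
        by_contra hcon
        push Not at hcon
        nlinarith [mul_le_mul_of_nonneg_right hcon h2.le]
      nlinarith
    have hS : IsPreconnected (s '' A) := hA.image s (hsc.mono hAD)
    have h1 : ‖s z - s w‖ ≤ 3 * (η / 6) := by
      refine norm_sub_le_of_sq_close hS (by positivity) ?_ ⟨z, hz, rfl⟩ ⟨w, hw, rfl⟩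
      rintro _ ⟨u, hu, rfl⟩ _ ⟨v, hv, rfl⟩
      rw [hsq, hsq, sub_sub_sub_cancel_right]
      exact hclose u hu v hv
    have hz' := hfar z (hAD hz)
    have hw' := hfar w (hAD hw)
    have e : (s z + s d)⁻¹ - (s w + s d)⁻¹ = (s w - s z) / ((s z + s d) * (s w + s d)) := by
      have h2 := hfar0 z (hAD hz)
      have h3 := hfar0 w (hAD hw)
      field_simp
      ring
    simp only
    rw [e, norm_div, norm_mul, norm_sub_rev]
    calc ‖s z - s w‖ / (‖s z + s d‖ * ‖s w + s d‖) ≤ 3 * (η / 6) / (r * r) := by gcongr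
      _ < ε := by
        rw [div_lt_iff₀ (by positivity), hη]
        nlinarith [mul_pos hε (mul_pos hr hr)]

end HypGeom

namespace HypGeom

/-! ### Prime ends and boundary points -/

theorem isOpen_coe_image {D : Set ℂ} (hD : IsOpen D) : IsOpen (((↑) : ℂ → OnePoint ℂ) '' D) :=
  OnePoint.isOpenEmbedding_coe.isOpenMap D hD

theorem IsCrossCut.exists_mem {D : Set ℂ} {C : Set (OnePoint ℂ)} (hC : IsCrossCut D C) :
    ∃ z ∈ D, (z : OnePoint ℂ) ∈ C := by
  obtain ⟨γ, -, -, rfl, hγ, -, -⟩ := hC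
  obtain ⟨z, hz, hze⟩ := hγ (1 / 2) (by norm_num)
  exact ⟨z, hz, by rw [hze]; exact ⟨1 / 2, by norm_num, rfl⟩⟩

theorem IsCrossCut.exists_notMem {D : Set ℂ} (hD : IsOpen D) {C : Set (OnePoint ℂ)}
    (hC : IsCrossCut D C) : ∃ p ∈ C, p ∉ ((↑) : ℂ → OnePoint ℂ) '' D := by
  obtain ⟨γ, -, -, rfl, -, h0, -⟩ := hC
  refine ⟨γ 0, ⟨0, by simp, rfl⟩, ?_⟩
  rw [(isOpen_coe_image hD).frontier_eq] at h0
  exact h0.2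

/-- The end points lie off the open set `D`, so the trace on `D` is the image of the open parameter
interval. -/
theorem IsCrossCut.isPreconnected {D : Set ℂ} (hD : IsOpen D) {C : Set (OnePoint ℂ)}
    (hC : IsCrossCut D C) : IsPreconnected {z ∈ D | (z : OnePoint ℂ) ∈ C} := by
  obtain ⟨γ, hc, -, rfl, hγ, h0, h1⟩ := hC
  rw [(isOpen_coe_image hD).frontier_eq] at h0 h1
  have e : {z ∈ D | (z : OnePoint ℂ) ∈ γ '' Icc 0 1} =
      ((↑) : ℂ → OnePoint ℂ) ⁻¹' (γ '' Ioo 0 1) := by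
    ext z
    constructor
    · rintro ⟨hz, t, ht, hte⟩
      have ht0 : t ≠ 0 := fun e => h0.2 ⟨z, hz, by rw [← hte, e]⟩
      have ht1 : t ≠ 1 := fun e => h1.2 ⟨z, hz, by rw [← hte, e]⟩
      exact ⟨t, ⟨lt_of_le_of_ne ht.1 ht0.symm, lt_of_le_of_ne ht.2 ht1⟩, hte⟩
    · rintro ⟨t, ht, hte⟩
      obtain ⟨w, hw, hwe⟩ := hγ t ht
      rw [hte] at hwe
      exact ⟨OnePoint.coe_injective hwe ▸ hw, t, Ioo_subset_Icc_self ht, hte⟩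
  rw [e]
  refine (isPreconnected_Ioo.image γ (hc.mono Ioo_subset_Icc_self)).preimage_of_isOpenMap
    OnePoint.coe_injective OnePoint.isOpenEmbedding_coe.isOpenMap ?_
  rintro _ ⟨t, ht, rfl⟩
  obtain ⟨w, -, hwe⟩ := hγ t ht
  exact ⟨w, hwe⟩

theorem NullChain.eventually_halfChord_lt {D : Set ℂ} (C : NullChain D) {ε : ℝ} (hε : 0 < ε) :
    ∀ᶠ n in atTop, ∀ p ∈ C.cut n, ∀ q ∈ C.cut n, halfChord p q < ε := by
  have h0 : 0 < min ε 1 := lt_min hε one_pos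
  filter_upwards [C.tendsto_diam.eventually (gt_mem_nhds (show (0 : ℝ) < 2 * min ε 1 by positivity))]
    with n hn p hp q hq
  exact (halfChord_lt_of_diam_lt h0 (min_le_right _ _) hn hp hq).trans_le (min_le_left _ _)

/-- Each cross cut has a point off `D`, at a fixed positive chordal distance from `K`, while the
diameters tend to zero. -/
theorem NullChain.eventually_notMem {D : Set ℂ} (hD : IsOpen D) (C : NullChain D) {K : Set ℂ}
    (hK : IsCompact K) (hKD : K ⊆ D) : ∀ᶠ n in atTop, ∀ z ∈ K, (z : OnePoint ℂ) ∉ C.cut n := by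
  obtain ⟨ε, hε, h⟩ := exists_le_halfChord hD hK hKD
  filter_upwards [C.eventually_halfChord_lt hε] with n hn z hz hzn
  obtain ⟨p, hp, hpD⟩ := (C.isCrossCut n).exists_notMem hD
  exact absurd (h z hz p hpD) (not_le.2 (hn z hzn p hp))

theorem NullChain.exists_mem_cut {D : Set ℂ} (C : NullChain D) {n : ℕ} {S : Set ℂ} (hS : S ⊆ D)
    (hSc : IsPreconnected S) {z w : ℂ} (hz : z ∈ S) (hw : w ∈ S) (hzC : (z : OnePoint ℂ) ∈ C.cut 0)
    (hwV : w ∈ C.interiorPart n) : ∃ u ∈ S, (u : OnePoint ℂ) ∈ C.cut n := by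
  by_contra hcon
  push Not at hcon
  have hsub : S ⊆ cutOff D (C.cut n) := fun u hu => ⟨hS hu, hcon u hu⟩
  exact hwV.2 z (hSc.subset_connectedComponentIn hw hsub hz) hzC

/-- Where a segment from a fixed interior point gets close to the unit circle, it is already close
to its far end `q`. Thus crossing points near the circle share the limits of the end points. -/
theorem norm_sub_le_of_mem_segment {z q x : ℂ} (hz : ‖z‖ < 1) (hq : ‖q‖ ≤ 1)
    (hx : x ∈ segment ℝ z q) : ‖x - q‖ ≤ 2 / (1 - ‖z‖) * (1 - ‖x‖) := by
  obtain ⟨a, b, ha, hb, hab, rfl⟩ := hx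
  have h1 : ‖a • z + b • q‖ ≤ a * ‖z‖ + b * ‖q‖ := by
    refine (norm_add_le _ _).trans ?_
    rw [norm_smul, norm_smul, Real.norm_of_nonneg ha, Real.norm_of_nonneg hb]
  have e : a • z + b • q - q = a • (z - q) := by
    obtain rfl : b = 1 - a := by linarith
    module
  rw [e, norm_smul, Real.norm_of_nonneg ha, div_mul_eq_mul_div, le_div_iff₀ (by linarith)]
  have h2 : ‖z - q‖ ≤ 2 := (norm_sub_le _ _).trans (by linarith)
  have h3 : a * (1 - ‖z‖) ≤ 1 - ‖a • z + b • q‖ := by nlinarith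
  calc a * ‖z - q‖ * (1 - ‖z‖) = (a * (1 - ‖z‖)) * ‖z - q‖ := by ring
    _ ≤ (a * (1 - ‖z‖)) * 2 := by
      refine mul_le_mul_of_nonneg_left h2 (mul_nonneg ha (by linarith))
    _ ≤ _ := by linarith

theorem PrimeEnd.nhdsTrace_le {D : Set ℂ} (C : NullChain D) {n : ℕ} (hn : 1 ≤ n) :
    PrimeEnd.nhdsTrace (Quotient.mk (NullChain.setoid D) C : PrimeEnd D) ≤ 𝓟 (C.interiorPart n) :=
  iInf₂_le_of_le C rfl (iInf₂_le_of_le n hn le_rfl)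

/-- If the Carathéodory extension of a Riemann map takes `σ` to `ζ`, then preimages of points that
tend to `ζ` tend to `σ`. -/
theorem tendsto_of_tendsto_nhdsTrace {D : Set ℂ} (hDc : IsSimplyConnected D) (hDu : D ≠ univ)
    {f : ℂ → ℂ} (hf : IsRiemannMap f D) {σ : ℂ} (hσ : ‖σ‖ = 1) {ζ : PrimeEnd D}
    (hζ : CaratheodoryMapsTo f σ ζ) {p : ℝ → ℂ} (hp : ∀ᶠ t in atTop, p t ∈ ball (0 : ℂ) 1)
    (hpζ : Tendsto (fun t => f (p t)) atTop ζ.nhdsTrace) : Tendsto p atTop (𝓝 σ) := by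
  have hD := hf.isOpen
  obtain ⟨C, rfl⟩ := Quotient.exists_rep ζ
  by_contra hcon
  obtain ⟨ε, hε, hfr⟩ : ∃ ε > 0, ∃ᶠ t in atTop, ε ≤ dist (p t) σ := by
    rw [Metric.tendsto_nhds] at hcon
    push Not at hcon
    obtain ⟨ε, hε, h⟩ := hcon
    exact ⟨ε, hε, h⟩
  -- Two sequences enter the interior parts: `P` stays away from `σ`, while `Q` below tends to `σ`.
  -- The index is `n + 1` because interior parts are used only from `1` on.
  have hP : ∀ n : ℕ, ∃ w, w ∈ ball (0 : ℂ) 1 ∧ ε ≤ dist w σ ∧ f w ∈ C.interiorPart (n + 1) := by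
    intro n
    obtain ⟨t, h1, h2, h3⟩ := (hfr.and_eventually (hp.and
      (tendsto_principal.1 (hpζ.mono_right (PrimeEnd.nhdsTrace_le C (n := n + 1) (by omega)))))).exists
    exact ⟨p t, h2, h1, h3⟩
  have hσcl : (𝓝[ball (0 : ℂ) 1] σ).NeBot := by
    rw [← mem_closure_iff_nhdsWithin_neBot, closure_ball _ one_ne_zero]
    simp [hσ]
  have hQ : ∀ n : ℕ, ∃ w, w ∈ ball (0 : ℂ) 1 ∧ dist w σ < 1 / ((n : ℝ) + 1) ∧
      f w ∈ C.interiorPart (n + 1) := by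
    intro n
    have h1 : ∀ᶠ w in 𝓝[ball (0 : ℂ) 1] σ, dist w σ < 1 / ((n : ℝ) + 1) :=
      nhdsWithin_le_nhds (ball_mem_nhds σ (by positivity))
    have h2 : ∀ᶠ w in 𝓝[ball (0 : ℂ) 1] σ, w ∈ ball (0 : ℂ) 1 := self_mem_nhdsWithin
    obtain ⟨w, hw1, hw2, hw3⟩ := (h1.and (h2.and
      (tendsto_principal.1 (hζ.mono_right (PrimeEnd.nhdsTrace_le C (n := n + 1) (by omega)))))).exists
    exact ⟨w, hw2, hw1, hw3⟩
  choose P hPb hPd hPV using hP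
  choose Q hQb hQd hQV using hQ
  have hQl : Tendsto Q atTop (𝓝 σ) := by
    rw [tendsto_iff_dist_tendsto_zero]
    exact squeeze_zero (fun _ => dist_nonneg) (fun n => (hQd n).le)
      tendsto_one_div_add_atTop_nhds_zero_nat
  obtain ⟨d, hd, hdC⟩ := (C.isCrossCut 0).exists_mem
  set z₀ := Function.invFunOn f (ball 0 1) d with hz₀
  have hz₀b : z₀ ∈ ball (0 : ℂ) 1 := hf.inv_mem hd
  have hz₀e : f z₀ = d := hf.apply_inv hd
  have hz₀1 : ‖z₀‖ < 1 := by simpa using hz₀b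
  set Γ : ℕ → Set ℂ := fun n => {z ∈ ball (0 : ℂ) 1 | (f z : OnePoint ℂ) ∈ C.cut (n + 1)} with hΓ
  -- The image of the segment joins the first cross cut to an interior part, so it crosses the cut
  -- in between.
  have hmeet : ∀ n, ∀ w ∈ ball (0 : ℂ) 1, f w ∈ C.interiorPart (n + 1) →
      ∃ x ∈ Γ n, x ∈ segment ℝ z₀ w := by
    intro n w hw hwV
    have hseg : segment ℝ z₀ w ⊆ ball 0 1 := (convex_ball 0 1).segment_subset hz₀b hw
    obtain ⟨_, ⟨x, hx, rfl⟩, hxC⟩ := C.exists_mem_cut (S := f '' segment ℝ z₀ w)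
      ((image_mono hseg).trans hf.mapsTo.image_subset)
      ((convex_segment z₀ w).isPreconnected.image f (hf.1.continuousOn.mono hseg))
      ⟨z₀, left_mem_segment ℝ z₀ w, rfl⟩ ⟨w, right_mem_segment ℝ z₀ w, rfl⟩
      (by rw [hz₀e]; exact hdC) hwV
    exact ⟨x, ⟨hseg hx, hxC⟩, hx⟩
  choose X hXΓ hXs using fun n => hmeet n (Q n) (hQb n) (hQV n)
  choose Y hYΓ hYs using fun n => hmeet n (P n) (hPb n) (hPV n)
  have hΓr : ∀ r < 1, ∀ᶠ n in atTop, ∀ z ∈ Γ n, r < ‖z‖ := by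
    intro r hr
    have hsub : closedBall (0 : ℂ) r ⊆ ball 0 1 := closedBall_subset_ball hr
    have h1 := C.eventually_notMem hD ((isCompact_closedBall (0 : ℂ) r).image_of_continuousOn
      (hf.1.continuousOn.mono hsub)) ((image_mono hsub).trans hf.mapsTo.image_subset)
    filter_upwards [(tendsto_add_atTop_nat 1).eventually h1] with n hn z hz
    by_contra hcon
    exact hn (f z) ⟨z, by simpa using hcon, rfl⟩ hz.2
  have hnorm : ∀ {W : ℕ → ℂ}, (∀ n, W n ∈ Γ n) → Tendsto (fun n => ‖W n‖) atTop (𝓝 1) := by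
    intro W hW
    rw [Metric.tendsto_nhds]
    intro η hη
    filter_upwards [hΓr (1 - η) (by linarith)] with n hn
    have h1 := hn _ (hW n)
    have h2 : ‖W n‖ < 1 := by simpa using (hW n).1
    rw [Real.dist_eq, abs_lt]
    exact ⟨by linarith, by linarith⟩
  have hclose : ∀ {W V : ℕ → ℂ}, (∀ n, W n ∈ Γ n) → (∀ n, V n ∈ ball (0 : ℂ) 1) →
      (∀ n, W n ∈ segment ℝ z₀ (V n)) → Tendsto (fun n => W n - V n) atTop (𝓝 0) := by
    intro W V hW hV hs
    have h1 : Tendsto (fun n => 2 / (1 - ‖z₀‖) * (1 - ‖W n‖)) atTop (𝓝 0) := by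
      have := ((hnorm hW).const_sub 1).const_mul (2 / (1 - ‖z₀‖))
      simpa using this
    refine squeeze_zero_norm (fun n => ?_) h1
    exact norm_sub_le_of_mem_segment hz₀1 (by simpa using (mem_ball.1 (hV n)).le) (hs n)
  have hXl : Tendsto X atTop (𝓝 σ) := by
    have := (hclose hXΓ hQb hXs).add hQl
    simpa using this
  obtain ⟨σ', -, φ, hφ, hφl⟩ := tendsto_subseq_of_bounded (x := P)
    (isBounded_ball (x := (0 : ℂ)) (r := 1)) hPb
  have hYl : Tendsto (Y ∘ φ) atTop (𝓝 σ') := by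
    have := ((hclose hYΓ hPb hYs).comp hφ.tendsto_atTop).add hφl
    simpa [Function.comp_def] using this
  have hσ' : ‖σ'‖ = 1 :=
    tendsto_nhds_unique hYl.norm ((hnorm hYΓ).comp hφ.tendsto_atTop)
  obtain ⟨B, M, hBd, hBi, hBM, hB⟩ := exists_bounded_injOn hD hDc hDu
  have hΓe : ∀ n, Γ n = Function.invFunOn f (ball 0 1) ''
      {z ∈ D | (z : OnePoint ℂ) ∈ C.cut (n + 1)} := by
    intro n
    ext z
    constructor
    · rintro ⟨hz, hzC⟩
      exact ⟨f z, ⟨hf.mapsTo hz, hzC⟩, invFunOn_image hf.2.1 hz⟩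
    · rintro ⟨w, ⟨hw, hwC⟩, rfl⟩
      exact ⟨hf.inv_mem hw, by rwa [hf.apply_inv hw]⟩
  -- Crossing points near `Q` and near `P` lie on the same connected preimages of cross cuts, so
  -- their limits `σ` and `σ'` agree, although `P` stays at distance `ε` from `σ`.
  have key := koebe_lemma (F := B ∘ f) (M := M) (Γ := fun n => Γ (φ n)) (x := X ∘ φ) (y := Y ∘ φ)
    (hBd.comp hf.1 hf.mapsTo) (hBi.comp hf.2.1 hf.mapsTo) (fun z hz => hBM _ (hf.mapsTo hz))
    (fun n z hz => hz.1)
    (fun n => by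
      rw [hΓe]
      exact ((C.isCrossCut _).isPreconnected hD).image _
        (hf.differentiableOn_inv.continuousOn.mono fun z hz => hz.1))
    (fun r hr => hφ.tendsto_atTop.eventually (hΓr r hr))
    (fun η hη => by
      obtain ⟨δ, hδ, h⟩ := hB η hη
      have h1 := C.eventually_halfChord_lt hδ
      filter_upwards [((tendsto_add_atTop_nat 1).comp hφ.tendsto_atTop).eventually h1]
        with n hn z hz w hw
      exact h {z ∈ D | (z : OnePoint ℂ) ∈ C.cut (φ n + 1)} (fun u hu => hu.1)
        ((C.isCrossCut _).isPreconnected hD) (fun u hu v hv => hn _ hu.2 _ hv.2)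
        (f z) ⟨hf.mapsTo hz.1, hz.2⟩ (f w) ⟨hf.mapsTo hw.1, hw.2⟩)
    (fun n => hXΓ _) (fun n => hYΓ _) hσ hσ' (hXl.comp hφ.tendsto_atTop) hYl
  have h1 : ε ≤ dist σ' σ :=
    ge_of_tendsto (hφl.dist tendsto_const_nhds) (Eventually.of_forall fun n => hPd _)
  rw [← key, dist_self] at h1
  linarith

end HypGeom
namespace HypGeom

/-! ### The right half-plane and its discs -/

/-- The right half-plane. -/
def rightHalfPlane : Set ℂ := {z | 0 < z.re}

/-- The Möbius map of the unit disc onto the right half-plane that takes `0` to `a`. -/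
noncomputable def chart (a v : ℂ) : ℂ := a.re * ((1 + v) / (1 - v)) + a.im * Complex.I

/-- The inverse of `chart a`. -/
noncomputable def chartInv (a b : ℂ) : ℂ := (b - a) / (b + starRingEnd ℂ a)

theorem one_sub_ne_zero_of_mem_ball {v : ℂ} (hv : v ∈ ball (0 : ℂ) 1) : 1 - v ≠ 0 := by
  intro h
  rw [mem_ball_zero_iff, ← sub_eq_zero.1 h] at hv
  simp at hv

theorem add_conj_ne_zero {a b : ℂ} (ha : a ∈ rightHalfPlane) (hb : b ∈ rightHalfPlane) :
    b + starRingEnd ℂ a ≠ 0 := by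
  intro h
  have := congrArg Complex.re h
  simp only [Complex.add_re, Complex.conj_re, Complex.zero_re] at this
  simp only [rightHalfPlane, mem_ofPred_eq] at ha hb
  linarith

theorem sub_conj (a : ℂ) : a + starRingEnd ℂ a = 2 * (a.re : ℂ) := by
  rw [Complex.add_conj]; push_cast; ring

theorem chart_zero (a : ℂ) : chart a 0 = a := by simp [chart]

theorem chart_eq (a v : ℂ) (hv : v ∈ ball (0 : ℂ) 1) :
    chart a v = a + 2 * a.re * v / (1 - v) := by
  have := one_sub_ne_zero_of_mem_ball hv
  nth_rw 2 [← Complex.re_add_im a]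
  rw [chart]
  field_simp
  ring

theorem chart_re_mul (a : ℂ) {v : ℂ} (hv : v ∈ ball (0 : ℂ) 1) :
    (chart a v).re * Complex.normSq (1 - v) = a.re * (1 - Complex.normSq v) := by
  have h := one_sub_ne_zero_of_mem_ball hv
  have h' : Complex.normSq (1 - v) ≠ 0 := by simpa using h
  have e : (chart a v).re = a.re * ((1 + v) / (1 - v)).re := by
    simp [chart, Complex.mul_re]
  rw [e, Complex.div_re]
  field_simp
  simp only [Complex.normSq_apply, Complex.add_re, Complex.add_im, Complex.sub_re, Complex.sub_im,
    Complex.one_re, Complex.one_im]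
  ring

theorem chart_im_mul (a : ℂ) {v : ℂ} (hv : v ∈ ball (0 : ℂ) 1) :
    (chart a v).im * Complex.normSq (1 - v) =
      a.im * Complex.normSq (1 - v) + 2 * a.re * v.im := by
  have h := one_sub_ne_zero_of_mem_ball hv
  have h' : Complex.normSq (1 - v) ≠ 0 := by simpa using h
  have e : (chart a v).im = a.re * ((1 + v) / (1 - v)).im + a.im := by
    simp [chart, Complex.mul_im]
  rw [e, Complex.div_im]
  field_simp
  simp [Complex.normSq_apply]
  ring

theorem normSq_lt_one {v : ℂ} (hv : v ∈ ball (0 : ℂ) 1) : Complex.normSq v < 1 := by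
  rw [Complex.normSq_eq_norm_sq]
  have : ‖v‖ < 1 := by simpa using hv
  nlinarith [norm_nonneg v]

theorem normSq_one_sub_pos {v : ℂ} (hv : v ∈ ball (0 : ℂ) 1) : 0 < Complex.normSq (1 - v) :=
  Complex.normSq_pos.2 (one_sub_ne_zero_of_mem_ball hv)

theorem chart_mem {a v : ℂ} (ha : a ∈ rightHalfPlane) (hv : v ∈ ball (0 : ℂ) 1) :
    chart a v ∈ rightHalfPlane := by
  have h := chart_re_mul a hv
  have h1 := normSq_one_sub_pos hv
  have h2 : 0 < a.re * (1 - Complex.normSq v) := mul_pos ha (by linarith [normSq_lt_one hv])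
  rw [← h] at h2
  exact pos_of_mul_pos_left h2 h1.le

theorem chartInv_chart {a v : ℂ} (ha : a ∈ rightHalfPlane) (hv : v ∈ ball (0 : ℂ) 1) :
    chartInv a (chart a v) = v := by
  have h := one_sub_ne_zero_of_mem_ball hv
  have ha' : (a.re : ℂ) ≠ 0 := by exact_mod_cast (ne_of_gt ha)
  rw [chartInv, div_eq_iff (add_conj_ne_zero ha (chart_mem ha hv)), chart_eq a v hv,
    add_right_comm, sub_conj]
  field_simp
  ring

theorem norm_add_conj_sq_sub (a b : ℂ) :
    ‖b + starRingEnd ℂ a‖ ^ 2 - ‖b - a‖ ^ 2 = 4 * a.re * b.re := by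
  rw [← Complex.normSq_eq_norm_sq, ← Complex.normSq_eq_norm_sq, Complex.normSq_apply,
    Complex.normSq_apply]
  simp
  ring

theorem norm_sub_lt_norm_add_conj {a b : ℂ} (ha : a ∈ rightHalfPlane) (hb : b ∈ rightHalfPlane) :
    ‖b - a‖ < ‖b + starRingEnd ℂ a‖ := by
  have h := norm_add_conj_sq_sub a b
  have h1 : 0 < 4 * a.re * b.re := mul_pos (mul_pos four_pos ha) hb
  exact lt_of_pow_lt_pow_left₀ 2 (norm_nonneg _) (by linarith)

theorem chartInv_mem {a b : ℂ} (ha : a ∈ rightHalfPlane) (hb : b ∈ rightHalfPlane) :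
    chartInv a b ∈ ball (0 : ℂ) 1 := by
  rw [mem_ball_zero_iff, chartInv, norm_div,
    div_lt_one (norm_pos_iff.2 (add_conj_ne_zero ha hb))]
  exact norm_sub_lt_norm_add_conj ha hb

theorem chart_chartInv {a b : ℂ} (ha : a ∈ rightHalfPlane) (hb : b ∈ rightHalfPlane) :
    chart a (chartInv a b) = b := by
  have h := add_conj_ne_zero ha hb
  have ha' : (a.re : ℂ) ≠ 0 := by exact_mod_cast (ne_of_gt ha)
  have e : 1 - chartInv a b = 2 * (a.re : ℂ) / (b + starRingEnd ℂ a) := by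
    rw [chartInv, ← sub_conj]
    field_simp
    ring
  rw [chart_eq a _ (chartInv_mem ha hb), e, chartInv]
  field_simp
  ring

theorem differentiableOn_chart (a : ℂ) : DifferentiableOn ℂ (chart a) (ball 0 1) := by
  unfold chart
  refine DifferentiableOn.add_const _ (DifferentiableOn.const_mul (DifferentiableOn.div
    (by fun_prop) (by fun_prop) fun v hv => one_sub_ne_zero_of_mem_ball hv) _)

theorem differentiableOn_chartInv {a : ℂ} (ha : a ∈ rightHalfPlane) :
    DifferentiableOn ℂ (chartInv a) rightHalfPlane := by
  unfold chartInv
  exact DifferentiableOn.div (by fun_prop) (by fun_prop) fun b hb => add_conj_ne_zero ha hb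

theorem chart_image {a : ℂ} (ha : a ∈ rightHalfPlane) :
    chart a '' ball 0 1 = rightHalfPlane :=
  Subset.antisymm (image_subset_iff.2 fun _ hv => chart_mem ha hv) fun b hb =>
    ⟨chartInv a b, chartInv_mem ha hb, chart_chartInv ha hb⟩

theorem chart_injOn {a : ℂ} (ha : a ∈ rightHalfPlane) : InjOn (chart a) (ball 0 1) :=
  LeftInvOn.injOn (f₁' := chartInv a) fun _ hv => chartInv_chart ha hv

theorem norm_add_conj_comm (a b : ℂ) :
    ‖b + starRingEnd ℂ a‖ = ‖a + starRingEnd ℂ b‖ := by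
  rw [← Complex.norm_conj (a + starRingEnd ℂ b)]
  simp [add_comm]

theorem norm_chartInv_comm (a b : ℂ) : ‖chartInv a b‖ = ‖chartInv b a‖ := by
  rw [chartInv, chartInv, norm_div, norm_div, norm_sub_rev, norm_add_conj_comm]

/-- Points in a pseudohyperbolic disc of radius `r` are at distance comparable to their real
parts. -/
theorem norm_sub_le_of_norm_chartInv_le {a b : ℂ} (ha : a ∈ rightHalfPlane)
    (hb : b ∈ rightHalfPlane) {r : ℝ} (hr0 : 0 ≤ r) (hr : r < 1) (h : ‖chartInv a b‖ ≤ r) :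
    ‖b - a‖ ≤ 2 * r / (1 - r) * a.re := by
  rw [chartInv, norm_div, div_le_iff₀ (norm_pos_iff.2 (add_conj_ne_zero ha hb))] at h
  have h1 : ‖b + starRingEnd ℂ a‖ ≤ ‖b - a‖ + 2 * a.re := by
    have e : b + starRingEnd ℂ a = (b - a) + ((2 * a.re : ℝ) : ℂ) := by
      push_cast
      rw [← sub_conj]
      ring
    rw [e]
    refine (norm_add_le _ _).trans ?_
    rw [Complex.norm_real, Real.norm_of_nonneg (mul_pos two_pos ha).le]
  rw [div_mul_eq_mul_div, le_div_iff₀ (by linarith)]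
  nlinarith [mul_le_mul_of_nonneg_left h1 hr0]

theorem one_sub_norm_chartInv_sq {a b : ℂ} (ha : a ∈ rightHalfPlane) (hb : b ∈ rightHalfPlane) :
    1 - ‖chartInv a b‖ ^ 2 = 4 * a.re * b.re / ‖b + starRingEnd ℂ a‖ ^ 2 := by
  have h := norm_ne_zero_iff.2 (add_conj_ne_zero ha hb)
  rw [← norm_add_conj_sq_sub, chartInv, norm_div]
  field_simp

/-! ### Truncated sectors of the half-plane -/

/-- The part `x > X` of the angle `|y| < B x`. -/
def wedge (B X : ℝ) : Set ℂ := {b | |b.im| < B * b.re ∧ X < b.re}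

theorem wedge_subset {B X : ℝ} (hX : 0 ≤ X) : wedge B X ⊆ rightHalfPlane :=
  fun _ hb => hX.trans_lt hb.2

/-- A condition `p + q y < M x` with `0 ≤ M` that holds at the end points of a hyperbolic segment holds
along the segment. -/
theorem lt_mul_re_chart {a v : ℂ} (ha : a ∈ rightHalfPlane) (hv : v ∈ ball (0 : ℂ) 1) {s : ℝ}
    (hs : s ∈ Icc (0 : ℝ) 1) {p q M : ℝ} (hM : 0 ≤ M) (h0 : p + q * a.im < M * a.re)
    (h1 : p + q * (chart a v).im < M * (chart a v).re) :
    p + q * (chart a (s * v)).im < M * (chart a (s * v)).re := by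
  have hw := radial_mem hv hs
  have hD := normSq_one_sub_pos hw
  have hD1 := normSq_one_sub_pos hv
  have hr := normSq_lt_one hv
  have hr0 := Complex.normSq_nonneg v
  have e1 := chart_re_mul a hv
  have e2 := chart_im_mul a hv
  have e3 := chart_re_mul a hw
  have e4 := chart_im_mul a hw
  have hx : 0 < a.re := ha
  have eD : Complex.normSq (1 - s * v) =
      (1 - s) * (1 - s * Complex.normSq v) + s * Complex.normSq (1 - v) := by
    simp only [Complex.normSq_apply, Complex.sub_re, Complex.one_re, Complex.mul_re,
      Complex.ofReal_re, Complex.ofReal_im, zero_mul, sub_zero, Complex.sub_im, Complex.one_im,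
      Complex.mul_im, add_zero, zero_sub]
    ring
  have eN : Complex.normSq (s * v) = s ^ 2 * Complex.normSq v := by
    rw [Complex.normSq_mul, Complex.normSq_ofReal]; ring
  have eI : ((s : ℂ) * v).im = s * v.im := by simp
  rw [eN] at e3
  rw [eI] at e4
  generalize Complex.normSq (1 - s * v) = D at *
  generalize Complex.normSq (1 - v) = D1 at *
  generalize Complex.normSq v = r at *
  generalize (chart a (s * v)).re = cx at *
  generalize (chart a (s * v)).im = cy at *
  generalize (chart a v).re = bx at *
  generalize (chart a v).im = b_y at *
  obtain ⟨hs0, hs1⟩ := hs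
  have hα : 0 ≤ (1 - s) * (1 - s * r) := mul_nonneg (by linarith) (by nlinarith)
  -- Cleared of denominators, the condition at the intermediate point is a nonnegative combination
  -- of those at the end points plus a term with the sign of `M`.
  have key : D * (M * cx - p - q * cy) = (1 - s) * (1 - s * r) * (M * a.re - (p + q * a.im)) +
      s * D1 * (M * bx - (p + q * b_y)) + M * a.re * (2 * s * (1 - s) * r) := by
    linear_combination M * e3 - q * e4 - (p + q * a.im) * eD - s * M * e1 + s * q * e2
  have hpos : 0 < D * (M * cx - p - q * cy) := by
    rw [key]
    have t1 : 0 ≤ (1 - s) * (1 - s * r) * (M * a.re - (p + q * a.im)) :=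
      mul_nonneg hα (by linarith)
    have t2 : 0 ≤ s * D1 * (M * bx - (p + q * b_y)) :=
      mul_nonneg (mul_nonneg hs0 hD1.le) (by linarith)
    have t3 : 0 ≤ M * a.re * (2 * s * (1 - s) * r) := by
      have : 0 ≤ 1 - s := by linarith
      positivity
    rcases hs0.eq_or_lt with h | h
    · have : 0 < (1 - s) * (1 - s * r) * (M * a.re - (p + q * a.im)) := by
        rw [← h]; simp; linarith
      linarith
    · have : 0 < s * D1 * (M * bx - (p + q * b_y)) := mul_pos (mul_pos h hD1) (by linarith)
      linarith
  have := pos_of_mul_pos_right hpos hD.le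
  linarith

/-- Hyperbolic convexity of the truncated angle: each of its three defining linear inequalities
persists along the hyperbolic segment by `lt_mul_re_chart`. -/
theorem chart_radial_mem_wedge {B X : ℝ} (hX : 0 ≤ X) {a b : ℂ} (ha : a ∈ wedge B X)
    (hb : b ∈ wedge B X) {s : ℝ} (hs : s ∈ Icc (0 : ℝ) 1) :
    chart a (s * chartInv a b) ∈ wedge B X := by
  have ha' := wedge_subset hX ha
  have hb' := wedge_subset hX hb
  have hv := chartInv_mem ha' hb'
  have e := chart_chartInv ha' hb'
  have hB : 0 ≤ B := by
    have h1 : 0 < B * a.re := (abs_nonneg _).trans_lt ha.1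
    exact (pos_of_mul_pos_left h1 (le_of_lt ha')).le
  obtain ⟨a1, a2⟩ := abs_lt.1 ha.1
  obtain ⟨b1, b2⟩ := abs_lt.1 hb.1
  refine ⟨abs_lt.2 ⟨?_, ?_⟩, ?_⟩
  · have := lt_mul_re_chart ha' hv hs (p := 0) (q := -1) hB (by linarith) (by rw [e]; linarith)
    linarith
  · have := lt_mul_re_chart ha' hv hs (p := 0) (q := 1) hB (by linarith) (by rw [e]; linarith)
    linarith
  · have := lt_mul_re_chart ha' hv hs (p := X) (q := 0) zero_le_one (by linarith [ha.2])
      (by rw [e]; linarith [hb.2])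
    linarith

/-- A pseudohyperbolic disc has Euclidean size comparable to the real part. The estimate is centred
at `c`, so the bound is `k * c.re`; this costs a factor `1 + k` in the truncation and widens the
slope accordingly. -/
theorem mem_wedge_of_norm_chartInv_le {r B X : ℝ} (hr0 : 0 ≤ r) (hr : r < 1) (hX : 0 ≤ X) {k : ℝ}
    (hk : k = 2 * r / (1 - r)) {b c : ℂ} (hb : b ∈ wedge B ((1 + k) * X)) (hB : 0 ≤ B)
    (hc : c ∈ rightHalfPlane) (h : ‖chartInv b c‖ ≤ r) : c ∈ wedge (B * (1 + k) + k) X := by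
  have hk0 : 0 ≤ k := hk ▸ div_nonneg (by linarith) (by linarith)
  have hb' : b ∈ rightHalfPlane := wedge_subset (mul_nonneg (by linarith) hX) hb
  rw [norm_chartInv_comm] at h
  have h1 := norm_sub_le_of_norm_chartInv_le hc hb' hr0 hr h
  rw [← hk] at h1
  have h2 := (abs_le.1 ((Complex.abs_re_le_norm (b - c)).trans h1)).2
  have h3 := (Complex.abs_im_le_norm (b - c)).trans h1
  rw [Complex.sub_re] at h2
  rw [Complex.sub_im] at h3
  have h4 : b.re ≤ (1 + k) * c.re := by linarith
  refine ⟨?_, ?_⟩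
  · have h5 : |c.im| ≤ |b.im| + |b.im - c.im| := by
      have := abs_sub_abs_le_abs_sub c.im b.im
      rw [abs_sub_comm] at this
      linarith
    have h6 := hb.1
    nlinarith [mul_le_mul_of_nonneg_left h4 hB]
  · have h6 := hb.2
    exact lt_of_mul_lt_mul_left (h6.trans_le h4) (by linarith)

/-- Points hyperbolically close to a point far out on a horizontal line. -/
theorem mem_wedge_of_horizontal {r X y : ℝ} (hr0 : 0 ≤ r) (hr : r < 1) (hX : 0 ≤ X) {k : ℝ}
    (hk : k = 2 * r / (1 - r)) {a b : ℂ} (ha : (1 + k) * X < a.re) (ha' : (1 + k) * |y| < a.re)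
    (hay : a.im = y) (hb : b ∈ rightHalfPlane) (h : ‖chartInv b a‖ ≤ r) :
    b ∈ wedge (1 + k) X := by
  have hk0 : 0 ≤ k := hk ▸ div_nonneg (by linarith) (by linarith)
  have ha0 : a ∈ rightHalfPlane := (mul_nonneg (by linarith) hX : 0 ≤ (1 + k) * X).trans_lt ha
  have h1 := norm_sub_le_of_norm_chartInv_le hb ha0 hr0 hr h
  rw [← hk] at h1
  have h2 := (abs_le.1 ((Complex.abs_re_le_norm (a - b)).trans h1)).2
  have h3 := (Complex.abs_im_le_norm (a - b)).trans h1
  rw [Complex.sub_re] at h2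
  rw [Complex.sub_im, hay] at h3
  have h4 : a.re ≤ (1 + k) * b.re := by linarith
  have hy : |y| < b.re := lt_of_mul_lt_mul_left (ha'.trans_le h4) (by linarith)
  refine ⟨?_, lt_of_mul_lt_mul_left (ha.trans_le h4) (by linarith)⟩
  have := abs_sub_abs_le_abs_sub b.im y
  rw [abs_sub_comm] at this
  linarith

/-- The comparison point on the line has the same real part as `b`. Since `|y| ≤ X < b.re`, the
denominator in `one_sub_norm_chartInv_sq` is at most `((B + 3) * b.re) ^ 2`, and the real part
cancels. -/
theorem norm_chartInv_le_of_mem_wedge {B X y : ℝ} (hX : 0 ≤ X) (hy : |y| ≤ X) {b : ℂ}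
    (hb : b ∈ wedge B X) :
    ‖chartInv b (⟨b.re, y⟩ : ℂ)‖ ≤ √(1 - 4 / (B + 3) ^ 2) := by
  have hb' := wedge_subset hX hb
  have hx : 0 < b.re := hb'
  have ha : (⟨b.re, y⟩ : ℂ) ∈ rightHalfPlane := hb'
  refine Real.le_sqrt_of_sq_le ?_
  have e := one_sub_norm_chartInv_sq hb' ha
  have hB : 0 < B := pos_of_mul_pos_left ((abs_nonneg _).trans_lt hb.1) hx.le
  have h1 : ‖(⟨b.re, y⟩ : ℂ) + starRingEnd ℂ b‖ ≤ (B + 3) * b.re := by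
    refine (Complex.norm_le_abs_re_add_abs_im _).trans ?_
    simp only [Complex.add_re, Complex.conj_re, Complex.add_im, Complex.conj_im]
    rw [abs_of_pos (by linarith)]
    have := abs_add_le y (-b.im)
    rw [abs_neg] at this
    linarith [hb.1, hb.2]
  have h2 : 4 / (B + 3) ^ 2 ≤ 4 * b.re * b.re / ‖(⟨b.re, y⟩ : ℂ) + starRingEnd ℂ b‖ ^ 2 := by
    have hp : 0 < ‖(⟨b.re, y⟩ : ℂ) + starRingEnd ℂ b‖ := norm_pos_iff.2 (add_conj_ne_zero hb' ha)
    rw [div_le_div_iff₀ (by positivity) (by positivity)]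
    have := pow_le_pow_left₀ hp.le h1 2
    nlinarith
  simp only at e
  linarith

end HypGeom
namespace HypGeom

/-! ### The half-plane model of a simply connected domain -/

/-- `g` restricts to a biholomorphism of the right half-plane onto `D`. -/
def IsHalfPlaneMap (g : ℂ → ℂ) (D : Set ℂ) : Prop :=
  DifferentiableOn ℂ g rightHalfPlane ∧ InjOn g rightHalfPlane ∧ g '' rightHalfPlane = D

theorem one_mem_rightHalfPlane : (1 : ℂ) ∈ rightHalfPlane := by simp [rightHalfPlane]

theorem chartInv_injOn {a : ℂ} (ha : a ∈ rightHalfPlane) : InjOn (chartInv a) rightHalfPlane :=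
  LeftInvOn.injOn (f₁' := chart a) fun _ hv => chart_chartInv ha hv

variable {D : Set ℂ} {g : ℂ → ℂ}

/-- `chartInv 1` tends to `1` at `∞`, so the rotation by `σ` makes `∞` correspond to the boundary
point `σ`. -/
theorem IsRiemannMap.isHalfPlaneMap {f : ℂ → ℂ} (hf : IsRiemannMap f D) {σ : ℂ} (hσ : ‖σ‖ = 1) :
    IsHalfPlaneMap (fun b => f (σ * chartInv 1 b)) D := by
  have h1 := one_mem_rightHalfPlane
  have hσ0 : σ ≠ 0 := norm_ne_zero_iff.1 (by rw [hσ]; exact one_ne_zero)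
  have hm : MapsTo (fun b => σ * chartInv 1 b) rightHalfPlane (ball 0 1) := fun b hb => by
    have := chartInv_mem h1 hb
    simpa [hσ] using this
  refine ⟨hf.1.comp ((differentiableOn_chartInv h1).const_mul σ) hm, ?_, ?_⟩
  · refine hf.2.1.comp (fun x hx y hy h => chartInv_injOn h1 hx hy ?_) hm
    exact mul_left_cancel₀ hσ0 h
  · rw [← hf.2.2]
    refine Subset.antisymm ?_ ?_
    · rintro _ ⟨b, hb, rfl⟩
      exact ⟨_, hm hb, rfl⟩
    · rintro _ ⟨w, hw, rfl⟩
      have hw' : w / σ ∈ ball (0 : ℂ) 1 := by simpa [hσ] using hw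
      refine ⟨chart 1 (w / σ), chart_mem h1 hw', ?_⟩
      simp only [chartInv_chart h1 hw', mul_div_cancel₀ w hσ0]

theorem IsHalfPlaneMap.isRiemannMap (hg : IsHalfPlaneMap g D) {a : ℂ} (ha : a ∈ rightHalfPlane) :
    IsRiemannMap (g ∘ chart a) D := by
  have hm : MapsTo (chart a) (ball 0 1) rightHalfPlane := fun v hv => chart_mem ha hv
  exact ⟨hg.1.comp (differentiableOn_chart a) hm, hg.2.1.comp (chart_injOn ha) hm, by
    rw [image_comp, chart_image ha, hg.2.2]⟩

theorem IsHalfPlaneMap.hypDist_eq (hg : IsHalfPlaneMap g D) {a b : ℂ} (ha : a ∈ rightHalfPlane)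
    (hb : b ∈ rightHalfPlane) : hypDist D (g a) (g b) = Real.artanh ‖chartInv a b‖ := by
  have := (hg.isRiemannMap ha).hypDist_zero (chartInv_mem ha hb)
  simpa [chart_zero, chart_chartInv ha hb] using this

/-! ### Geodesic rays that tend to infinity in the half-plane -/

/-- In this form additivity of distances becomes an algebraic identity that can be divided by powers
of `‖p t‖` before passing to the limit. -/
theorem exp_two_mul_artanh_chartInv {a b : ℂ} (ha : a ∈ rightHalfPlane)
    (hb : b ∈ rightHalfPlane) : Real.exp (2 * Real.artanh ‖chartInv a b‖) =
      (‖b + starRingEnd ℂ a‖ + ‖b - a‖) ^ 2 / (4 * a.re * b.re) := by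
  have hp : 0 < ‖b + starRingEnd ℂ a‖ := norm_pos_iff.2 (add_conj_ne_zero ha hb)
  have hlt := norm_sub_lt_norm_add_conj ha hb
  have hρ : ‖chartInv a b‖ < 1 := by simpa using chartInv_mem ha hb
  have hρ0 := norm_nonneg (chartInv a b)
  rw [Real.artanh_eq_half_log ⟨by linarith, hρ.le⟩, ← mul_assoc, mul_one_div_cancel two_ne_zero,
    one_mul, Real.exp_log (div_pos (by linarith) (by linarith)), chartInv, norm_div,
    ← norm_add_conj_sq_sub]
  have h1 : ‖b + starRingEnd ℂ a‖ - ‖b - a‖ ≠ 0 := by linarith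
  have h2 : ‖b + starRingEnd ℂ a‖ ^ 2 - ‖b - a‖ ^ 2 ≠ 0 := by
    rw [sq_sub_sq]
    exact mul_ne_zero (by positivity) h1
  have h3 : 1 - ‖b - a‖ / ‖b + starRingEnd ℂ a‖ ≠ 0 := by
    rw [one_sub_div hp.ne']
    exact div_ne_zero h1 hp.ne'
  rw [div_eq_div_iff h3 h2]
  field_simp
  ring

theorem tendsto_norm_add_div_norm {c : ℝ → ℂ} (hc : Tendsto (fun t => ‖c t‖) atTop atTop) (a : ℂ) :
    Tendsto (fun t => ‖c t + a‖ / ‖c t‖) atTop (𝓝 1) := by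
  have h0 : Tendsto (fun t => ‖a‖ / ‖c t‖) atTop (𝓝 0) := hc.const_div_atTop _
  have h1 : Tendsto (fun t => ‖c t + a‖ / ‖c t‖ - 1) atTop (𝓝 0) := by
    refine squeeze_zero_norm' ?_ h0
    filter_upwards [hc.eventually_gt_atTop 0] with t ht
    rw [div_sub_one ht.ne', norm_div, norm_norm]
    refine div_le_div_of_nonneg_right ?_ ht.le
    have := abs_norm_sub_norm_le (c t + a) (c t)
    simpa using this
  simpa using h1.add_const 1

/-- On a hyperbolic geodesic that tends to infinity in the half-plane the imaginary part is
constant and the real part is nondecreasing. -/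
theorem im_eq_and_re_le_of_additive {b c : ℂ} (hb : b ∈ rightHalfPlane) (hc : c ∈ rightHalfPlane)
    {p : ℝ → ℂ} (hp : ∀ᶠ t in atTop, p t ∈ rightHalfPlane)
    (hpl : Tendsto (fun t => ‖p t‖) atTop atTop)
    (hadd : ∀ᶠ t in atTop, Real.artanh ‖chartInv b (p t)‖ =
      Real.artanh ‖chartInv b c‖ + Real.artanh ‖chartInv c (p t)‖) :
    c.im = b.im ∧ b.re ≤ c.re := by
  have hb0 : 0 < b.re := hb
  have hc0 : 0 < c.re := hc
  have hlim : ∀ a : ℂ, Tendsto (fun t => ((‖p t + starRingEnd ℂ a‖ + ‖p t - a‖) / ‖p t‖) ^ 2) atTop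
      (𝓝 4) := by
    intro a
    have := ((tendsto_norm_add_div_norm hpl (starRingEnd ℂ a)).add
      (tendsto_norm_add_div_norm hpl (-a))).pow 2
    norm_num at this
    refine this.congr fun t => ?_
    rw [← add_div, sub_eq_add_neg]
  have hev : ∀ᶠ t in atTop, ((‖p t + starRingEnd ℂ b‖ + ‖p t - b‖) / ‖p t‖) ^ 2 * (4 * c.re ^ 2) =
      (‖c + starRingEnd ℂ b‖ + ‖c - b‖) ^ 2 *
        ((‖p t + starRingEnd ℂ c‖ + ‖p t - c‖) / ‖p t‖) ^ 2 := by
    filter_upwards [hp, hadd, hpl.eventually_gt_atTop 0] with t ht hta htp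
    have ht0 : 0 < (p t).re := ht
    have h := congrArg (fun x => Real.exp (2 * x)) hta
    simp only [mul_add, Real.exp_add] at h
    rw [exp_two_mul_artanh_chartInv hb ht, exp_two_mul_artanh_chartInv hb hc,
      exp_two_mul_artanh_chartInv hc ht] at h
    field_simp at h ⊢
    linear_combination h
  -- The limit forces `‖c + conj b‖ + ‖c - b‖ = 2 * c.re`. The summands are at least `c.re + b.re`
  -- and `c.re - b.re`, so both are equalities, and `c - b` is real and nonnegative.
  have heq : 4 * (4 * c.re ^ 2) = (‖c + starRingEnd ℂ b‖ + ‖c - b‖) ^ 2 * 4 :=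
    tendsto_nhds_unique_of_eventuallyEq ((hlim b).mul_const _) ((hlim c).const_mul _) hev
  have hS : ‖c + starRingEnd ℂ b‖ + ‖c - b‖ = 2 * c.re := by
    rw [← sq_eq_sq₀ (by positivity) (by positivity)]
    linarith
  have h1 : c.re + b.re ≤ ‖c + starRingEnd ℂ b‖ := by
    simpa using Complex.re_le_norm (c + starRingEnd ℂ b)
  have h2 : c.re - b.re ≤ ‖c - b‖ := by simpa using Complex.re_le_norm (c - b)
  have h3 : ‖c - b‖ = c.re - b.re := by linarith
  have h4 : 0 ≤ c.re - b.re := h3 ▸ norm_nonneg _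
  refine ⟨?_, by linarith⟩
  have h5 := congrArg (· ^ 2) h3
  simp only [← Complex.normSq_eq_norm_sq, Complex.normSq_apply, Complex.sub_re, Complex.sub_im]
    at h5
  have h6 : (c.im - b.im) ^ 2 = 0 := by linarith
  exact sub_eq_zero.1 (pow_eq_zero_iff two_ne_zero |>.1 h6)

theorem IsDiscGeodesicRay.discDist_add {η : ℝ → ℂ} (hη : IsDiscGeodesicRay η) {s t u : ℝ}
    (hs : 0 ≤ s) (hst : s ≤ t) (htu : t ≤ u) :
    discDist (η s) (η u) = discDist (η s) (η t) + discDist (η t) (η u) := by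
  rw [← hη.2.2 s u hs (hst.trans htu), ← hη.2.2 s t hs hst, ← hη.2.2 t u (hs.trans hst) htu]
  have hu : 0 ≤ u := hs.trans (hst.trans htu)
  have hint := intervalIntegrable_length hu (hη.1 u hu) continuousOn_discDensity
    (hη.2.1.mono_left Icc_subset_Ici_self)
  refine (intervalIntegral.integral_add_adjacent_intervals (hint.mono_set ?_)
    (hint.mono_set ?_)).symm
  · rw [uIcc_of_le hst, uIcc_of_le hu]
    exact Icc_subset_Icc hs htu
  · rw [uIcc_of_le htu, uIcc_of_le hu]
    exact Icc_subset_Icc (hs.trans hst) le_rfl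

theorem IsGeodesicRay.mem {γ : ℝ → ℂ} (hγ : IsGeodesicRay D γ) {t : ℝ} (ht : 0 ≤ t) : γ t ∈ D := by
  obtain ⟨f, η, hf, hη, h⟩ := hγ
  rw [h t ht]
  exact hf.mapsTo (hη.2.1 ht)

theorem IsGeodesicRay.hypDist_add {γ : ℝ → ℂ} (hγ : IsGeodesicRay D γ) {s t u : ℝ}
    (hs : 0 ≤ s) (hst : s ≤ t) (htu : t ≤ u) :
    hypDist D (γ s) (γ u) = hypDist D (γ s) (γ t) + hypDist D (γ t) (γ u) := by
  obtain ⟨f, η, hf, hη, h⟩ := hγ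
  have ht := hs.trans hst
  have hu := ht.trans htu
  rw [h s hs, h t ht, h u hu, hf.hypDist_eq (hη.2.1 hs) (hη.2.1 hu),
    hf.hypDist_eq (hη.2.1 hs) (hη.2.1 ht), hf.hypDist_eq (hη.2.1 ht) (hη.2.1 hu),
    hη.discDist_add hs hst htu]

theorem IsGeodesicRay.continuousOn {γ : ℝ → ℂ} (hγ : IsGeodesicRay D γ) :
    ContinuousOn γ (Ici 0) := by
  obtain ⟨f, η, hf, hη, h⟩ := hγ
  have hc : ContinuousOn η (Ici 0) := by
    intro t ht
    have h1 := (hη.1 (t + 1) (by linarith [mem_Ici.1 ht])).continuousOn t ⟨ht, by linarith⟩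
    refine h1.mono_of_mem_nhdsWithin ?_
    rw [← Ici_inter_Iic]
    exact inter_mem self_mem_nhdsWithin (mem_nhdsWithin_of_mem_nhds (Iic_mem_nhds (by linarith)))
  exact (hf.1.continuousOn.comp hc hη.2.1).congr h

/-- In the half-plane model in which a geodesic ray tends to `∞` it is a horizontal half-line. -/
theorem IsGeodesicRay.exists_horizontal {γ : ℝ → ℂ} (hγ : IsGeodesicRay D γ)
    (hg : IsHalfPlaneMap g D) {p : ℝ → ℂ} (hp : ContinuousOn p (Ici 0))
    (hpH : ∀ t, 0 ≤ t → p t ∈ rightHalfPlane) (hgp : ∀ t, 0 ≤ t → g (p t) = γ t)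
    (hpl : Tendsto (fun t => ‖p t‖) atTop atTop) :
    ∃ (y : ℝ) (x : ℝ → ℝ), ContinuousOn x (Ici 0) ∧ Tendsto x atTop atTop ∧
      ∀ t, 0 ≤ t → 0 < x t ∧ g ⟨x t, y⟩ = γ t := by
  have him : ∀ t, 0 ≤ t → (p t).im = (p 0).im := by
    intro t ht
    refine (im_eq_and_re_le_of_additive (hpH 0 le_rfl) (hpH t ht)
      ((eventually_ge_atTop 0).mono hpH) hpl ?_).1
    filter_upwards [eventually_ge_atTop t] with u hu
    have hu0 := ht.trans hu
    rw [← hg.hypDist_eq (hpH 0 le_rfl) (hpH u hu0), ← hg.hypDist_eq (hpH 0 le_rfl) (hpH t ht),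
      ← hg.hypDist_eq (hpH t ht) (hpH u hu0), hgp 0 le_rfl, hgp t ht, hgp u hu0,
      hγ.hypDist_add le_rfl ht hu]
  refine ⟨(p 0).im, fun t => (p t).re, Complex.continuous_re.comp_continuousOn hp, ?_, ?_⟩
  · refine tendsto_atTop_mono' _ ?_ (tendsto_atTop_add_const_right _ (-|(p 0).im|) hpl)
    filter_upwards [eventually_ge_atTop 0] with t ht
    have h1 := Complex.norm_le_abs_re_add_abs_im (p t)
    rw [abs_of_pos (hpH t ht), him t ht] at h1
    linarith
  · intro t ht
    refine ⟨hpH t ht, ?_⟩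
    rw [← hgp t ht]
    congr 1
    exact Complex.ext rfl (him t ht).symm

end HypGeom
namespace HypGeom

/-! ### Sectors in the half-plane model -/

variable {D : Set ℂ} {g : ℂ → ℂ} {γ : ℝ → ℂ} {x : ℝ → ℝ} {y : ℝ}

/-- A point of the sector is at bounded pseudohyperbolic distance from a far point of the half-line,
where the height is negligible. Hence the slope depends only on `R`, while the truncation `X` is
free. -/
theorem IsHalfPlaneMap.sector_subset (hg : IsHalfPlaneMap g D) (hx : Tendsto x atTop atTop)
    (hγ : ∀ t, 0 ≤ t → 0 < x t ∧ g ⟨x t, y⟩ = γ t) {R : ℝ} (hR : 0 < R) :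
    ∃ B, 0 ≤ B ∧ ∀ X, 0 ≤ X → ∃ t₁, 0 ≤ t₁ ∧ sector D γ t₁ R ⊆ g '' wedge B X := by
  obtain ⟨r, hr, hrR⟩ := Real.artanh_surjOn (mem_univ R)
  have hr0 : 0 ≤ r := by
    by_contra hcon
    have := Real.artanh_neg ⟨hr.1, not_le.1 hcon⟩
    linarith
  set k := 2 * r / (1 - r) with hk
  have hk0 : 0 ≤ k := div_nonneg (by linarith) (by linarith [hr.2])
  refine ⟨1 + k, by linarith, fun X hX => ?_⟩
  obtain ⟨t₁, ht₁⟩ := eventually_atTop.1 ((hx.eventually_gt_atTop ((1 + k) * X)).and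
    (hx.eventually_gt_atTop ((1 + k) * |y|)))
  refine ⟨max t₁ 0, le_max_right _ _, ?_⟩
  rintro z ⟨hz, hzs⟩
  obtain ⟨⟨t, ht⟩, hlt⟩ := exists_lt_of_ciInf_lt hzs
  have ht0 : 0 ≤ t := (le_max_right _ _).trans ht
  obtain ⟨h1, h2⟩ := ht₁ t ((le_max_left _ _).trans ht)
  obtain ⟨h3, h4⟩ := hγ t ht0
  rw [← hg.2.2] at hz
  obtain ⟨b, hb, rfl⟩ := hz
  have ha : (⟨x t, y⟩ : ℂ) ∈ rightHalfPlane := h3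
  have hm := chartInv_mem hb ha
  have hm1 : ‖chartInv b ⟨x t, y⟩‖ < 1 := by simpa using hm
  simp only at hlt
  rw [← h4, hg.hypDist_eq hb ha, ← hrR,
    Real.artanh_lt_artanh_iff ⟨by linarith [norm_nonneg (chartInv b ⟨x t, y⟩)], hm1⟩ hr] at hlt
  exact ⟨b, mem_wedge_of_horizontal hr0 hr.2 hX hk h1 h2 rfl hb hlt.le, rfl⟩

theorem IsHalfPlaneMap.exists_wedge_subset_sector (hg : IsHalfPlaneMap g D)
    (hxc : ContinuousOn x (Ici 0)) (hx : Tendsto x atTop atTop)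
    (hγ : ∀ t, 0 ≤ t → 0 < x t ∧ g ⟨x t, y⟩ = γ t) {B : ℝ} (hB : 0 ≤ B) :
    ∃ R, 0 < R ∧ ∀ t₀, 0 ≤ t₀ → ∃ X, 0 < X ∧ g '' wedge B X ⊆ sector D γ t₀ R := by
  set r := √(1 - 4 / (B + 3) ^ 2) with hr
  have hr1 : r < 1 := by
    have : 0 < 4 / (B + 3) ^ 2 := by positivity
    rw [hr, Real.sqrt_lt' one_pos]
    linarith
  have hr0 : 0 ≤ r := Real.sqrt_nonneg _
  have hR : 0 ≤ Real.artanh r := Real.artanh_nonneg hr0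
  -- The `1` makes the distance bound strict. Below, `x t₀ ≤ X` ensures that the half-line attains
  -- the real part of a wedge point at a time after `t₀`.
  refine ⟨Real.artanh r + 1, by linarith, fun t₀ ht₀ => ?_⟩
  have hX : 0 < max (x t₀) |y| := (hγ t₀ ht₀).1.trans_le (le_max_left _ _)
  refine ⟨_, hX, ?_⟩
  rintro _ ⟨b, hb, rfl⟩
  have hb' := wedge_subset hX.le hb
  refine ⟨hg.2.2 ▸ mem_image_of_mem g hb', ?_⟩
  obtain ⟨T, hT, hbT⟩ := ((hx.eventually_ge_atTop b.re).and (eventually_ge_atTop t₀)).exists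
  obtain ⟨t, ht, htb⟩ := intermediate_value_Icc hbT
    (hxc.mono (Icc_subset_Ici_self.trans (Ici_subset_Ici.2 ht₀)))
    ⟨(le_max_left _ _).trans hb.2.le, hT⟩
  have h := norm_chartInv_le_of_mem_wedge hX.le (le_max_right _ _) hb
  have ha : (⟨b.re, y⟩ : ℂ) ∈ rightHalfPlane := hb'
  have hdist : ∀ s, 0 ≤ s → hypDist D (g b) (γ s) = Real.artanh ‖chartInv b ⟨x s, y⟩‖ := by
    intro s hs
    rw [← (hγ s hs).2]
    exact hg.hypDist_eq hb' (hγ s hs).1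
  have hbdd : BddBelow (range fun s : Ici t₀ => hypDist D (g b) (γ s)) := by
    refine ⟨0, ?_⟩
    rintro _ ⟨⟨s, hs⟩, rfl⟩
    simp only
    rw [hdist s (ht₀.trans hs)]
    exact Real.artanh_nonneg (norm_nonneg _)
  refine (ciInf_le hbdd ⟨t, ht.1⟩).trans_lt ?_
  simp only
  rw [hdist t (ht₀.trans ht.1), htb]
  have := Real.artanh_le_artanh (by linarith [norm_nonneg (chartInv b ⟨b.re, y⟩)]) hr1 h
  linarith

/-! ### Landing in the half-plane model -/

/-- The landing hypothesis comes with a Riemann map of its own. Through that map the curve tends to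
`ζ` in the Carathéodory topology, a statement free of the map, which is then pulled back by the
fixed `f`. -/
theorem LandsAt.tendsto_inv (hDc : IsSimplyConnected D) (hDu : D ≠ univ) {f : ℂ → ℂ}
    (hf : IsRiemannMap f D) {σ : ℂ} (hσ : ‖σ‖ = 1) {ζ : PrimeEnd D}
    (hζ : CaratheodoryMapsTo f σ ζ) (hγD : ∀ t, 0 ≤ t → γ t ∈ D) (hγ : LandsAt γ ζ) :
    Tendsto (fun t => Function.invFunOn f (ball 0 1) (γ t)) atTop (𝓝 σ) := by
  obtain ⟨f', σ', hf', -, hζ', hl⟩ := hγ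
  have h0 := eventually_ge_atTop (0 : ℝ)
  refine tendsto_of_tendsto_nhdsTrace hDc hDu hf hσ hζ
    (h0.mono fun t ht => hf.inv_mem (hγD t ht)) ?_
  refine (hζ'.comp (tendsto_nhdsWithin_iff.2
    ⟨hl, h0.mono fun t ht => hf'.inv_mem (hγD t ht)⟩)).congr' ?_
  filter_upwards [h0] with t ht
  rw [hf.apply_inv (hγD t ht)]
  exact hf'.apply_inv (hγD t ht)

theorem tendsto_norm_chart_one {p : ℝ → ℂ} (hp : ∀ᶠ t in atTop, p t ∈ ball (0 : ℂ) 1)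
    (hl : Tendsto p atTop (𝓝 1)) : Tendsto (fun t => ‖chart 1 (p t)‖) atTop atTop := by
  have h1 : Tendsto (fun t => ‖1 + p t‖) atTop (𝓝 2) := by
    have := (hl.const_add 1).norm
    norm_num at this
    exact this
  have h2 : Tendsto (fun t => ‖1 - p t‖⁻¹) atTop atTop := by
    refine tendsto_inv_nhdsGT_zero.comp (tendsto_nhdsWithin_iff.2 ⟨?_, ?_⟩)
    · simpa using (hl.const_sub 1).norm
    · exact hp.mono fun t ht => norm_pos_iff.2 (one_sub_ne_zero_of_mem_ball ht)
  refine (h1.pos_mul_atTop two_pos h2).congr fun t => ?_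
  simp [chart, div_eq_mul_inv]

theorem IsGeodesicRay.exists_horizontal_of_tendsto (hγ : IsGeodesicRay D γ) {f : ℂ → ℂ}
    (hf : IsRiemannMap f D) {σ : ℂ} (hσ : ‖σ‖ = 1)
    (hl : Tendsto (fun t => Function.invFunOn f (ball 0 1) (γ t)) atTop (𝓝 σ)) :
    ∃ (y : ℝ) (x : ℝ → ℝ), ContinuousOn x (Ici 0) ∧ Tendsto x atTop atTop ∧
      ∀ t, 0 ≤ t → 0 < x t ∧ f (σ * chartInv 1 ⟨x t, y⟩) = γ t := by
  have h1 := one_mem_rightHalfPlane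
  have hσ0 : σ ≠ 0 := norm_ne_zero_iff.1 (by rw [hσ]; exact one_ne_zero)
  set q : ℝ → ℂ := fun t => Function.invFunOn f (ball 0 1) (γ t) / σ with hq
  have hqb : ∀ t, 0 ≤ t → q t ∈ ball (0 : ℂ) 1 := fun t ht => by
    have := hf.inv_mem (hγ.mem ht)
    simpa [hq, hσ] using this
  have hql : Tendsto q atTop (𝓝 1) := by
    have := hl.div_const σ
    rwa [div_self hσ0] at this
  have hqc : ContinuousOn q (Ici 0) :=
    (hf.differentiableOn_inv.continuousOn.comp hγ.continuousOn fun t ht => hγ.mem ht).div_const σ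
  refine hγ.exists_horizontal (hf.isHalfPlaneMap hσ) (p := fun t => chart 1 (q t))
    ((differentiableOn_chart 1).continuousOn.comp hqc hqb) (fun t ht => chart_mem h1 (hqb t ht))
    (fun t ht => ?_) (tendsto_norm_chart_one ((eventually_ge_atTop 0).mono hqb) hql)
  rw [chartInv_chart h1 (hqb t ht), hq, mul_div_cancel₀ _ hσ0, hf.apply_inv (hγ.mem ht)]

/-! ### Comparison of the hyperbolic metrics -/

theorem hypDensity_anti {D₁ D₂ : Set ℂ} {f₁ f₂ : ℂ → ℂ} (h₁ : IsRiemannMap f₁ D₁)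
    (h₂ : IsRiemannMap f₂ D₂) (h : D₁ ⊆ D₂) {z : ℂ} (hz : z ∈ D₁) :
    hypDensity D₂ z ≤ hypDensity D₁ z := by
  have hu := h₁.inv_mem hz
  have hle := h₂.hypDensity_mul_le h₁.1 (h₁.mapsTo.mono_right h) hu
  rw [← h₁.hypDensity_mul hu, h₁.apply_inv hz] at hle
  exact le_of_mul_le_mul_right hle (norm_pos_iff.2 (h₁.deriv_ne_zero hu))

theorem IsRiemannMap.exists_curve {f : ℂ → ℂ} (hf : IsRiemannMap f D) {z w : ℂ} (hz : z ∈ D)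
    (hw : w ∈ D) : ∃ (η : ℝ → ℂ), PiecewiseC1On η 0 1 ∧ MapsTo η (Icc 0 1) D ∧ η 0 = z ∧
      η 1 = w := by
  set u := Function.invFunOn f (ball 0 1) z with hu
  set v := Function.invFunOn f (ball 0 1) w with hv
  have hub : u ∈ ball (0 : ℂ) 1 := hf.inv_mem hz
  have hvb : v ∈ ball (0 : ℂ) 1 := hf.inv_mem hw
  have hm : MapsTo (fun t : ℝ => AffineMap.lineMap u v (t : ℂ)) (Icc 0 1) (ball (0 : ℂ) 1) := by
    intro t ht
    have h := (convex_ball (0 : ℂ) 1).lineMap_mem hub hvb ht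
    convert h using 1
    simp [AffineMap.lineMap_apply]
  have hp : PiecewiseC1On (fun t : ℝ => AffineMap.lineMap u v (t : ℂ)) 0 1 := by
    refine PiecewiseC1On.of_contDiff ?_ zero_le_one
    simp only [AffineMap.lineMap_apply, vsub_eq_sub, smul_eq_mul, vadd_eq_add]
    exact (Complex.ofRealCLM.contDiff.mul contDiff_const).add contDiff_const
  refine ⟨_, hp.comp isOpen_ball hf.1 hm, hf.mapsTo.comp hm, ?_, ?_⟩
  · simpa using hf.apply_inv hz
  · simpa using hf.apply_inv hw

theorem hypDist_anti {D₁ D₂ : Set ℂ} {f₁ f₂ : ℂ → ℂ} (h₁ : IsRiemannMap f₁ D₁)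
    (h₂ : IsRiemannMap f₂ D₂) (h : D₁ ⊆ D₂) {z w : ℂ} (hz : z ∈ D₁) (hw : w ∈ D₁) :
    hypDist D₂ z w ≤ hypDist D₁ z w := by
  obtain ⟨η, hη, hηm, hη0, hη1⟩ := h₁.exists_curve hz hw
  refine le_metricDist zero_le_one hη hηm hη0 hη1 ?_
  rintro η c d hcd hp hm rfl rfl
  refine (metricDist_le (fun z hz => (h₂.hypDensity_pos hz).le) hcd hp (hm.mono_right h)).trans ?_
  have := metricLength_mono hcd hp (h₂.continuousOn_hypDensity.mono h) h₁.continuousOn_hypDensity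
    Subset.rfl hm (K := 1) fun z hz => by
      rw [one_mul]
      exact hypDensity_anti h₁ h₂ h hz
  rwa [one_mul] at this

/-- If `D₁` contains the hyperbolic disc of pseudohyperbolic radius `1 / K` about a point, then the
density of `D₁` there is at most `K` times that of the model domain. -/
theorem IsHalfPlaneMap.hypDensity_le {D₁ : Set ℂ} {f₁ : ℂ → ℂ} (h₁ : IsRiemannMap f₁ D₁)
    (hg : IsHalfPlaneMap g D) {K : ℝ} (hK : 1 < K) {b : ℂ} (hb : b ∈ rightHalfPlane)
    (h : ∀ c ∈ rightHalfPlane, ‖chartInv b c‖ ≤ 1 / K → g c ∈ D₁) :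
    hypDensity D₁ (g b) ≤ K * hypDensity D (g b) := by
  have hK0 : 0 < K := one_pos.trans hK
  have hΦ := hg.isRiemannMap hb
  have h0 : (0 : ℂ) ∈ ball (0 : ℂ) 1 := by simp
  have hnorm : ∀ v ∈ ball (0 : ℂ) 1, ‖v / (K : ℂ)‖ ≤ 1 / K := fun v hv => by
    rw [norm_div, Complex.norm_real, Real.norm_of_nonneg hK0.le]
    exact div_le_div_of_nonneg_right (by simpa using (mem_ball.1 hv).le) hK0.le
  have hm : MapsTo (fun v => v / (K : ℂ)) (ball (0 : ℂ) 1) (ball 0 1) := fun v hv => by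
    rw [mem_ball_zero_iff]
    exact (hnorm v hv).trans_lt ((div_lt_one hK0).2 hK)
  -- The Riemann map centred at `g b`, restricted to the disc of radius `1 / K`, maps into `D₁`;
  -- rescaling divides its derivative at `0` by `K`.
  have hle := h₁.hypDensity_mul_le (g := fun v => (g ∘ chart b) (v / (K : ℂ)))
    (hΦ.1.comp (by fun_prop) hm) (fun v hv => h _ (chart_mem hb (hm hv)) (by
      rw [chartInv_chart hb (hm hv)]
      exact hnorm v hv)) h0
  have hd : HasDerivAt (fun v => (g ∘ chart b) (v / (K : ℂ)))
      (deriv (g ∘ chart b) 0 * (1 / (K : ℂ))) 0 := by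
    have h1 : HasDerivAt (fun v : ℂ => v / (K : ℂ)) (1 / (K : ℂ)) 0 := (hasDerivAt_id 0).div_const _
    have h2 : HasDerivAt (g ∘ chart b) (deriv (g ∘ chart b) 0) (0 / (K : ℂ)) := by
      rw [zero_div]
      exact (hΦ.1.differentiableAt (isOpen_ball.mem_nhds h0)).hasDerivAt
    exact HasDerivAt.comp (h₂ := g ∘ chart b) 0 h2 h1
  have heq := hΦ.hypDensity_mul h0
  rw [hd.deriv, norm_mul, norm_div, norm_one, Complex.norm_real, Real.norm_of_nonneg hK0.le,
    ← heq] at hle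
  simp only [zero_div, Function.comp_apply, chart_zero] at hle
  have hpos := norm_pos_iff.2 (hΦ.deriv_ne_zero h0)
  rw [mul_one_div, ← mul_div_assoc, div_le_iff₀ hK0] at hle
  refine le_of_mul_le_mul_right (hle.trans_eq ?_) hpos
  ring

/-- The radial segment in the chart centred at `a` realises the distance in `D` and stays in the
wedge by convexity, so it is an admissible curve in `D₁` along which the densities compare. -/
theorem IsHalfPlaneMap.hypDist_le {D₁ : Set ℂ} {f₁ : ℂ → ℂ} (h₁ : IsRiemannMap f₁ D₁)
    (hg : IsHalfPlaneMap g D) {K B X : ℝ} (hX : 0 ≤ X) (hD₁ : g '' wedge B X ⊆ D₁) (hD : D₁ ⊆ D)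
    (hle : ∀ z ∈ g '' wedge B X, hypDensity D₁ z ≤ K * hypDensity D z) {a b : ℂ}
    (ha : a ∈ wedge B X) (hb : b ∈ wedge B X) :
    hypDist D₁ (g a) (g b) ≤ K * hypDist D (g a) (g b) := by
  have ha' := wedge_subset hX ha
  have hb' := wedge_subset hX hb
  have hΦ := hg.isRiemannMap ha'
  have hv := chartInv_mem ha' hb'
  set v := chartInv a b with hvdef
  set η : ℝ → ℂ := (g ∘ chart a) ∘ fun s : ℝ => (s : ℂ) * v with hη
  have hm : MapsTo (fun s : ℝ => (s : ℂ) * v) (Icc 0 1) (ball (0 : ℂ) 1) := fun s hs =>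
    radial_mem hv hs
  have hp : PiecewiseC1On η 0 1 := (piecewiseC1On_radial v).comp isOpen_ball hΦ.1 hm
  have hηm : MapsTo η (Icc 0 1) (g '' wedge B X) := fun s hs =>
    ⟨_, chart_radial_mem_wedge hX ha hb hs, rfl⟩
  have hη0 : η 0 = g a := by simp [hη, chart_zero]
  have hη1 : η 1 = g b := by simp [hη, hvdef, chart_chartInv ha' hb']
  have e := metricLength_comp zero_le_one (piecewiseC1On_radial v) isOpen_ball hΦ.1 hm
    (ρB := hypDensity D) fun u hu => hΦ.hypDensity_mul hu
  rw [metricLength_radial hv, ← hg.hypDist_eq ha' hb'] at e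
  rw [← e, ← hη0, ← hη1]
  refine (metricDist_le (fun z hz => (h₁.hypDensity_pos hz).le) zero_le_one hp
    (hηm.mono_right hD₁)).trans ?_
  exact metricLength_mono zero_le_one hp h₁.continuousOn_hypDensity
    (hΦ.continuousOn_hypDensity.mono hD) hD₁ hηm hle

end HypGeom
-- Proof of the theorem
theorem mainTheorem12 (D₁ D₂ : Set ℂ)
    (hD₁_open : IsOpen D₁) (hD₁_sc : IsSimplyConnected D₁)
    (hD₂_open : IsOpen D₂) (hD₂_sc : IsSimplyConnected D₂)
    (hD₁D₂ : D₁ ⊆ D₂) (hD₂_ne : D₂ ≠ Set.univ)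
    (ζ : HypGeom.PrimeEnd D₂) (htan : HypGeom.InternallyTangent D₁ D₂ ζ)
    (γ : ℝ → ℂ) (hγ : HypGeom.IsGeodesicRay D₂ γ) (hγζ : HypGeom.LandsAt γ ζ)
    (K : ℝ) (hK : 1 < K) (R : ℝ) (hR : 0 < R) :
    ∃ t₁ : ℝ, 0 ≤ t₁ ∧
      HypGeom.sector D₂ γ t₁ R ⊆ D₁ ∧
      (∀ z ∈ HypGeom.sector D₂ γ t₁ R,
        HypGeom.hypDensity D₂ z ≤ HypGeom.hypDensity D₁ z ∧
        HypGeom.hypDensity D₁ z ≤ K * HypGeom.hypDensity D₂ z) ∧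
      (∀ z ∈ HypGeom.sector D₂ γ t₁ R, ∀ w ∈ HypGeom.sector D₂ γ t₁ R,
        HypGeom.hypDist D₂ z w ≤ HypGeom.hypDist D₁ z w ∧
        HypGeom.hypDist D₁ z w ≤ K * HypGeom.hypDist D₂ z w) := by
  obtain ⟨γ₀, hγ₀, ⟨h, σ, hh, hσ, hhσ, hl₀⟩, hin⟩ := htan
  have hσ1 : ‖σ‖ = 1 := by simpa using hσ
  -- The inverse Riemann map of `D₂`, restricted to `D₁`, is the embedding into the disc.
  obtain ⟨f₁, hf₁⟩ := HypGeom.exists_isRiemannMap hD₁_open hD₁_sc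
    (hh.differentiableOn_inv.mono hD₁D₂)
    (fun z hz w hw e => by rw [← hh.apply_inv (hD₁D₂ hz), e, hh.apply_inv (hD₁D₂ hw)])
    (fun z hz => hh.inv_mem (hD₁D₂ hz))
  have hg := hh.isHalfPlaneMap hσ1
  have hl := hγζ.tendsto_inv hD₂_sc hD₂_ne hh hσ1 hhσ fun t ht => hγ.mem ht
  obtain ⟨y₀, x₀, hx₀c, hx₀, hγx₀⟩ := hγ₀.exists_horizontal_of_tendsto hh hσ1 hl₀
  obtain ⟨y, x, -, hx, hγx⟩ := hγ.exists_horizontal_of_tendsto hh hσ1 hl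
  set g : ℂ → ℂ := fun b => h (σ * HypGeom.chartInv 1 b) with hgdef
  have hK0 : 0 < K := one_pos.trans hK
  have hr0 : 0 ≤ 1 / K := by positivity
  have hr1 : 1 / K < 1 := (div_lt_one hK0).2 hK
  obtain ⟨k, hk⟩ : ∃ k, k = 2 * (1 / K) / (1 - 1 / K) := ⟨_, rfl⟩
  have hk0 : 0 ≤ k := hk ▸ div_nonneg (by linarith) (by linarith)
  -- Order of choice: `R` fixes the slope `B`, `K` widens it to `B * (1 + k) + k`, and that slope
  -- fixes the amplitude `R₀` at which tangency along `γ₀` is used. This yields `t₀` and the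
  -- truncation `X`, and only then `t₁` along `γ`.
  obtain ⟨B, hB, hsec⟩ := hg.sector_subset hx hγx hR
  have hB' : 0 ≤ B * (1 + k) + k := by positivity
  obtain ⟨R₀, hR₀, hwed⟩ := hg.exists_wedge_subset_sector hx₀c hx₀ hγx₀ hB'
  obtain ⟨t₀, ht₀, hsub₀⟩ := hin R₀ hR₀
  obtain ⟨X, hX, hXsub⟩ := hwed t₀ ht₀
  have hX' : 0 ≤ (1 + k) * X := by positivity
  obtain ⟨t₁, ht₁, hsub⟩ := hsec _ hX'
  have hdisc : ∀ b ∈ HypGeom.wedge B ((1 + k) * X), ∀ c ∈ HypGeom.rightHalfPlane,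
      ‖HypGeom.chartInv b c‖ ≤ 1 / K → g c ∈ D₁ := fun b hb c hc hbc =>
    hsub₀ (hXsub ⟨c, HypGeom.mem_wedge_of_norm_chartInv_le hr0 hr1 hX.le hk hb hB hc hbc, rfl⟩)
  have hmem : g '' HypGeom.wedge B ((1 + k) * X) ⊆ D₁ := by
    rintro _ ⟨b, hb, rfl⟩
    refine hdisc b hb b (HypGeom.wedge_subset hX' hb) ?_
    simpa [HypGeom.chartInv] using hr0
  have hle : ∀ z ∈ g '' HypGeom.wedge B ((1 + k) * X),
      HypGeom.hypDensity D₁ z ≤ K * HypGeom.hypDensity D₂ z := by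
    rintro _ ⟨b, hb, rfl⟩
    exact hg.hypDensity_le hf₁ hK (HypGeom.wedge_subset hX' hb) (hdisc b hb)
  refine ⟨t₁, ht₁, hsub.trans hmem, fun z hz => ⟨?_, hle z (hsub hz)⟩, fun z hz w hw => ⟨?_, ?_⟩⟩
  · exact HypGeom.hypDensity_anti hf₁ hh hD₁D₂ (hmem (hsub hz))
  · exact HypGeom.hypDist_anti hf₁ hh hD₁D₂ (hmem (hsub hz)) (hmem (hsub hw))
  · obtain ⟨a, ha, rfl⟩ := hsub hz
    obtain ⟨b, hb, rfl⟩ := hsub hw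
    exact hg.hypDist_le hf₁ hX' hmem hD₁D₂ hle ha hb
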